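/- Let $D\ge 0$ be an integer, $g\neq 0$ a real number, $m\in\mathbb R$, $(m_{ij})$ a real $D\times D$ matrix, and $\widetilde m_{ij}=m\,\delta_{ij}+m_{ij}$. Let $\mathrm{Cl}_D$ be the complex Clifford algebra with generators $\gamma^1,\dots,\gamma^D$, $\gamma^i\gamma^j+\gamma^j\gamma^i=-2\delta^{ij}$, with the inner product for which the monomials $\gamma^{i_1}\cdots\gamma^{i_k}$ ($i_1<\dots<i_k$) are orthonormal. For a real $D\times d$ matrix $W$ let $$H_W=-\Delta+g\sum_{i=1}^{D}\sum_{j=1}^{d}\gamma^i\,W_{ij}A_j$$ be the operator in $L^2(\mathbb R^d;\mathrm{Cl}_D)$, where the potential acts by left multiplication and the domain consists of all $u\in L^2$ whose distributional image $H_Wu$ is in $L^2$. (This operator is in general not self-adjoint, so its spectrum is a subset of $\mathbb C$.) Call the spectrum of a closed operator *discrete* if each of its points is an isolated point of the spectrum and an eigenvalue of finite algebraic multiplicity (finite-rank Riesz projection), and *bounded from below* if the real parts of its points are bounded from below. Then: 1. The spectrum of $H_{\widetilde m}=-\Delta_A+g\gamma^i\widetilde m_{ij}A_j$ in $L^2(\mathbb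 R^D;\mathrm{Cl}_D)$ is bounded from below. 2. If $m\neq 0$ and $m_{ij}=-m_{ji}$, the spectrum of $H_{\widetilde m}$ is discrete. 3. More generally, the spectrum of $H_{\widetilde m}$ is discrete whenever $\operatorname{rank}(\widetilde m)=D$. 4. For arbitrary $\widetilde m$ of rank $r$, let the columns of the $D\times r$ matrix $B$ be an orthonormal basis of $(\ker\widetilde m)^{\perp}$. Then the spectrum of $H_{\widetilde m B}$ in $L^2(\mathbb R^{r};\mathrm{Cl}_D)$ is discrete and bounded from below, and $$\sigma(H_{\widetilde m})=\{\lambda'+|p|^2:\ \lambda'\in\sigma(H_{\widetilde m B}),\ p\in\mathbb R^{D-r}\}.$$ -/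

import Mathlib

open MeasureTheory Metric
open scoped ContDiff Matrix

noncomputable section

/-! ### The complex Clifford algebra and the expansion in Clifford monomials -/

/-- The quadratic form `v ↦ -∑ v_i²` on `ℂ^D`. -/
def negQ (D : ℕ) : QuadraticForm ℂ (Fin D → ℂ) :=
  QuadraticMap.weightedSumSquares ℂ (fun _ : Fin D => (-1 : ℂ))

/-- The complex Clifford algebra with generators satisfying `γ_i γ_j + γ_j γ_i = -2 δ_ij`. -/
abbrev Cl (D : ℕ) : Type := CliffordAlgebra (negQ D)

/-- The generators `γ_i`. -/
def gam {D : ℕ} (i : Fin D) : Cl D := CliffordAlgebra.ι (negQ D) (Pi.single i 1)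

theorem gam_sq {D : ℕ} (i : Fin D) : gam i * gam i = (-1 : Cl D) := by
  have h : negQ D (Pi.single i 1) = -1 := by
    rw [negQ, QuadraticMap.weightedSumSquares_apply, Finset.sum_eq_single i]
    · simp
    · intro b _ hb
      simp [Pi.single_eq_of_ne hb]
    · simp
  rw [gam, CliffordAlgebra.ι_sq_scalar, h]
  simp

theorem gam_anticomm {D : ℕ} {i j : Fin D} (hij : i ≠ j) :
    gam i * gam j = -(gam j * gam i : Cl D) := by
  have h : QuadraticMap.polar (negQ D) (Pi.single i 1) (Pi.single j 1) = 0 := by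
    simp only [QuadraticMap.polar, negQ, QuadraticMap.weightedSumSquares_apply,
      ← Finset.sum_sub_distrib]
    refine Finset.sum_eq_zero fun k _ => ?_
    rcases eq_or_ne k i with rfl | hk
    · simp [Pi.single_eq_of_ne hij]
    · simp [Pi.single_eq_of_ne hk]
  have h2 := CliffordAlgebra.ι_mul_ι_add_swap (Q := negQ D) (Pi.single i 1) (Pi.single j 1)
  rw [h, map_zero] at h2
  exact eq_neg_of_add_eq_zero_left h2

/-- The Clifford monomial `γ_{i₁} γ_{i₂} ⋯ γ_{i_k}`, where `S = {i₁ < i₂ < ⋯ < i_k}`. -/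
def blade {D : ℕ} (S : Finset (Fin D)) : Cl D := ((S.sort (· ≤ ·)).map gam).prod

theorem blade_empty {D : ℕ} : blade (∅ : Finset (Fin D)) = 1 := by
  simp [blade]

theorem blade_insert {D : ℕ} {a : Fin D} {s : Finset (Fin D)} (h : ∀ x ∈ s, a < x) :
    blade (insert a s) = gam a * blade s := by
  have ha : a ∉ s := fun h' => lt_irrefl _ (h a h')
  rw [blade, Finset.sort_insert (· ≤ ·) (fun b hb => (h b hb).le) ha]
  simp [blade]

/-- The sign in `γ_i γ_S = ± γ_{S ∆ {i}}`. -/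
def bladeSign {D : ℕ} (i : Fin D) (S : Finset (Fin D)) : ℂ :=
  (-1) ^ (S.filter (· ≤ i)).card

/-- Left multiplication of a Clifford monomial by a generator. -/
theorem gam_mul_blade {D : ℕ} (S : Finset (Fin D)) :
    ∀ i : Fin D, gam i * blade S = bladeSign i S • blade (symmDiff S {i}) := by
  induction S using Finset.induction_on_min with
  | empty =>
    intro i
    have := blade_insert (a := i) (s := ∅) (by simp)
    simp only [insert_empty_eq] at this
    rw [show symmDiff (∅ : Finset (Fin D)) {i} = {i} from bot_symmDiff _, this]
    simp [bladeSign]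
  | insert a s h ih =>
    intro i
    have ha : a ∉ s := fun h' => lt_irrefl _ (h a h')
    rcases lt_trichotomy i a with hia | rfl | hai
    · have h1 : ∀ x ∈ insert a s, i < x := by
        intro x hx
        rcases Finset.mem_insert.1 hx with rfl | hx
        · exact hia
        · exact hia.trans (h x hx)
      have h2 : symmDiff (insert a s) {i} = insert i (insert a s) := by
        ext x
        have := h1 x
        simp only [Finset.mem_symmDiff, Finset.mem_singleton, Finset.mem_insert] at this ⊢
        by_cases hx : x = i
        · subst hx
          have h3 : ¬ (x = a ∨ x ∈ s) := fun h' => lt_irrefl _ (this h')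
          tauto
        · tauto
      have h3 : (insert a s).filter (· ≤ i) = ∅ :=
        Finset.filter_eq_empty_iff.2 fun x hx => not_le.2 (h1 x hx)
      rw [h2, blade_insert h1, bladeSign, h3]
      simp
    · have h2 : symmDiff (insert i s) {i} = s := by
        ext x
        simp only [Finset.mem_symmDiff, Finset.mem_singleton, Finset.mem_insert]
        by_cases hx : x = i
        · subst hx
          tauto
        · tauto
      have h3 : (insert i s).filter (· ≤ i) = {i} := by
        ext x
        have := h x
        simp only [Finset.mem_filter, Finset.mem_insert, Finset.mem_singleton]
        constructor
        · rintro ⟨rfl | hx, hle⟩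
          · rfl
          · exact absurd hle (not_le.2 (this hx))
        · rintro rfl
          exact ⟨Or.inl rfl, le_rfl⟩
      rw [h2, blade_insert h, bladeSign, h3, ← mul_assoc, gam_sq]
      simp
    · have h2 : symmDiff (insert a s) {i} = insert a (symmDiff s {i}) := by
        ext x
        simp only [Finset.mem_symmDiff, Finset.mem_singleton, Finset.mem_insert]
        by_cases hx : x = a
        · subst hx
          have := hai.ne
          tauto
        · tauto
      have h1 : ∀ x ∈ symmDiff s {i}, a < x := by
        intro x hx
        simp only [Finset.mem_symmDiff, Finset.mem_singleton] at hx
        rcases hx with ⟨hx, -⟩ | ⟨rfl, -⟩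
        · exact h x hx
        · exact hai
      have h3 : (insert a s).filter (· ≤ i) = insert a (s.filter (· ≤ i)) := by
        rw [Finset.filter_insert, if_pos hai.le]
      rw [h2, blade_insert h, blade_insert h1, ← mul_assoc, gam_anticomm hai.ne', neg_mul,
        mul_assoc, ih i, bladeSign, bladeSign, h3, Finset.card_insert_of_notMem (by simp [ha]),
        pow_succ]
      simp

theorem span_blade (D : ℕ) : (⊤ : Submodule ℂ (Cl D)) ≤ Submodule.span ℂ (Set.range blade) := by
  have key : ∀ x y : Cl D, y ∈ Submodule.span ℂ (Set.range (blade (D := D))) →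
      x * y ∈ Submodule.span ℂ (Set.range (blade (D := D))) := by
    intro x
    induction x using CliffordAlgebra.induction with
    | algebraMap r =>
      intro y hy
      rw [← Algebra.smul_def]
      exact Submodule.smul_mem _ _ hy
    | ι v =>
      intro y hy
      have hv : CliffordAlgebra.ι (negQ D) v = ∑ i, v i • gam i := by
        have : v = ∑ i, v i • (Pi.single i 1 : Fin D → ℂ) := by
          ext k
          simp [Finset.sum_apply, Pi.single_apply]
        conv_lhs => rw [this]
        simp [gam]
      rw [hv, Finset.sum_mul]
      refine Submodule.sum_mem _ fun i _ => ?_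
      rw [smul_mul_assoc]
      refine Submodule.smul_mem _ _ ?_
      induction hy using Submodule.span_induction with
      | mem z hz =>
        obtain ⟨S, rfl⟩ := hz
        rw [gam_mul_blade]
        exact Submodule.smul_mem _ _ (Submodule.subset_span ⟨_, rfl⟩)
      | zero => simp
      | add a b _ _ ha hb =>
        rw [mul_add]
        exact Submodule.add_mem _ ha hb
      | smul c a _ ha =>
        rw [mul_smul_comm]
        exact Submodule.smul_mem _ _ ha
    | mul a b ha hb =>
      intro y hy
      rw [mul_assoc]
      exact ha _ (hb _ hy)
    | add a b ha hb =>
      intro y hy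
      rw [add_mul]
      exact Submodule.add_mem _ (ha _ hy) (hb _ hy)
  intro x _
  have := key x 1 (Submodule.subset_span ⟨∅, blade_empty⟩)
  rwa [mul_one] at this

theorem finrank_Cl (D : ℕ) : Fintype.card (Finset (Fin D)) = Module.finrank ℂ (Cl D) := by
  rw [(CliffordAlgebra.equivExterior (negQ D)).finrank_eq,
    Module.finrank_eq_card_basis (Pi.basisFun ℂ (Fin D)).ExteriorAlgebra]

/-- The Clifford monomials `γ_S`, `S ⊆ {1, …, D}`, form a basis of the Clifford algebra. -/
def bladeBasis (D : ℕ) : Module.Basis (Finset (Fin D)) ℂ (Cl D) :=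
  basisOfTopLeSpanOfCardEqFinrank blade (span_blade D) (finrank_Cl D)

/-- The values of the wave functions: a Clifford number `∑_S ψ_S γ_S`, given by its complex
components `ψ_S`, with the inner product `∑_S conj φ_S * ψ_S`, which is the scalar part of
`Φ^† Ψ`. -/
abbrev ClVal (D : ℕ) : Type := EuclideanSpace ℂ (Finset (Fin D))

/-- Left multiplication by a Clifford number, in components. -/
def leftMul {D : ℕ} (x : Cl D) : ClVal D →L[ℂ] ClVal D :=
  Matrix.toEuclideanCLM (𝕜 := ℂ) (Algebra.leftMulMatrix (bladeBasis D) x)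

/-- In components, `leftMul x` is indeed `Ψ ↦ x Ψ`. -/
theorem leftMul_spec {D : ℕ} (x : Cl D) (ψ : ClVal D) :
    ∑ S, leftMul x ψ S • blade S = x * ∑ S, ψ S • blade S := by
  have hb : ∀ S, blade S = bladeBasis D S := by
    intro S
    simp [bladeBasis]
  have h1 : ∀ φ : ClVal D, ∑ S, φ S • blade S = (bladeBasis D).equivFun.symm φ.ofLp := by
    intro φ
    simp [Module.Basis.equivFun_symm_apply, hb]
  rw [h1, h1, LinearEquiv.symm_apply_eq]
  ext S
  have h2 := congrFun (Algebra.leftMulMatrix_mulVec_repr (bladeBasis D) x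
    ((bladeBasis D).equivFun.symm ψ.ofLp)) S
  have h3 : ⇑((bladeBasis D).repr ((bladeBasis D).equivFun.symm ψ.ofLp)) = ψ.ofLp :=
    (bladeBasis D).equivFun.apply_symm_apply ψ.ofLp
  rw [h3] at h2
  simpa [leftMul, Module.Basis.equivFun_apply] using h2

/-! ### The operator -/

/-- Square-integrable functions on `ℝ^d` with values in the Clifford algebra with `D`
generators. -/
abbrev WaveSpace (d D : ℕ) : Type :=
  Lp (ClVal D) 2 (volume : Measure (EuclideanSpace ℝ (Fin d)))

/-- The Clifford-valued linear potential `g ∑_{i,j} γ_i W_ij A_j`. -/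
def cliffordPotential {d D : ℕ} (g : ℝ) (W : Matrix (Fin D) (Fin d) ℝ)
    (A : EuclideanSpace ℝ (Fin d)) : Cl D :=
  (g : ℂ) • ∑ i, ∑ j, ((W i j * A j : ℝ) : ℂ) • gam i

/-- `-Δ u + g γ_i W_ij A_j u = f` in the sense of distributions on `ℝ^d`. -/
def WeakAiry {d D : ℕ} (g : ℝ) (W : Matrix (Fin D) (Fin d) ℝ) (u f : WaveSpace d D) : Prop :=
  ∀ φ : EuclideanSpace ℝ (Fin d) → ℝ, ContDiff ℝ ∞ φ → HasCompactSupport φ →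
    ∫ A, ((-(Laplacian.laplacian φ A)) • u A + φ A • leftMul (cliffordPotential g W A) (u A))
      = ∫ A, φ A • f A

theorem integrable_of_test {d : ℕ} {F : Type*} [NormedAddCommGroup F] [NormedSpace ℝ F]
    {h : EuclideanSpace ℝ (Fin d) → F} (hh : LocallyIntegrable h)
    {ψ : EuclideanSpace ℝ (Fin d) → ℝ} (hc : Continuous ψ) (hs : HasCompactSupport ψ) :
    Integrable (fun A => ψ A • h A) :=
  hh.integrable_smul_left_of_hasCompactSupport hc hs

theorem locInt {d D : ℕ} (u : WaveSpace d D) : LocallyIntegrable u :=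
  (Lp.memLp u).locallyIntegrable (by norm_num)

theorem continuous_laplacian {d : ℕ} {φ : EuclideanSpace ℝ (Fin d) → ℝ} (hφ : ContDiff ℝ ∞ φ) :
    Continuous (Laplacian.laplacian φ) := by
  rw [InnerProductSpace.laplacian_eq_iteratedFDeriv_stdOrthonormalBasis]
  refine continuous_finsetSum _ fun i _ => ?_
  have h := hφ.continuous_iteratedFDeriv (m := 2) (WithTop.coe_le_coe.2 le_top)
  fun_prop

theorem hasCompactSupport_laplacian {d : ℕ} {φ : EuclideanSpace ℝ (Fin d) → ℝ}
    (hs : HasCompactSupport φ) : HasCompactSupport (Laplacian.laplacian φ) := by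
  rw [InnerProductSpace.laplacian_eq_iteratedFDeriv_stdOrthonormalBasis]
  refine (hs.iteratedFDeriv (𝕜 := ℝ) 2).mono fun x hx hx' => hx ?_
  simp [hx']

theorem leftMul_potential {d D : ℕ} (g : ℝ) (W : Matrix (Fin D) (Fin d) ℝ)
    (A : EuclideanSpace ℝ (Fin d)) (ψ : ClVal D) :
    leftMul (cliffordPotential g W A) ψ =
      ∑ i, ∑ j, (g * (W i j * A j)) • leftMul (gam i) ψ := by
  simp only [cliffordPotential, Finset.smul_sum, smul_smul]
  rw [leftMul, map_sum, map_sum, sum_apply]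
  refine Finset.sum_congr rfl fun i _ => ?_
  rw [map_sum, map_sum, sum_apply]
  refine Finset.sum_congr rfl fun j _ => ?_
  rw [map_smul, map_smul, smul_apply, ← Complex.ofReal_mul]
  rfl

/-- All terms of the weak equation are integrable. -/
theorem integrable_potential {d D : ℕ} (g : ℝ) (W : Matrix (Fin D) (Fin d) ℝ)
    (u : WaveSpace d D) {φ : EuclideanSpace ℝ (Fin d) → ℝ} (hφ : ContDiff ℝ ∞ φ)
    (hs : HasCompactSupport φ) :
    Integrable (fun A => φ A • leftMul (cliffordPotential g W A) (u A)) := by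
  have h : (fun A => φ A • leftMul (cliffordPotential g W A) (u A)) =
      fun A => ∑ i, ∑ j, leftMul (gam i) ((φ A * (g * (W i j * A j))) • u A) := by
    funext A
    rw [leftMul_potential]
    simp only [Finset.smul_sum, smul_smul, ContinuousLinearMap.map_smul_of_tower]
  rw [h]
  refine integrable_finsetSum _ fun i _ => integrable_finsetSum _ fun j _ => ?_
  refine (leftMul (gam i)).integrable_comp
    (integrable_of_test (ψ := fun A => φ A * (g * (W i j * A j))) (locInt u) ?_ hs.mul_right)
  have := hφ.continuous
  fun_prop

theorem integrable_laplacian {d D : ℕ} (u : WaveSpace d D)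
    {φ : EuclideanSpace ℝ (Fin d) → ℝ} (hφ : ContDiff ℝ ∞ φ) (hs : HasCompactSupport φ) :
    Integrable (fun A => (-(Laplacian.laplacian φ A)) • u A) :=
  integrable_of_test (ψ := fun A => -(Laplacian.laplacian φ A)) (locInt u)
    (continuous_laplacian hφ).neg (hasCompactSupport_laplacian hs).neg

theorem WeakAiry.add {d D : ℕ} {g : ℝ} {W : Matrix (Fin D) (Fin d) ℝ}
    {u f u' f' : WaveSpace d D} (h : WeakAiry g W u f) (h' : WeakAiry g W u' f') :
    WeakAiry g W (u + u') (f + f') := by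
  intro φ hφ hs
  have e1 : ∫ A, φ A • (f + f') A = ∫ A, (φ A • f A + φ A • f' A) :=
    integral_congr_ae (by
      filter_upwards [Lp.coeFn_add f f'] with A hA
      rw [hA, Pi.add_apply, smul_add])
  have e2 : ∫ A, ((-(Laplacian.laplacian φ A)) • (u + u') A
        + φ A • leftMul (cliffordPotential g W A) ((u + u') A)) =
      ∫ A, (((-(Laplacian.laplacian φ A)) • u A
        + φ A • leftMul (cliffordPotential g W A) (u A)) +
        ((-(Laplacian.laplacian φ A)) • u' A
        + φ A • leftMul (cliffordPotential g W A) (u' A))) :=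
    integral_congr_ae (by
      filter_upwards [Lp.coeFn_add u u'] with A hA
      rw [hA, Pi.add_apply, map_add, smul_add, smul_add]
      abel)
  rw [e1, e2, integral_add (integrable_of_test (locInt f) hφ.continuous hs)
      (integrable_of_test (locInt f') hφ.continuous hs), ← h φ hφ hs, ← h' φ hφ hs]
  exact integral_add ((integrable_laplacian u hφ hs).add (integrable_potential g W u hφ hs))
      ((integrable_laplacian u' hφ hs).add (integrable_potential g W u' hφ hs))

theorem WeakAiry.smul {d D : ℕ} {g : ℝ} {W : Matrix (Fin D) (Fin d) ℝ}
    {u f : WaveSpace d D} (c : ℂ) (h : WeakAiry g W u f) : WeakAiry g W (c • u) (c • f) := by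
  intro φ hφ hs
  have e1 : ∫ A, φ A • (c • f) A = ∫ A, c • (φ A • f A) :=
    integral_congr_ae (by
      filter_upwards [Lp.coeFn_smul c f] with A hA
      rw [hA, Pi.smul_apply, smul_comm])
  have e2 : ∫ A, ((-(Laplacian.laplacian φ A)) • (c • u) A
        + φ A • leftMul (cliffordPotential g W A) ((c • u) A)) =
      ∫ A, c • ((-(Laplacian.laplacian φ A)) • u A
        + φ A • leftMul (cliffordPotential g W A) (u A)) :=
    integral_congr_ae (by
      filter_upwards [Lp.coeFn_smul c u] with A hA
      rw [hA, Pi.smul_apply, map_smul, smul_add, smul_comm c, smul_comm c])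
  rw [e1, e2, integral_smul, integral_smul, h φ hφ hs]

/-- The graph of `-Δ + g γ_i W_ij A_j` in `L²`, on the maximal domain. -/
def airyGraph {d D : ℕ} (g : ℝ) (W : Matrix (Fin D) (Fin d) ℝ) :
    Submodule ℂ (WaveSpace d D × WaveSpace d D) where
  carrier := {p | WeakAiry g W p.1 p.2}
  zero_mem' := by
    have h : WeakAiry g W (0 : WaveSpace d D) 0 := by
      intro φ _ _
      have h0 := Lp.coeFn_zero (ClVal D) 2 (volume : Measure (EuclideanSpace ℝ (Fin d)))
      refine integral_congr_ae ?_
      filter_upwards [h0] with A hA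
      rw [hA]
      simp
    exact h
  add_mem' := fun h h' => WeakAiry.add h h'
  smul_mem' := fun c _ h => WeakAiry.smul c h

/-- The operator `-Δ + g γ_i W_ij A_j` in `L²`, on its maximal domain: all `u ∈ L²` whose
distributional image is again in `L²`. -/
def airyOp {d D : ℕ} (g : ℝ) (W : Matrix (Fin D) (Fin d) ℝ) :
    WaveSpace d D →ₗ.[ℂ] WaveSpace d D :=
  (airyGraph g W).toLinearPMap

/-- The action of the operator: `u` is in the domain and is mapped to `f` if and only if
`-Δ u + g γ_i W_ij A_j u = f` in the sense of distributions. -/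
theorem mem_graph_airyOp {d D : ℕ} (g : ℝ) (W : Matrix (Fin D) (Fin d) ℝ)
    (u f : WaveSpace d D) : (u, f) ∈ (airyOp g W).graph ↔ WeakAiry g W u f := by
  rw [airyOp, Submodule.toLinearPMap_graph_eq]
  · rfl
  · rintro ⟨v, w⟩ (h : WeakAiry g W v w) (rfl : v = 0)
    change w = 0
    have h0 := Lp.coeFn_zero (ClVal D) 2 (volume : Measure (EuclideanSpace ℝ (Fin d)))
    refine Lp.eq_zero_iff_ae_eq_zero.2
      (ae_eq_zero_of_integral_contDiff_smul_eq_zero (locInt w) fun φ hφ hs => ?_)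
    rw [← h φ hφ hs]
    refine integral_eq_zero_of_ae ?_
    filter_upwards [h0] with A hA
    rw [hA]
    simp

/-! ### Spectrum of an unbounded operator -/

section Spectrum

variable {X : Type*} [NormedAddCommGroup X] [NormedSpace ℂ X]

/-- `R` is the bounded two-sided inverse of `T - z`: for all `u` and `f`, one has `u ∈ dom T` and
`T u - z u = f` if and only if `u = R f`. -/
def IsResolventAt (T : X →ₗ.[ℂ] X) (z : ℂ) (R : X →L[ℂ] X) : Prop :=
  ∀ u f : X, (u, f + z • u) ∈ T.graph ↔ u = R f

/-- The spectrum of an unbounded operator. -/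
def opSpectrum (T : X →ₗ.[ℂ] X) : Set ℂ := {z | ¬ ∃ R : X →L[ℂ] X, IsResolventAt T z R}

open Classical in
/-- The resolvent `(T - z)⁻¹` for `z` outside of the spectrum. -/
def opResolvent (T : X →ₗ.[ℂ] X) (z : ℂ) : X →L[ℂ] X :=
  if h : ∃ R : X →L[ℂ] X, IsResolventAt T z R then h.choose else 0

/-- `-(1 / 2πi) ∮ (T - z)⁻¹ dz` over the circle with centre `w` and radius `ε`. -/
def rieszProjection (T : X →ₗ.[ℂ] X) (w : ℂ) (ε : ℝ) : X →L[ℂ] X :=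
  -(2 * Real.pi * Complex.I : ℂ)⁻¹ • ∮ z in C(w, ε), opResolvent T z

/-- `w` is an isolated eigenvalue of finite algebraic multiplicity: it is an eigenvalue, an
isolated point of the spectrum, and the corresponding Riesz projection has finite rank. -/
def IsDiscreteEigenvalue (T : X →ₗ.[ℂ] X) (w : ℂ) : Prop :=
  (∃ u : X, u ≠ 0 ∧ (u, w • u) ∈ T.graph) ∧
  ∃ ε : ℝ, 0 < ε ∧ opSpectrum T ∩ closedBall w ε = {w} ∧
    FiniteDimensional ℂ (rieszProjection T w ε).range

/-- The spectrum is (purely) discrete: it consists of isolated eigenvalues of finite algebraic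
multiplicity. -/
def HasDiscreteSpectrum (T : X →ₗ.[ℂ] X) : Prop :=
  ∀ w ∈ opSpectrum T, IsDiscreteEigenvalue T w

/-- The spectrum of a (not necessarily self-adjoint) operator is bounded from below: the real
parts of its points are. -/
def SpectrumBoundedBelow (T : X →ₗ.[ℂ] X) : Prop :=
  ∃ c : ℝ, ∀ w ∈ opSpectrum T, c ≤ w.re

end Spectrum

end

/-!
The potential `V(A) = g γ_i W_ij A_j` has two algebraic properties. Left multiplication by a
generator is anti-Hermitian, so `V(A)` is anti-Hermitian; and by the Clifford relation it squares to
`-g² |W A|²`, so `|V(A) ψ| = |g| |W A| |ψ|`. In addition, `V` is linear in `A`, so all its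
commutators with mollifications and derivatives are harmless.

*Resolvent set.* Mollification followed by a cutoff shows that test functions are a core of the
maximal operator (`WeakSol.exists_test_approx`). Hence the maximal operators for `W` and `-W` are
adjoint to each other (`isAdjointGraph_airyOp`), and `z` is outside of the spectrum if and only if
the operator at `z` and the adjoint at the conjugate point satisfy a lower bound
(`notMem_opSpectrum_airyOp_iff`). Such bounds need only be verified on test functions. There the
real part of the quadratic form is the Dirichlet energy, which gives a lower bound for `re z < 0`:
the spectrum lies in the closed right half-plane (`spectrumBoundedBelow_airyOp`).

*Discreteness.* If `W` is injective, the operator controls the gradient (`dirichlet_le`) and the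
potential (`l2norm_potential_sq_le`), which now grows linearly in all directions. By a
Rellich-type argument the unit ball of the graph norm is almost finite-dimensional
(`exists_finiteDimensional_approx_test`), so the resolvent is compact, and Riesz theory yields a
discrete spectrum (`hasDiscreteSpectrum_of_compact_resolvent`). A matrix `m + (m_ij)` with
`m ≠ 0` and antisymmetric `m_ij` is injective, as `x · (m + m_ij) x = m |x|²`.

*Kernel directions.* In orthonormal coordinates adapted to the kernel, the operator is
`-Δ_x + V₁(x) - Δ_y`. A partial Fourier transform in `y` makes it the direct integral of the
operators `-Δ_x + V₁ + |p|²`, so lower bounds for these, uniform in `p`, imply one for the full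
operator (`TestBound.of_forall_split`); uniformity is automatic, by compactness for bounded `p` and
by accretivity for large `p` (`exists_uniform_testBound`). Conversely, tensor products with plane
waves under a wide cutoff transfer a lower bound to each of these operators
(`TestBound.of_split`). With the criterion for the resolvent set this determines the spectrum
(`opSpectrum_split`).
-/

open scoped Convolution Topology

set_option linter.unusedSectionVars false

/-! ### Compact operators and contour integrals of resolvents -/

section CompactSpectrum

open Filter Topology

variable {X : Type*} [NormedAddCommGroup X] [InnerProductSpace ℂ X]

/-- A compact operator has only finitely many eigenvalues outside of a disc around `0`: otherwise
Gram-Schmidt, applied to eigenvectors of distinct eigenvalues, would give an orthonormal sequence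
whose images keep a positive distance from each other. -/
theorem IsCompactOperator.finite_eigenvalues {K : X →L[ℂ] X} (hK : IsCompactOperator K)
    {δ : ℝ} (hδ : 0 < δ) :
    {z : ℂ | δ ≤ ‖z‖ ∧ Module.End.HasEigenvalue (K : X →ₗ[ℂ] X) z}.Finite := by
  by_contra hinf
  let z : ℕ → ℂ := fun n => Set.Infinite.natEmbedding _ hinf n
  have hzinj : Function.Injective z :=
    Subtype.val_injective.comp (Set.Infinite.natEmbedding _ hinf).injective
  have hz : ∀ n, δ ≤ ‖z n‖ ∧ Module.End.HasEigenvalue (K : X →ₗ[ℂ] X) (z n) :=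
    fun n => (Set.Infinite.natEmbedding _ hinf n).2
  choose u hu using fun n => (hz n).2.exists_hasEigenvector
  have hKu : ∀ n, K (u n) = z n • u n := fun n => (hu n).apply_eq_smul
  have hli : LinearIndependent ℂ u :=
    Module.End.eigenvectors_linearIndependent' (K : X →ₗ[ℂ] X) z hzinj u hu
  let e : ℕ → X := InnerProductSpace.gramSchmidtNormed ℂ u
  have he : Orthonormal ℂ e := InnerProductSpace.gramSchmidtNormed_orthonormal hli
  let M : ℕ → Submodule ℂ X := fun n => Submodule.span ℂ (u '' Set.Iio n)
  have hMe : ∀ n, M n = Submodule.span ℂ (e '' Set.Iio n) := fun n => by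
    rw [InnerProductSpace.span_gramSchmidtNormed, InnerProductSpace.span_gramSchmidt_Iio]
  have hMperp : ∀ n, ∀ x ∈ M n, inner ℂ (e n) x = 0 := by
    intro n x hx
    rw [hMe] at hx
    induction hx using Submodule.span_induction with
    | mem x hx =>
      obtain ⟨i, hi, rfl⟩ := hx
      exact he.2 (ne_of_gt hi)
    | zero => simp
    | add x y _ _ hx hy => rw [inner_add_right, hx, hy, add_zero]
    | smul c x _ hx => rw [inner_smul_right, hx, mul_zero]
  have hMK : ∀ n, ∀ x ∈ M n, K x ∈ M n := by
    intro n x hx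
    induction hx using Submodule.span_induction with
    | mem x hx =>
      obtain ⟨i, hi, rfl⟩ := hx
      rw [hKu]
      exact Submodule.smul_mem _ _ (Submodule.subset_span ⟨i, hi, rfl⟩)
    | zero => simp
    | add x y _ _ hx hy => rw [map_add]; exact Submodule.add_mem _ hx hy
    | smul c x _ hx => rw [map_smul]; exact Submodule.smul_mem _ _ hx
  have heM : ∀ n, e n ∈ M (n + 1) := fun n => by
    rw [hMe]
    exact Submodule.subset_span ⟨n, Nat.lt_succ_self n, rfl⟩
  have hshift : ∀ n, ∀ x ∈ M (n + 1), K x - z n • x ∈ M n := by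
    intro n x hx
    induction hx using Submodule.span_induction with
    | mem x hx =>
      obtain ⟨i, hi, rfl⟩ := hx
      rw [hKu, ← sub_smul]
      rcases Nat.lt_succ_iff_lt_or_eq.1 hi with h | rfl
      · exact Submodule.smul_mem _ _ (Submodule.subset_span ⟨i, h, rfl⟩)
      · simp
    | zero => simp
    | add x y _ _ hx hy =>
      rw [map_add, smul_add, add_sub_add_comm]
      exact Submodule.add_mem _ hx hy
    | smul c x _ hx =>
      rw [map_smul, smul_comm, ← smul_sub]
      exact Submodule.smul_mem _ _ hx
  have hMmono : Monotone M := fun i j hij =>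
    Submodule.span_mono (Set.image_mono (Set.Iio_subset_Iio hij))
  -- `K (e n) - K (e m)` is `z n • e n` up to a vector of `M n`, which is orthogonal to `e n`
  have hsep : ∀ m n, m < n → δ ≤ ‖K (e n) - K (e m)‖ := by
    intro m n hmn
    have h1 : inner ℂ (e n) (K (e n) - K (e m)) = z n := by
      have h2 := hMperp n _ (hshift n _ (heM n))
      have h3 := hMperp n _ (hMK n _ (hMmono (Nat.succ_le_of_lt hmn) (heM m)))
      rw [inner_sub_right, inner_smul_right, inner_self_eq_norm_sq_to_K, he.1 n] at h2
      rw [inner_sub_right, h3]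
      simpa [sub_eq_zero] using h2
    have h4 := norm_inner_le_norm (𝕜 := ℂ) (e n) (K (e n) - K (e m))
    rw [h1, he.1 n, one_mul] at h4
    exact (hz n).1.trans h4
  obtain ⟨C, hC, hC'⟩ := hK.image_closedBall_subset_compact (f := (K : X →ₗ[ℂ] X)) 1
  obtain ⟨y, _, ψ, hψ, hψy⟩ := hC.tendsto_subseq (x := fun n => K (e n))
    (fun n => hC' ⟨e n, by simp [he.1 n], rfl⟩)
  obtain ⟨N, hN⟩ := Metric.cauchySeq_iff'.1 hψy.cauchySeq δ hδ
  have h5 := hN (N + 1) (Nat.le_succ N)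
  rw [dist_eq_norm] at h5
  exact absurd h5 (not_lt.2 (hsep _ _ (hψ (Nat.lt_succ_self N))))

/-- An idempotent compact operator has finite rank. -/
theorem finiteDimensional_range_of_isCompactOperator_of_isIdempotentElem {P : X →L[ℂ] X}
    (hP : IsCompactOperator P) (hPP : IsIdempotentElem P) : FiniteDimensional ℂ P.range := by
  have hid : ∀ x ∈ P.range, P x = x := by
    rintro _ ⟨y, rfl⟩
    exact congrArg (fun Q : X →L[ℂ] X => Q y) hPP
  have hclosed : IsClosed (P.range : Set X) := by
    have : (P.range : Set X) = {x | P x = x} := by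
      ext x
      exact ⟨fun h => hid x h, fun h => ⟨x, h⟩⟩
    rw [this]
    exact isClosed_eq P.continuous continuous_id
  have hmaps : ∀ x ∈ P.range, (P : X →ₗ[ℂ] X) x ∈ P.range := fun x _ => ⟨x, rfl⟩
  have hc := IsCompactOperator.restrict (f := (P : X →ₗ[ℂ] X)) hP hmaps hclosed
  refine FiniteDimensional.of_isCompactOperator_id (𝕜 := ℂ) ?_
  convert! hc using 1
  ext x
  exact (hid x x.2).symm

end CompactSpectrum

section CircleProjection

variable {A : Type*} [NormedRing A] [NormedAlgebra ℂ A] [CompleteSpace A]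

theorem ContinuousLinearMap.circleIntegral_comp_comm {E F : Type*} [NormedAddCommGroup E]
    [NormedSpace ℂ E] [CompleteSpace E] [NormedAddCommGroup F] [NormedSpace ℂ F] [CompleteSpace F]
    (L : E →L[ℂ] F) {f : ℂ → E} {c : ℂ} {r : ℝ} (hf : CircleIntegrable f c r) :
    (∮ z in C(c, r), L (f z)) = L (∮ z in C(c, r), f z) := by
  rw [circleIntegral, circleIntegral, ← L.intervalIntegral_comp_comm hf.out]
  simp

theorem circleIntegral_inv_sub_of_notMem {c : ℂ} {r : ℝ} (hr : 0 < r) {z : ℂ}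
    (hz : z ∉ closedBall c r) : (∮ w in C(c, r), (z - w)⁻¹) = 0 := by
  refine Complex.circleIntegral_eq_zero_of_differentiable_on_off_countable hr.le
    Set.countable_empty ?_ ?_
  · refine ContinuousOn.inv₀ (by fun_prop) fun w hw h => hz ?_
    rwa [sub_eq_zero.1 h]
  · intro w hw
    refine DifferentiableAt.inv (by fun_prop) fun h => hz ?_
    rw [sub_eq_zero.1 h]
    exact ball_subset_closedBall hw.1

/-- The contour integral of a family satisfying the first resolvent identity is, up to the factor
`-2πi`, an idempotent: multiply the integrals over two concentric circles. -/
theorem circleIntegral_mul_self_of_resolvent_identity {R : ℂ → A} {c : ℂ} {r s : ℝ} (hr : 0 < r)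
    (hrs : r < s) (hcr : ContinuousOn R (sphere c r)) (hcs : ContinuousOn R (sphere c s))
    (hR : ∀ z ∈ sphere c s, ∀ w ∈ sphere c r, R z - R w = (z - w) • (R z * R w))
    (heq : (∮ z in C(c, s), R z) = ∮ z in C(c, r), R z) :
    (∮ z in C(c, s), R z) * (∮ z in C(c, s), R z)
      = -(2 * Real.pi * Complex.I : ℂ) • ∮ z in C(c, s), R z := by
  have hs : 0 < s := hr.trans hrs
  have hne : ∀ z ∈ sphere c s, ∀ w ∈ sphere c r, z - w ≠ 0 := by
    intro z hz w hw h
    rw [sub_eq_zero.1 h] at hz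
    rw [mem_sphere] at hz hw
    linarith
  have hout : ∀ z ∈ sphere c s, z ∉ closedBall c r := by
    intro z hz h
    rw [mem_sphere] at hz
    rw [mem_closedBall] at h
    linarith
  have hin : ∀ w ∈ sphere c r, w ∈ ball c s := by
    intro w hw
    rw [mem_sphere] at hw
    rw [mem_ball]
    linarith
  have hswap : (∮ z in C(c, s), ∮ w in C(c, r), (z - w)⁻¹ • R w)
      = ∮ w in C(c, r), ∮ z in C(c, s), (z - w)⁻¹ • R w := by
    simp only [circleIntegral, ← intervalIntegral.integral_smul]
    rw [intervalIntegral_intervalIntegral_swap]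
    · refine intervalIntegral.integral_congr fun θ _ => intervalIntegral.integral_congr fun φ _ => ?_
      exact smul_comm _ _ _
    · have hc : Continuous (Function.uncurry fun θ φ : ℝ => deriv (circleMap c s) θ •
          deriv (circleMap c r) φ • (circleMap c s θ - circleMap c r φ)⁻¹ • R (circleMap c r φ)) := by
        have hR' : Continuous fun φ : ℝ => R (circleMap c r φ) :=
          hcr.comp_continuous (continuous_circleMap c r) fun φ => circleMap_mem_sphere c hr.le φ
        have hi : Continuous fun p : ℝ × ℝ => (circleMap c s p.1 - circleMap c r p.2)⁻¹ :=
          Continuous.inv₀ (by fun_prop) fun p =>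
            hne _ (circleMap_mem_sphere c hs.le _) _ (circleMap_mem_sphere c hr.le _)
        simp only [deriv_circleMap, Function.uncurry_def]
        have hR2 : Continuous fun p : ℝ × ℝ => R (circleMap c r p.2) := hR'.comp continuous_snd
        exact Continuous.smul (by fun_prop) (Continuous.smul (by fun_prop) (hi.smul hR2))
      exact (hc.continuousOn.integrableOn_compact (isCompact_uIcc.prod isCompact_uIcc)).mono_set
        (Set.prod_mono Set.uIoc_subset_uIcc Set.uIoc_subset_uIcc)
  -- by the resolvent identity `R z * R w = (z - w)⁻¹ (R z - R w)`; the first term integrates to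
  -- zero in `w`, since `z` is outside of the smaller circle, the second one to `2πi R w` in `z`
  have h1 : ∀ z ∈ sphere c s, R z * (∮ w in C(c, r), R w)
      = -∮ w in C(c, r), (z - w)⁻¹ • R w := by
    intro z hz
    have e1 : R z * (∮ w in C(c, r), R w) = ∮ w in C(c, r), R z * R w :=
      ((ContinuousLinearMap.mul ℂ A (R z)).circleIntegral_comp_comm
        (hcr.circleIntegrable hr.le)).symm
    have e2 : (∮ w in C(c, r), R z * R w)
        = ∮ w in C(c, r), ((z - w)⁻¹ • R z - (z - w)⁻¹ • R w) := by
      refine circleIntegral.integral_congr hr.le fun w hw => ?_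
      have h := hR z hz w hw
      change _ = (z - w)⁻¹ • R z - (z - w)⁻¹ • R w
      rw [← smul_sub, h, smul_smul, inv_mul_cancel₀ (hne z hz w hw), one_smul]
    have hinv : ContinuousOn (fun w => (z - w)⁻¹) (sphere c r) :=
      ContinuousOn.inv₀ (by fun_prop) fun w hw => hne z hz w hw
    rw [e1, e2, circleIntegral.integral_sub (f := fun w => (z - w)⁻¹ • R z)
      (g := fun w => (z - w)⁻¹ • R w)
      ((hinv.smul continuousOn_const).circleIntegrable hr.le)
      ((hinv.smul hcr).circleIntegrable hr.le),
      circleIntegral.integral_smul_const, circleIntegral_inv_sub_of_notMem hr (hout z hz)]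
    simp
  have h2 : ∀ w ∈ sphere c r, (∮ z in C(c, s), (z - w)⁻¹ • R w)
      = (2 * Real.pi * Complex.I : ℂ) • R w := by
    intro w hw
    rw [circleIntegral.integral_smul_const, circleIntegral.integral_sub_inv_of_mem_ball (hin w hw)]
  have e3 : (∮ z in C(c, s), R z) * (∮ z in C(c, s), R z)
      = ∮ z in C(c, s), R z * (∮ w in C(c, r), R w) := by
    rw [← heq]
    exact (((ContinuousLinearMap.mul ℂ A).flip (∮ z in C(c, s), R z)).circleIntegral_comp_comm
        (hcs.circleIntegrable hs.le)).symm
  rw [e3, circleIntegral.integral_congr hs.le h1]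
  have e4 : (∮ z in C(c, s), -∮ w in C(c, r), (z - w)⁻¹ • R w)
      = -∮ z in C(c, s), ∮ w in C(c, r), (z - w)⁻¹ • R w := by
    simp [circleIntegral]
  rw [e4, hswap, circleIntegral.integral_congr hr.le h2, circleIntegral.integral_smul, heq, neg_smul]

end CircleProjection

/-! ### Unbounded operators with compact resolvent -/

section CompactResolvent

open Filter Topology

variable {X : Type*} [NormedAddCommGroup X] [InnerProductSpace ℂ X] {T : X →ₗ.[ℂ] X}

theorem IsResolventAt.unique {z : ℂ} {R R' : X →L[ℂ] X} (h : IsResolventAt T z R)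
    (h' : IsResolventAt T z R') : R = R' := by
  ext f
  exact (h' _ _).1 ((h _ f).2 rfl)

theorem opResolvent_eq {z : ℂ} {R : X →L[ℂ] X} (h : IsResolventAt T z R) :
    opResolvent T z = R := by
  have hex : ∃ R : X →L[ℂ] X, IsResolventAt T z R := ⟨R, h⟩
  rw [opResolvent, dif_pos hex]
  exact hex.choose_spec.unique h

theorem IsResolventAt.resolvent_identity {z w : ℂ} {R S : X →L[ℂ] X} (hR : IsResolventAt T z R)
    (hS : IsResolventAt T w S) : R - S = (z - w) • (R * S) := by
  ext f
  have h1 : (S f, (f + (w - z) • S f) + z • S f) ∈ T.graph := by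
    have := (hS (S f) f).2 rfl
    convert this using 2
    module
  have h2 := (hR _ _).1 h1
  rw [map_add, map_smul] at h2
  change R f - S f = (z - w) • R (S f)
  nth_rewrite 1 [h2]
  module

theorem mem_opSpectrum_of_eigenvector {z : ℂ} {u : X} (hu : u ≠ 0) (h : (u, z • u) ∈ T.graph) :
    z ∈ opSpectrum T := by
  rintro ⟨R, hR⟩
  refine hu ?_
  rw [(hR u 0).1 (by rwa [zero_add]), map_zero]

/-- `(T - z)⁻¹` in terms of `K = (T - a)⁻¹`. -/
theorem IsResolventAt.of_isUnit {a z : ℂ} {K : X →L[ℂ] X} (hK : IsResolventAt T a K)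
    (hu : IsUnit (1 - (z - a) • K)) :
    IsResolventAt T z (K * Ring.inverse (1 - (z - a) • K)) := by
  have hcomm : K * Ring.inverse (1 - (z - a) • K) = Ring.inverse (1 - (z - a) • K) * K := by
    have : Commute K (1 - (z - a) • K) :=
      (Commute.one_right K).sub_right ((Commute.refl K).smul_right _)
    calc K * Ring.inverse (1 - (z - a) • K)
        = Ring.inverse (1 - (z - a) • K) * ((1 - (z - a) • K) * K) *
            Ring.inverse (1 - (z - a) • K) := by
          rw [← mul_assoc, Ring.inverse_mul_cancel _ hu, one_mul]
      _ = Ring.inverse (1 - (z - a) • K) * K := by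
          rw [← this.eq, mul_assoc, mul_assoc, Ring.mul_inverse_cancel _ hu, mul_one]
  intro u f
  have h1 : (u, f + z • u) = (u, (f + (z - a) • u) + a • u) := by
    congr 1
    module
  have h2 : u = K (f + (z - a) • u) ↔ (1 - (z - a) • K) u = K f := by
    rw [map_add, map_smul]
    change _ ↔ u - (z - a) • K u = K f
    rw [sub_eq_iff_eq_add]
  rw [h1, hK, h2, hcomm]
  constructor
  · intro h
    change u = Ring.inverse (1 - (z - a) • K) (K f)
    rw [← h]
    exact (congrArg (fun Q : X →L[ℂ] X => Q u) (Ring.inverse_mul_cancel _ hu)).symm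
  · intro h
    rw [h]
    exact congrArg (fun Q : X →L[ℂ] X => Q (K f)) (Ring.mul_inverse_cancel _ hu)

variable [CompleteSpace X]

/-- The Fredholm alternative for an operator with compact resolvent. -/
theorem isUnit_or_eigenvector {a : ℂ} {K : X →L[ℂ] X} (hK : IsResolventAt T a K)
    (hc : IsCompactOperator K) (z : ℂ) :
    IsUnit (1 - (z - a) • K) ∨
      (z ≠ a ∧ Module.End.HasEigenvalue (K : X →ₗ[ℂ] X) (z - a)⁻¹ ∧
        ∃ u : X, u ≠ 0 ∧ (u, z • u) ∈ T.graph) := by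
  rcases eq_or_ne z a with rfl | hza
  · left
    simp
  have hne : (z - a)⁻¹ ≠ 0 := inv_ne_zero (sub_ne_zero.2 hza)
  rcases hc.hasEigenvalue_or_mem_resolventSet hne with h | h
  · right
    refine ⟨hza, h, ?_⟩
    obtain ⟨u, hu⟩ := h.exists_hasEigenvector
    have hKu : K u = (z - a)⁻¹ • u := hu.apply_eq_smul
    refine ⟨u, hu.2, ?_⟩
    have h3 := (hK u ((z - a) • u)).2 (by
      rw [map_smul, hKu, smul_smul, mul_inv_cancel₀ (sub_ne_zero.2 hza), one_smul])
    convert h3 using 2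
    module
  · left
    rw [spectrum.mem_resolventSet_iff] at h
    have h4 : (1 - (z - a) • K) =
        (algebraMap ℂ (X →L[ℂ] X) (z - a)) * (algebraMap ℂ (X →L[ℂ] X) (z - a)⁻¹ - K) := by
      rw [mul_sub, ← map_mul, mul_inv_cancel₀ (sub_ne_zero.2 hza), map_one, ← Algebra.smul_def]
    rw [h4]
    exact ((IsUnit.mk0 _ (sub_ne_zero.2 hza)).map _).mul h

/-- An operator with compact resolvent `K = (T - a)⁻¹` has discrete spectrum. The map
`z ↦ (z - a)⁻¹` sends spectral points to eigenvalues of `K`, which accumulate only at `0`; the Riesz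
projection is an idempotent and contains `K` as a factor, hence is compact. -/
theorem hasDiscreteSpectrum_of_compact_resolvent {a : ℂ} {K : X →L[ℂ] X}
    (hK : IsResolventAt T a K) (hc : IsCompactOperator K) : HasDiscreteSpectrum T := by
  have hspec : ∀ z, z ∈ opSpectrum T → z ≠ a ∧
      Module.End.HasEigenvalue (K : X →ₗ[ℂ] X) (z - a)⁻¹ ∧
        ∃ u : X, u ≠ 0 ∧ (u, z • u) ∈ T.graph := by
    intro z hz
    rcases isUnit_or_eigenvector hK hc z with h | h
    · exact absurd ⟨_, hK.of_isUnit h⟩ hz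
    · exact h
  have hunit : ∀ z, z ∉ opSpectrum T → IsUnit (1 - (z - a) • K) := by
    intro z hz
    rcases isUnit_or_eigenvector hK hc z with h | ⟨_, _, u, hu, h⟩
    · exact h
    · exact absurd (mem_opSpectrum_of_eigenvector hu h) hz
  intro w hw
  refine ⟨(hspec w hw).2.2, ?_⟩
  have hfin : (opSpectrum T ∩ closedBall w 1).Finite := by
    have hpos : 0 < (‖w - a‖ + 1)⁻¹ := by positivity
    refine Set.Finite.of_finite_image ((hc.finite_eigenvalues hpos).subset ?_)
      (f := fun z => (z - a)⁻¹) ?_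
    · rintro _ ⟨z, ⟨hz, hzw⟩, rfl⟩
      obtain ⟨hza, he, -⟩ := hspec z hz
      refine ⟨?_, he⟩
      rw [norm_inv]
      refine inv_anti₀ (norm_pos_iff.2 (sub_ne_zero.2 hza)) ?_
      rw [mem_closedBall, dist_eq_norm] at hzw
      calc ‖z - a‖ = ‖(w - a) + (z - w)‖ := by congr 1; ring
        _ ≤ ‖w - a‖ + ‖z - w‖ := norm_add_le _ _
        _ ≤ _ := by gcongr
    · intro x _ y _ hxy
      exact sub_left_injective (inv_injective hxy)
  obtain ⟨ε, hε, hεw⟩ : ∃ ε : ℝ, 0 < ε ∧ opSpectrum T ∩ closedBall w ε = {w} := by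
    have hcl : IsClosed ((opSpectrum T ∩ closedBall w 1) \ {w}) :=
      (hfin.subset Set.sdiff_subset).isClosed
    have hmem : ((opSpectrum T ∩ closedBall w 1) \ {w})ᶜ ∈ 𝓝 w :=
      hcl.isOpen_compl.mem_nhds (by simp)
    obtain ⟨r, hr, hrs⟩ := Metric.nhds_basis_closedBall.mem_iff.1 hmem
    refine ⟨min r 1, lt_min hr one_pos, Set.Subset.antisymm ?_ ?_⟩
    · rintro z ⟨hz, hzr⟩
      by_contra hzw
      exact hrs (closedBall_subset_closedBall (min_le_left _ _) hzr)
        ⟨⟨hz, closedBall_subset_closedBall (min_le_right _ _) hzr⟩, hzw⟩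
    · rintro _ rfl
      exact ⟨hw, mem_closedBall_self (le_min hr.le one_pos.le)⟩
  refine ⟨ε, hε, hεw, ?_⟩
  -- the resolvent at `z` is `K * S z`
  let S : ℂ → X →L[ℂ] X := fun z => Ring.inverse (1 - (z - a) • K)
  have hnot : ∀ z ∈ closedBall w ε \ {w}, z ∉ opSpectrum T := by
    rintro z ⟨hz, hzw⟩ h
    have : z ∈ opSpectrum T ∩ closedBall w ε := ⟨h, hz⟩
    rw [hεw] at this
    exact hzw this
  have hres : ∀ z ∈ closedBall w ε \ {w}, IsResolventAt T z (K * S z) :=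
    fun z hz => hK.of_isUnit (hunit z (hnot z hz))
  have hSd : ∀ z ∈ closedBall w ε \ {w}, DifferentiableAt ℂ S z := by
    intro z hz
    obtain ⟨x, hx⟩ := hunit z (hnot z hz)
    have h1 : DifferentiableAt ℂ Ring.inverse (1 - (z - a) • K) := by
      rw [← hx]
      exact differentiableAt_inverse (𝕜 := ℂ) x.isUnit
    exact h1.comp z (f := fun z : ℂ => 1 - (z - a) • K) (by fun_prop)
  have hsphere : ∀ r : ℝ, 0 < r → r ≤ ε → sphere w r ⊆ closedBall w ε \ {w} := by
    intro r hr hrε z hz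
    refine ⟨sphere_subset_closedBall.trans (closedBall_subset_closedBall hrε) hz, ?_⟩
    rintro rfl
    rw [mem_sphere, dist_self] at hz
    exact hr.ne hz
  have hScont : ∀ r : ℝ, 0 < r → r ≤ ε → ContinuousOn S (sphere w r) := fun r hr hrε z hz =>
    (hSd z (hsphere r hr hrε hz)).continuousAt.continuousWithinAt
  have hI : (∮ z in C(w, ε), opResolvent T z) = ∮ z in C(w, ε), K * S z :=
    circleIntegral.integral_congr hε.le fun z hz =>
      opResolvent_eq (hres z (hsphere ε hε le_rfl hz))
  have hI2 : (∮ z in C(w, ε), K * S z) = K * ∮ z in C(w, ε), S z :=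
    (ContinuousLinearMap.mul ℂ (X →L[ℂ] X) K).circleIntegral_comp_comm
      ((hScont ε hε le_rfl).circleIntegrable hε.le)
  have hdef : rieszProjection T w ε
      = -(2 * Real.pi * Complex.I : ℂ)⁻¹ • ∮ z in C(w, ε), K * S z := by
    rw [rieszProjection, hI]
  apply finiteDimensional_range_of_isCompactOperator_of_isIdempotentElem
  -- compactness: the factor `K` can be taken out of the integral
  · rw [hdef, hI2]
    have h : IsCompactOperator (K * ∮ z in C(w, ε), S z) :=
      hc.comp_clm (∮ z in C(w, ε), S z)
    exact h.smul _
  -- idempotence: compare the circles of radius `ε` and `ε / 2`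
  · have hpi : (2 * Real.pi * Complex.I : ℂ) ≠ 0 := Complex.two_pi_I_ne_zero
    have hsq := circleIntegral_mul_self_of_resolvent_identity (R := fun z => K * S z) (c := w)
      (half_pos hε) (half_lt_self hε)
      (continuousOn_const.mul (hScont _ (half_pos hε) (half_le_self hε.le)))
      (continuousOn_const.mul (hScont _ hε le_rfl))
      (fun z hz z' hz' => (hres z (hsphere ε hε le_rfl hz)).resolvent_identity
        (hres z' (hsphere _ (half_pos hε) (half_le_self hε.le) hz')))
      (Complex.circleIntegral_eq_of_differentiable_on_annulus_off_countable (half_pos hε)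
        (half_le_self hε.le) Set.countable_empty
        (fun z hz => ((hSd z ⟨hz.1, by
            rintro rfl
            exact hz.2 (mem_ball_self (half_pos hε))⟩).continuousAt.const_mul
              K).continuousWithinAt)
        (fun z hz => (hSd z ⟨ball_subset_closedBall hz.1.1, by
            rintro rfl
            exact hz.1.2 (mem_closedBall_self (half_pos hε).le)⟩).const_mul K))
    rw [IsIdempotentElem, hdef, smul_mul_smul_comm, hsq, smul_smul]
    congr 1
    field_simp

end CompactResolvent

/-! ### Mutually adjoint operators: resolvent set and compactness of the resolvent -/

section LowerBounds

open Filter Topology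

variable {X : Type*} [NormedAddCommGroup X] [InnerProductSpace ℂ X]

/-- `T - z` is injective with a bounded inverse on its range. Negative values of `C` are harmless:
they force the domain to be trivial. -/
def BoundedBelowAt (T : X →ₗ.[ℂ] X) (z : ℂ) : Prop :=
  ∃ C : ℝ, ∀ u f : X, (u, f) ∈ T.graph → ‖u‖ ≤ C * ‖f - z • u‖

/-- `T'` is the adjoint of `T`, stated on graphs; `T` is not assumed to be densely defined. -/
def IsAdjointGraph (T T' : X →ₗ.[ℂ] X) : Prop :=
  ∀ v k : X, (v, k) ∈ T'.graph ↔ ∀ u f : X, (u, f) ∈ T.graph → inner ℂ f v = inner ℂ u k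

theorem IsResolventAt.boundedBelowAt {T : X →ₗ.[ℂ] X} {z : ℂ} {R : X →L[ℂ] X}
    (h : IsResolventAt T z R) : BoundedBelowAt T z := by
  refine ⟨‖R‖, fun u f huf => ?_⟩
  have h1 : u = R (f - z • u) := (h _ _).1 (by rwa [sub_add_cancel])
  nth_rewrite 1 [h1]
  exact R.le_opNorm _

theorem IsAdjointGraph.isClosed {T T' : X →ₗ.[ℂ] X} (h : IsAdjointGraph T T') :
    IsClosed (T'.graph : Set (X × X)) := by
  have : (T'.graph : Set (X × X)) =
      ⋂ p ∈ T.graph, {q : X × X | inner ℂ p.2 q.1 = inner ℂ p.1 q.2} := by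
    ext ⟨v, k⟩
    simp only [SetLike.mem_coe, h v k, Set.mem_iInter, Set.mem_ofPred_eq, Prod.forall]
  rw [this]
  refine isClosed_biInter fun p _ => isClosed_eq ?_ ?_ <;> fun_prop

variable [CompleteSpace X]

theorem IsResolventAt.adjoint_boundedBelowAt {T T' : X →ₗ.[ℂ] X} (h : IsAdjointGraph T T') {z : ℂ}
    {R : X →L[ℂ] X} (hR : IsResolventAt T z R) : BoundedBelowAt T' (starRingEnd ℂ z) := by
  refine ⟨‖ContinuousLinearMap.adjoint R‖, fun v k hvk => ?_⟩
  have h1 : v = ContinuousLinearMap.adjoint R (k - starRingEnd ℂ z • v) := by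
    refine ext_inner_left ℂ fun x => ?_
    have h2 := (h v k).1 hvk _ _ ((hR (R x) x).2 rfl)
    rw [ContinuousLinearMap.adjoint_inner_right, inner_sub_right, inner_smul_right, ← h2,
      inner_add_left, inner_smul_left, add_sub_cancel_right]
  nth_rewrite 1 [h1]
  exact ContinuousLinearMap.le_opNorm _ _

/-- The lower bound for `T` makes `T - z` injective with closed range, and the lower bound for its
adjoint makes the orthogonal complement of the range trivial. -/
theorem exists_isResolventAt {T T' : X →ₗ.[ℂ] X} (h : IsAdjointGraph T T')
    (h' : IsAdjointGraph T' T) {z : ℂ} (hz : BoundedBelowAt T z)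
    (hz' : BoundedBelowAt T' (starRingEnd ℂ z)) : ∃ R : X →L[ℂ] X, IsResolventAt T z R := by
  obtain ⟨C, hC⟩ := hz
  obtain ⟨C', hC'⟩ := hz'
  have hcl := h'.isClosed
  have : CompleteSpace T.graph := hcl.completeSpace_coe
  let L : T.graph →L[ℂ] X :=
    (ContinuousLinearMap.snd ℂ X X - z • ContinuousLinearMap.fst ℂ X X).comp T.graph.subtypeL
  have hL : ∀ p : T.graph, L p = p.1.2 - z • p.1.1 := fun p => rfl
  have hanti : ∃ c, AntilipschitzWith c L := by
    refine ⟨Real.toNNReal (|C| + (1 + ‖z‖ * |C|)), ?_⟩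
    refine AddMonoidHomClass.antilipschitz_of_bound L fun p => ?_
    rw [Real.coe_toNNReal _ (by positivity)]
    have h1 : ‖p.1.1‖ ≤ |C| * ‖L p‖ :=
      (hC _ _ p.2).trans (mul_le_mul_of_nonneg_right (le_abs_self C) (norm_nonneg _))
    have h2 : ‖p.1.2‖ ≤ (1 + ‖z‖ * |C|) * ‖L p‖ := by
      have : p.1.2 = L p + z • p.1.1 := by rw [hL, sub_add_cancel]
      calc ‖p.1.2‖ ≤ ‖L p‖ + ‖z‖ * ‖p.1.1‖ := by
            rw [this]; exact (norm_add_le _ _).trans_eq (by rw [norm_smul])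
        _ ≤ ‖L p‖ + ‖z‖ * (|C| * ‖L p‖) := by gcongr
        _ = _ := by ring
    change max ‖p.1.1‖ ‖p.1.2‖ ≤ _
    have h0 := mul_nonneg (norm_nonneg z) (abs_nonneg C)
    refine max_le (h1.trans ?_) (h2.trans ?_)
    · exact mul_le_mul_of_nonneg_right (by linarith) (norm_nonneg _)
    · exact mul_le_mul_of_nonneg_right (by linarith [abs_nonneg C]) (norm_nonneg _)
  obtain ⟨c, hc⟩ := hanti
  -- a vector orthogonal to the range of `T - z` is in the kernel of the adjoint, which is trivial
  have hrange : L.range = ⊤ := by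
    have hclosed : IsClosed (L.range : Set X) := by
      have := hc.isClosed_range L.uniformContinuous
      rwa [LinearMap.coe_range]
    have : CompleteSpace L.range := hclosed.completeSpace_coe
    rw [← Submodule.orthogonal_eq_bot_iff, Submodule.eq_bot_iff]
    intro v hv
    have hgr : (v, starRingEnd ℂ z • v) ∈ T'.graph := by
      rw [h]
      intro u f huf
      have h3 := (Submodule.mem_orthogonal _ _).1 hv _ (LinearMap.mem_range_self _ ⟨(u, f), huf⟩)
      change inner ℂ (f - z • u) v = 0 at h3
      rw [inner_sub_left, inner_smul_left, sub_eq_zero] at h3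
      rw [h3, inner_smul_right]
    have := hC' _ _ hgr
    rwa [sub_self, norm_zero, mul_zero, norm_le_zero_iff] at this
  let e : T.graph ≃L[ℂ] X := ContinuousLinearEquiv.ofBijective L
    (LinearMap.ker_eq_bot.2 hc.injective) hrange
  have he : ∀ p, e p = L p := fun p => rfl
  refine ⟨((ContinuousLinearMap.fst ℂ X X).comp T.graph.subtypeL).comp e.symm.toContinuousLinearMap,
    fun u f => ⟨fun huf => ?_, fun huf => ?_⟩⟩
  · have : e ⟨_, huf⟩ = f := by
      rw [he, hL]
      simp
    change u = (e.symm f).1.1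
    rw [← this, e.symm_apply_apply]
  · change u = (e.symm f).1.1 at huf
    have h1 : L (e.symm f) = f := e.apply_symm_apply f
    have h2 : (e.symm f).1.2 = f + z • (e.symm f).1.1 := by
      rw [hL] at h1
      exact sub_eq_iff_eq_add.1 h1
    rw [huf, ← h2]
    exact (e.symm f).2

/-- For mutually adjoint operators `T`, `T'`, a point `z` is in the resolvent set of `T` if and only
if `T - z` and its adjoint are bounded below. -/
theorem notMem_opSpectrum_iff {T T' : X →ₗ.[ℂ] X} (h : IsAdjointGraph T T')
    (h' : IsAdjointGraph T' T) (z : ℂ) :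
    z ∉ opSpectrum T ↔ BoundedBelowAt T z ∧ BoundedBelowAt T' (starRingEnd ℂ z) := by
  rw [opSpectrum, Set.mem_ofPred_eq, not_not]
  exact ⟨fun ⟨R, hR⟩ => ⟨hR.boundedBelowAt, hR.adjoint_boundedBelowAt h⟩,
    fun ⟨h1, h2⟩ => exists_isResolventAt h h' h1 h2⟩

/-- The resolvent is compact if the unit ball of the graph norm is, up to arbitrarily small
errors, contained in finite-dimensional subspaces. -/
theorem IsResolventAt.isCompactOperator {T : X →ₗ.[ℂ] X} {z : ℂ} {K : X →L[ℂ] X}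
    (hK : IsResolventAt T z K)
    (happ : ∀ ε : ℝ, 0 < ε → ∃ S : Submodule ℂ X, FiniteDimensional ℂ S ∧
      ∀ u f : X, (u, f) ∈ T.graph → ∃ v ∈ S, ‖u - v‖ ≤ ε * (‖u‖ + ‖f‖)) :
    IsCompactOperator K := by
  -- the projections of `K` to the approximating subspaces have finite rank and converge to `K`
  have hmem : K ∈ closure {f : X →L[ℂ] X | IsCompactOperator f} := by
    rw [Metric.mem_closure_iff]
    intro δ hδ
    let C : ℝ := ‖K‖ + (1 + ‖z‖ * ‖K‖)
    have hCpos : 0 < C := by positivity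
    obtain ⟨S, hS, hSa⟩ := happ (δ / (2 * C)) (by positivity)
    refine ⟨S.starProjection ∘L K, ?_, ?_⟩
    · have : ProperSpace S := FiniteDimensional.proper ℂ S
      have h1 : IsCompactOperator (S.subtypeL : S →L[ℂ] X) :=
        isCompactOperator_of_locallyCompactSpace_rng S.subtypeL
      exact h1.comp_clm (S.orthogonalProjectionOnto ∘L K)
    · rw [dist_eq_norm]
      refine lt_of_le_of_lt (ContinuousLinearMap.opNorm_le_bound _ (M := δ / 2) (by positivity)
        fun x => ?_) (half_lt_self hδ)
      obtain ⟨v, hv, hvu⟩ := hSa _ _ ((hK (K x) x).2 rfl)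
      have h2 : ‖K x - S.starProjection (K x)‖ ≤ ‖K x - v‖ := by
        rw [S.starProjection_minimal]
        exact ciInf_le ⟨0, by rintro _ ⟨y, rfl⟩; exact norm_nonneg _⟩ (⟨v, hv⟩ : S)
      have h3 : ‖K x‖ + ‖x + z • K x‖ ≤ C * ‖x‖ := by
        have h4 := K.le_opNorm x
        calc ‖K x‖ + ‖x + z • K x‖ ≤ ‖K‖ * ‖x‖ + (‖x‖ + ‖z‖ * (‖K‖ * ‖x‖)) := by
              refine add_le_add h4 ((norm_add_le _ _).trans ?_)
              rw [norm_smul]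
              gcongr
          _ = C * ‖x‖ := by ring
      calc ‖K x - S.starProjection (K x)‖ ≤ δ / (2 * C) * (C * ‖x‖) :=
            (h2.trans hvu).trans (by gcongr)
        _ = δ / 2 * ‖x‖ := by field_simp
  rwa [isClosed_setOfPred_isCompactOperator.closure_eq] at hmem

end LowerBounds

/-! ### The Clifford potential -/

section CliffordPotential

variable {D d : ℕ}

theorem symmDiff_singleton_twice (i : Fin D) (S : Finset (Fin D)) :
    symmDiff (symmDiff S {i}) {i} = S := symmDiff_symmDiff_cancel_right _ _

theorem bladeSign_symmDiff (i : Fin D) (S : Finset (Fin D)) :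
    bladeSign i (symmDiff S {i}) = -bladeSign i S := by
  have key : ∀ S : Finset (Fin D), i ∉ S → bladeSign i (symmDiff S {i}) = -bladeSign i S := by
    intro S hi
    have h1 : (symmDiff S {i}).filter (· ≤ i) = insert i (S.filter (· ≤ i)) := by
      ext x
      simp only [Finset.mem_filter, Finset.mem_symmDiff, Finset.mem_singleton, Finset.mem_insert]
      by_cases hx : x = i
      · subst hx
        simp [hi]
      · simp [hx]
    rw [bladeSign, bladeSign, h1, Finset.card_insert_of_notMem (by simp [hi]), pow_succ]
    ring
  by_cases hi : i ∈ S
  · have h2 := key (symmDiff S {i}) (by simp [Finset.mem_symmDiff, hi])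
    rw [symmDiff_singleton_twice] at h2
    rw [h2, neg_neg]
  · exact key S hi

theorem bladeBasis_apply (S : Finset (Fin D)) : bladeBasis D S = blade S := by
  simp [bladeBasis]

theorem leftMul_gam_apply (i : Fin D) (ψ : ClVal D) (T : Finset (Fin D)) :
    leftMul (gam i) ψ T = -(bladeSign i T * ψ (symmDiff T {i})) := by
  have h1 := leftMul_spec (gam i) ψ
  rw [Finset.mul_sum] at h1
  have h2 : ∑ S, gam i * ψ S • blade S =
      ∑ T : Finset (Fin D), (-(bladeSign i T * ψ (symmDiff T {i}))) • blade T := by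
    refine Finset.sum_nbij' (fun S => symmDiff S {i}) (fun S => symmDiff S {i}) (by simp) (by simp)
      (by simp) (by simp) fun S _ => ?_
    rw [mul_smul_comm, gam_mul_blade, smul_smul, symmDiff_singleton_twice, bladeSign_symmDiff]
    congr 1
    ring
  rw [h2] at h1
  simp only [← bladeBasis_apply] at h1
  have h3 := congrArg (fun x => (bladeBasis D).repr x T) h1
  simpa only [Module.Basis.repr_sum_self] using h3

/-- The generators act as anti-Hermitian matrices. -/
theorem inner_leftMul_gam (i : Fin D) (ψ φ : ClVal D) :
    inner ℂ (leftMul (gam i) ψ) φ = -inner ℂ ψ (leftMul (gam i) φ) := by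
  simp only [PiLp.inner_apply, RCLike.inner_apply, leftMul_gam_apply, ← Finset.sum_neg_distrib]
  refine Finset.sum_nbij' (fun S => symmDiff S {i}) (fun S => symmDiff S {i}) (by simp) (by simp)
      (by simp) (by simp) fun S _ => ?_
  rw [symmDiff_singleton_twice, bladeSign_symmDiff]
  have : starRingEnd ℂ (bladeSign i S) = bladeSign i S := by simp [bladeSign]
  rw [map_neg, map_mul, this]
  ring

/-- The potential `A ↦ g γ_i W_ij A_j`, as a linear function of the position with values
in the endomorphisms. -/
noncomputable def cliffordPot (g : ℝ) (W : Matrix (Fin D) (Fin d) ℝ) :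
    EuclideanSpace ℝ (Fin d) →ₗ[ℝ] ClVal D →L[ℂ] ClVal D where
  toFun A := leftMul (cliffordPotential g W A)
  map_add' A B := by
    ext ψ : 1
    simp only [leftMul_potential, add_apply, PiLp.add_apply, mul_add, add_smul,
      Finset.sum_add_distrib]
  map_smul' c A := by
    ext ψ : 1
    simp only [leftMul_potential, smul_apply, PiLp.smul_apply, smul_eq_mul, Finset.smul_sum,
      smul_smul, RingHom.id_apply]
    refine Finset.sum_congr rfl fun i _ => Finset.sum_congr rfl fun j _ => ?_
    congr 1
    ring

theorem cliffordPot_apply (g : ℝ) (W : Matrix (Fin D) (Fin d) ℝ) (A : EuclideanSpace ℝ (Fin d)) :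
    cliffordPot g W A = leftMul (cliffordPotential g W A) := rfl

theorem cliffordPot_neg (g : ℝ) (W : Matrix (Fin D) (Fin d) ℝ) :
    cliffordPot g (-W) = -cliffordPot g W := by
  ext A ψ : 2
  simp only [LinearMap.neg_apply, neg_apply, cliffordPot_apply, leftMul_potential, Matrix.neg_apply,
    neg_mul, mul_neg, neg_smul, Finset.sum_neg_distrib]

theorem inner_cliffordPot (g : ℝ) (W : Matrix (Fin D) (Fin d) ℝ) (A : EuclideanSpace ℝ (Fin d))
    (ψ φ : ClVal D) :
    inner ℂ (cliffordPot g W A ψ) φ = -inner ℂ ψ (cliffordPot g W A φ) := by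
  simp only [cliffordPot_apply, leftMul_potential, sum_inner, inner_sum, ← Finset.sum_neg_distrib]
  refine Finset.sum_congr rfl fun i _ => Finset.sum_congr rfl fun j _ => ?_
  rw [← Complex.coe_smul, ← Complex.coe_smul, inner_smul_left, inner_smul_right, inner_leftMul_gam]
  simp

/-- The Clifford relation: the potential squares to the scalar `-g² |W A|²`. -/
theorem cliffordPot_sq (g : ℝ) (W : Matrix (Fin D) (Fin d) ℝ) (A : EuclideanSpace ℝ (Fin d))
    (ψ : ClVal D) :
    cliffordPot g W A (cliffordPot g W A ψ) =
      (-(g ^ 2 * ∑ i, (W *ᵥ A.ofLp) i ^ 2 : ℝ) : ℂ) • ψ := by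
  have h1 : cliffordPotential g W A =
      CliffordAlgebra.ι (negQ D) (fun i => ((g * (W *ᵥ A.ofLp) i : ℝ) : ℂ)) := by
    have : (fun i => ((g * (W *ᵥ A.ofLp) i : ℝ) : ℂ)) =
        ∑ i, ((g * (W *ᵥ A.ofLp) i : ℝ) : ℂ) • (Pi.single i 1 : Fin D → ℂ) := by
      ext k
      simp [Finset.sum_apply, Pi.single_apply]
    rw [this, map_sum, cliffordPotential, Finset.smul_sum]
    refine Finset.sum_congr rfl fun i _ => ?_
    rw [← Finset.sum_smul, smul_smul, map_smul, gam]
    congr 1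
    simp [Matrix.mulVec, dotProduct]
  have h2 : leftMul (cliffordPotential g W A * cliffordPotential g W A) ψ =
      cliffordPot g W A (cliffordPot g W A ψ) := by
    rw [cliffordPot_apply, leftMul, map_mul, map_mul]
    rfl
  rw [← h2, h1, CliffordAlgebra.ι_sq_scalar, leftMul, AlgHom.commutes,
    Algebra.algebraMap_eq_smul_one, map_smul, map_one, smul_apply, one_apply_eq_self]
  congr 1
  rw [negQ, QuadraticMap.weightedSumSquares_apply]
  push_cast
  rw [Finset.mul_sum, ← Finset.sum_neg_distrib]
  refine Finset.sum_congr rfl fun i _ => ?_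
  rw [smul_eq_mul]
  ring

theorem norm_cliffordPot (g : ℝ) (W : Matrix (Fin D) (Fin d) ℝ) (A : EuclideanSpace ℝ (Fin d))
    (ψ : ClVal D) :
    ‖cliffordPot g W A ψ‖ ^ 2 = (g ^ 2 * ∑ i, (W *ᵥ A.ofLp) i ^ 2) * ‖ψ‖ ^ 2 := by
  have h := inner_cliffordPot g W A ψ (cliffordPot g W A ψ)
  rw [cliffordPot_sq, inner_smul_right, inner_self_eq_norm_sq_to_K, inner_self_eq_norm_sq_to_K,
    neg_mul, neg_neg] at h
  refine Complex.ofReal_injective ?_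
  simpa using h

/-- If `W` is injective, the potential grows linearly at infinity: `|V(A) ψ| = |g| |W A| |ψ|`. -/
theorem exists_le_norm_cliffordPot {g : ℝ} (hg : g ≠ 0) {W : Matrix (Fin D) (Fin d) ℝ}
    (hW : Function.Injective W.mulVec) :
    ∃ c : ℝ, 0 < c ∧ ∀ (A : EuclideanSpace ℝ (Fin d)) (ψ : ClVal D),
      c * (‖A‖ * ‖ψ‖) ≤ ‖cliffordPot g W A ψ‖ := by
  let L : EuclideanSpace ℝ (Fin d) →ₗ[ℝ] EuclideanSpace ℝ (Fin D) := W.toEuclideanLin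
  have hL : ∀ A, (L A).ofLp = W *ᵥ A.ofLp := fun A => by simp [L]
  have hLinj : Function.Injective L := fun x y h => by
    have h1 := congrArg WithLp.ofLp h
    rw [hL, hL] at h1
    exact WithLp.ofLp_injective 2 (hW h1)
  obtain ⟨K, hK, hKL⟩ := (LinearMap.injective_iff_antilipschitz L).1 hLinj
  have hK' : (0 : ℝ) < K := hK
  refine ⟨|g| / K, div_pos (abs_pos.2 hg) hK', fun A ψ => ?_⟩
  have h1 : ‖A‖ ≤ K * ‖L A‖ := by
    simpa using hKL.le_mul_dist A 0
  have h2 : ‖cliffordPot g W A ψ‖ = |g| * ‖L A‖ * ‖ψ‖ := by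
    rw [← sq_eq_sq₀ (norm_nonneg _) (by positivity), norm_cliffordPot, mul_pow, mul_pow, sq_abs,
      EuclideanSpace.real_norm_sq_eq, hL]
  rw [h2]
  calc |g| / K * (‖A‖ * ‖ψ‖) ≤ |g| / K * ((K * ‖L A‖) * ‖ψ‖) := by gcongr
    _ = |g| * ‖L A‖ * ‖ψ‖ := by field_simp

end CliffordPotential

/-! ### Calculus of smooth functions with compact support -/

section Calculus

variable {E : Type*} [NormedAddCommGroup E] [InnerProductSpace ℝ E] [FiniteDimensional ℝ E]
  {G G₁ G₂ : Type*} [NormedAddCommGroup G] [NormedSpace ℝ G]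
  [NormedAddCommGroup G₁] [NormedSpace ℝ G₁] [NormedAddCommGroup G₂] [NormedSpace ℝ G₂]

/-- The derivative in the direction `v`. -/
noncomputable def dirDeriv (v : E) (f : E → G) (x : E) : G := fderiv ℝ f x v

theorem contDiff_dirDeriv (v : E) {f : E → G} (hf : ContDiff ℝ ∞ f) :
    ContDiff ℝ ∞ (dirDeriv v f) :=
  (hf.fderiv_right (m := ∞) (by simp)).clm_apply contDiff_const

theorem hasCompactSupport_dirDeriv (v : E) {f : E → G} (hf : HasCompactSupport f) :
    HasCompactSupport (dirDeriv v f) :=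
  hf.fderiv_apply (𝕜 := ℝ) v

theorem laplacian_eq_sum_dirDeriv {ι : Type*} [Fintype ι] (b : OrthonormalBasis ι ℝ E) {f : E → G}
    (hf : ContDiff ℝ ∞ f) (x : E) :
    Laplacian.laplacian f x = ∑ i, dirDeriv (b i) (dirDeriv (b i) f) x := by
  rw [InnerProductSpace.laplacian_eq_iteratedFDeriv_orthonormalBasis f b]
  refine Finset.sum_congr rfl fun i _ => ?_
  rw [iteratedFDeriv_two_apply]
  have hd : DifferentiableAt ℝ (fderiv ℝ f) x :=
    ((hf.fderiv_right (m := 1) (by norm_cast)).differentiable (by norm_num)) x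
  have h1 : dirDeriv (b i) f = fun y => fderiv ℝ f y (b i) := rfl
  rw [dirDeriv, h1, fderiv_clm_apply hd (differentiableAt_const _)]
  simp

theorem contDiff_laplacian {f : E → G} (hf : ContDiff ℝ ∞ f) :
    ContDiff ℝ ∞ (Laplacian.laplacian f) := by
  have h : Laplacian.laplacian f = fun x =>
      ∑ i, dirDeriv (stdOrthonormalBasis ℝ E i) (dirDeriv (stdOrthonormalBasis ℝ E i) f) x :=
    funext (laplacian_eq_sum_dirDeriv _ hf)
  rw [h]
  exact ContDiff.sum fun i _ => contDiff_dirDeriv _ (contDiff_dirDeriv _ hf)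

theorem HasCompactSupport.laplacian {f : E → G} (hf : HasCompactSupport f) :
    HasCompactSupport (Laplacian.laplacian f) := by
  rw [InnerProductSpace.laplacian_eq_iteratedFDeriv_stdOrthonormalBasis]
  refine (hf.iteratedFDeriv (𝕜 := ℝ) 2).mono fun x hx hx' => hx ?_
  simp [hx']

theorem dirDeriv_comp_smul {f : E → ℝ} (hf : ContDiff ℝ ∞ f) (a : ℝ) (v : E) :
    dirDeriv v (fun y => f (a • y)) = fun y => a * dirDeriv v f (a • y) := by
  funext y
  have h1 : HasFDerivAt (fun y : E => a • y) (a • ContinuousLinearMap.id ℝ E) y :=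
    (a • ContinuousLinearMap.id ℝ E).hasFDerivAt
  have h2 := (hf.differentiable (by simp) (a • y)).hasFDerivAt.comp y h1
  rw [dirDeriv]
  refine (congrArg (fun M : E →L[ℝ] ℝ => M v) h2.fderiv).trans ?_
  simp [dirDeriv]

theorem laplacian_comp_smul {f : E → ℝ} (hf : ContDiff ℝ ∞ f) (a : ℝ) (y : E) :
    Laplacian.laplacian (fun y => f (a • y)) y = a * (a * Laplacian.laplacian f (a • y)) := by
  let b := stdOrthonormalBasis ℝ E
  have hfa : ContDiff ℝ ∞ fun y => f (a • y) := hf.comp (contDiff_const_smul a)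
  rw [laplacian_eq_sum_dirDeriv b hfa, laplacian_eq_sum_dirDeriv b hf, Finset.mul_sum,
    Finset.mul_sum]
  refine Finset.sum_congr rfl fun i _ => ?_
  have h1 : dirDeriv (b i) (fun y => f (a • y)) = a • fun y => dirDeriv (b i) f (a • y) :=
    dirDeriv_comp_smul hf a _
  have h2 : ContDiff ℝ ∞ fun y => dirDeriv (b i) f (a • y) :=
    (contDiff_dirDeriv _ hf).comp (contDiff_const_smul a)
  have h3 := dirDeriv_comp_smul (contDiff_dirDeriv (b i) hf) a (b i)
  rw [h1, dirDeriv, fderiv_const_smul (h2.differentiable (by simp) y)]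
  exact congrArg (a * ·) (congrFun h3 y)

variable [MeasurableSpace E] [BorelSpace E]

theorem integrable_bilin (B : G₁ →L[ℝ] G₂ →L[ℝ] G) {f : E → G₁} {g : E → G₂} (hf : Continuous f)
    (hg : Continuous g) (h : HasCompactSupport f ∨ HasCompactSupport g) :
    Integrable fun x => B (f x) (g x) := by
  refine (by fun_prop : Continuous fun x => B (f x) (g x)).integrable_of_hasCompactSupport ?_
  rcases h with h | h
  · exact h.mono fun x hx hx' => hx (by simp [hx'])
  · exact h.mono fun x hx hx' => hx (by simp [hx'])

/-- Integration by parts for a bilinear pairing. -/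
theorem integral_dirDeriv_right (B : G₁ →L[ℝ] G₂ →L[ℝ] G) {f : E → G₁} {g : E → G₂}
    (hf : ContDiff ℝ ∞ f) (hg : ContDiff ℝ ∞ g) (h : HasCompactSupport f ∨ HasCompactSupport g)
    (v : E) :
    ∫ x, B (f x) (dirDeriv v g x) = -∫ x, B (dirDeriv v f x) (g x) := by
  have h1 : HasCompactSupport (dirDeriv v f) ∨ HasCompactSupport g :=
    h.imp_left (hasCompactSupport_dirDeriv v)
  have h2 : HasCompactSupport f ∨ HasCompactSupport (dirDeriv v g) :=
    h.imp_right (hasCompactSupport_dirDeriv v)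
  exact integral_bilinear_hasLineDerivAt_right_eq_neg_left_of_integrable
    (integrable_bilin B (contDiff_dirDeriv v hf).continuous hg.continuous h1)
    (integrable_bilin B hf.continuous (contDiff_dirDeriv v hg).continuous h2)
    (integrable_bilin B hf.continuous hg.continuous h)
    (fun x _ => ((hf.differentiable (by simp)) x).hasFDerivAt.hasLineDerivAt v)
    (fun x _ => ((hg.differentiable (by simp)) x).hasFDerivAt.hasLineDerivAt v)

theorem integral_bilin_laplacian (B : G₁ →L[ℝ] G₂ →L[ℝ] G) {f : E → G₁} {g : E → G₂}
    (hf : ContDiff ℝ ∞ f) (hg : ContDiff ℝ ∞ g) (h : HasCompactSupport f ∨ HasCompactSupport g)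
    {ι : Type*} [Fintype ι] (b : OrthonormalBasis ι ℝ E) :
    ∫ x, B (f x) (Laplacian.laplacian g x) =
      -∑ i, ∫ x, B (dirDeriv (b i) f x) (dirDeriv (b i) g x) := by
  simp only [laplacian_eq_sum_dirDeriv b hg, map_sum]
  rw [integral_finsetSum, ← Finset.sum_neg_distrib]
  · exact Finset.sum_congr rfl fun i _ =>
      integral_dirDeriv_right B hf (contDiff_dirDeriv _ hg)
        (h.imp_right (hasCompactSupport_dirDeriv _)) _
  · exact fun i _ => integrable_bilin B hf.continuous
      (contDiff_dirDeriv _ (contDiff_dirDeriv _ hg)).continuous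
      (h.imp_right fun h => hasCompactSupport_dirDeriv _ (hasCompactSupport_dirDeriv _ h))

theorem integral_laplacian_bilin (B : G₁ →L[ℝ] G₂ →L[ℝ] G) {f : E → G₁} {g : E → G₂}
    (hf : ContDiff ℝ ∞ f) (hg : ContDiff ℝ ∞ g) (h : HasCompactSupport f ∨ HasCompactSupport g)
    {ι : Type*} [Fintype ι] (b : OrthonormalBasis ι ℝ E) :
    ∫ x, B (Laplacian.laplacian f x) (g x) =
      -∑ i, ∫ x, B (dirDeriv (b i) f x) (dirDeriv (b i) g x) :=
  integral_bilin_laplacian B.flip hg hf h.symm b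

end Calculus

/-! ### The weak equation -/

section Weak

variable {E : Type*} [NormedAddCommGroup E] [InnerProductSpace ℝ E] [FiniteDimensional ℝ E]
  [MeasurableSpace E] [BorelSpace E]
  {F : Type*} [NormedAddCommGroup F] [InnerProductSpace ℂ F]

/-- `-Δ u + V u = f` in the sense of distributions, for a potential `V` that is linear in the
position. Test functions are scalar, so this is `WeakAiry` on plain functions. -/
def WeakSol (V : E →L[ℝ] F →L[ℂ] F) (u f : E → F) : Prop :=
  ∀ φ : E → ℝ, ContDiff ℝ ∞ φ → HasCompactSupport φ →
    ∫ x, ((-(Laplacian.laplacian φ x)) • u x + φ x • V x (u x)) = ∫ x, φ x • f x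

/-- `-Δ φ + V φ` for a smooth function `φ`. -/
noncomputable def airy (V : E →L[ℝ] F →L[ℂ] F) (φ : E → F) (x : E) : F :=
  -(Laplacian.laplacian φ x) + V x (φ x)

/-- Test functions: smooth functions with compact support. -/
def IsTest {G : Type*} [NormedAddCommGroup G] [NormedSpace ℝ G] (φ : E → G) : Prop :=
  ContDiff ℝ ∞ φ ∧ HasCompactSupport φ

theorem continuous_potential (V : E →L[ℝ] F →L[ℂ] F) {u : E → F} (hu : Continuous u) :
    Continuous fun x => V x (u x) :=
  V.continuous.clm_apply hu

theorem contDiff_potential (V : E →L[ℝ] F →L[ℂ] F) {u : E → F} (hu : ContDiff ℝ ∞ u) :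
    ContDiff ℝ ∞ fun x => V x (u x) := by
  let L : E →L[ℝ] F →L[ℝ] F := (ContinuousLinearMap.restrictScalarsL ℂ F F ℝ ℝ).comp V
  exact L.contDiff.clm_apply hu

theorem contDiff_airy (V : E →L[ℝ] F →L[ℂ] F) {φ : E → F} (hφ : ContDiff ℝ ∞ φ) :
    ContDiff ℝ ∞ (airy V φ) :=
  (contDiff_laplacian hφ).neg.add (contDiff_potential V hφ)

theorem isTest_airy (V : E →L[ℝ] F →L[ℂ] F) {φ : E → F} (hφ : IsTest φ) : IsTest (airy V φ) :=
  ⟨contDiff_airy V hφ.1, hφ.2.laplacian.neg.add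
    (hφ.2.mono fun x hx hx' => hx (by simp [hx']))⟩

theorem IsTest.memLp {φ : E → F} (hφ : IsTest φ) : MemLp φ 2 :=
  hφ.1.continuous.memLp_of_hasCompactSupport hφ.2

/-- Smooth functions are weak solutions. -/
theorem weakSol_airy (V : E →L[ℝ] F →L[ℂ] F) {u : E → F} (hu : ContDiff ℝ ∞ u) :
    WeakSol V u (airy V u) := by
  intro φ hφ hs
  let B : ℝ →L[ℝ] F →L[ℝ] F := ContinuousLinearMap.lsmul ℝ ℝ
  have hB : ∀ (a : ℝ) (x : F), B a x = a • x := fun a x => rfl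
  have h1 : ∫ x, (-(Laplacian.laplacian φ x)) • u x = ∫ x, φ x • (-(Laplacian.laplacian u x)) := by
    simp only [neg_smul, smul_neg, integral_neg]
    congr 1
    have h2 := integral_bilin_laplacian B hφ hu (Or.inl hs) (stdOrthonormalBasis ℝ E)
    have h3 := integral_laplacian_bilin B hφ hu (Or.inl hs) (stdOrthonormalBasis ℝ E)
    exact h3.trans h2.symm
  have hint := fun {a : E → ℝ} {g : E → F} (ha : Continuous a) (hg : Continuous g)
    (h : HasCompactSupport a) => integrable_bilin B ha hg (Or.inl h)
  simp only [hB] at hint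
  simp only [airy, smul_add]
  rw [integral_add, integral_add, h1]
  · exact hint hφ.continuous (contDiff_laplacian hu).neg.continuous hs
  · exact hint hφ.continuous (continuous_potential V hu.continuous) hs
  · exact hint (contDiff_laplacian hφ).neg.continuous hu.continuous hs.laplacian.neg
  · exact hint hφ.continuous (continuous_potential V hu.continuous) hs

end Weak

/-! ### The `L²` norm and Minkowski's integral inequality -/

section L2

variable {α : Type*} [MeasureSpace α] {G : Type*} [NormedAddCommGroup G]

/-- The `L²`-norm of a function, as a real number; it is `0` for functions of infinite norm, so
estimates carry the hypothesis `MemLp u 2`. -/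
noncomputable def l2norm (u : α → G) : ℝ := (eLpNorm u 2 volume).toReal

theorem eLpNorm_two_sq (u : α → G) :
    eLpNorm u 2 volume ^ 2 = ∫⁻ x, ‖u x‖ₑ ^ 2 := by
  have h := eLpNorm_nnreal_pow_eq_lintegral (f := u) (μ := (volume : Measure α)) (p := 2) two_ne_zero
  have h2 : (((2 : NNReal) : ℝ)) = ((2 : ℕ) : ℝ) := by norm_num
  simp only [h2, ENNReal.rpow_natCast] at h
  exact_mod_cast h

theorem l2norm_nonneg (u : α → G) : 0 ≤ l2norm u := ENNReal.toReal_nonneg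

theorem l2norm_congr {u v : α → G} (h : u =ᵐ[volume] v) : l2norm u = l2norm v := by
  rw [l2norm, l2norm, eLpNorm_congr_ae h]

theorem norm_toLp_eq_l2norm {u : α → G} (hu : MemLp u 2) : ‖hu.toLp u‖ = l2norm u := by
  rw [Lp.norm_toLp, l2norm]

theorem norm_eq_l2norm (u : Lp G 2 (volume : Measure α)) : ‖u‖ = l2norm u := rfl

theorem l2norm_add_le {u v : α → G} (hu : MemLp u 2) (hv : MemLp v 2) :
    l2norm (u + v) ≤ l2norm u + l2norm v := by
  rw [← norm_toLp_eq_l2norm hu, ← norm_toLp_eq_l2norm hv, ← norm_toLp_eq_l2norm (hu.add hv),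
    MemLp.toLp_add]
  exact norm_add_le _ _

theorem l2norm_neg (u : α → G) : l2norm (-u) = l2norm u := by
  rw [l2norm, eLpNorm_neg, l2norm]

theorem l2norm_sub_le {u v : α → G} (hu : MemLp u 2) (hv : MemLp v 2) :
    l2norm (u - v) ≤ l2norm u + l2norm v := by
  rw [sub_eq_add_neg, ← l2norm_neg v]
  exact l2norm_add_le hu hv.neg

theorem l2norm_const_smul {𝕜 : Type*} [NormedField 𝕜] [NormedSpace 𝕜 G] (c : 𝕜) (u : α → G) :
    l2norm (c • u) = ‖c‖ * l2norm u := by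
  rw [l2norm, eLpNorm_const_smul, ENNReal.toReal_mul, l2norm, toReal_enorm]

theorem ofReal_l2norm_sq {u : α → G} (hu : MemLp u 2) :
    ENNReal.ofReal (l2norm u ^ 2) = ∫⁻ x, ‖u x‖ₑ ^ 2 := by
  rw [← eLpNorm_two_sq, ENNReal.ofReal_pow (l2norm_nonneg u), l2norm,
    ENNReal.ofReal_toReal hu.eLpNorm_ne_top]

theorem l2norm_sq {u : α → G} (hu : MemLp u 2) : l2norm u ^ 2 = ∫ x, ‖u x‖ ^ 2 := by
  rw [integral_eq_lintegral_of_nonneg_ae (f := fun x => ‖u x‖ ^ 2)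
    (.of_forall fun x => by positivity) (hu.aestronglyMeasurable.norm.pow 2)]
  have h : ∀ x, ENNReal.ofReal (‖u x‖ ^ 2) = ‖u x‖ₑ ^ 2 := fun x => by
    rw [ENNReal.ofReal_pow (norm_nonneg _), ofReal_norm]
  simp only [h, ← ofReal_l2norm_sq hu]
  rw [ENNReal.toReal_ofReal (by positivity)]

theorem memLp_of_lintegral_le {u : α → G} (hu : AEStronglyMeasurable u volume) {c : ℝ}
    (hc : 0 ≤ c) (h : ∫⁻ x, ‖u x‖ₑ ^ 2 ≤ ENNReal.ofReal (c ^ 2)) : MemLp u 2 ∧ l2norm u ≤ c := by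
  rw [← eLpNorm_two_sq, ENNReal.ofReal_pow hc] at h
  have h2 : eLpNorm u 2 volume ≤ ENNReal.ofReal c := by
    by_contra hcon
    exact absurd h (not_le.2 (ENNReal.pow_lt_pow_left two_ne_zero (not_le.1 hcon)))
  exact ⟨⟨hu, h2.trans_lt ENNReal.ofReal_lt_top⟩, ENNReal.toReal_le_of_le_ofReal hc h2⟩

theorem l2norm_mono {H : Type*} [NormedAddCommGroup H] {u : α → G} {v : α → H} (hv : MemLp v 2)
    (h : ∀ x, ‖u x‖ ≤ ‖v x‖) : l2norm u ≤ l2norm v :=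
  ENNReal.toReal_mono hv.eLpNorm_ne_top (eLpNorm_mono h)

/-- Minkowski's integral inequality in `L²`, in the form of the Cauchy-Schwarz inequality. -/
theorem lintegral_enorm_integral_sq_le {β : Type*} [MeasureSpace β] [SFinite (volume : Measure α)]
    [SFinite (volume : Measure β)] [NormedSpace ℝ G] {k : β → ℝ} {g : α → β → G}
    (hk : AEMeasurable k)
    (hg : AEStronglyMeasurable (Function.uncurry g) (volume.prod volume)) :
    ∫⁻ x, ‖∫ y, k y • g x y‖ₑ ^ 2 ≤ (∫⁻ y, ‖k y‖ₑ) * ∫⁻ y, ‖k y‖ₑ * ∫⁻ x, ‖g x y‖ₑ ^ 2 := by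
  have hk' : AEMeasurable (fun y => ‖k y‖ₑ) := hk.enorm
  have hpt : ∀ᵐ x : α, ‖∫ y, k y • g x y‖ₑ ^ 2 ≤
      (∫⁻ y, ‖k y‖ₑ) * ∫⁻ y, ‖k y‖ₑ * ‖g x y‖ₑ ^ 2 := by
    filter_upwards [hg.prodMk_left] with x hx
    have hgx : AEMeasurable (fun y => ‖g x y‖ₑ) := hx.enorm
    have h1 : ‖∫ y, k y • g x y‖ₑ ≤ ∫⁻ y, ‖k y‖ₑ ^ (1 / 2 : ℝ) * (‖k y‖ₑ ^ (1 / 2 : ℝ) * ‖g x y‖ₑ) := by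
      refine (enorm_integral_le_lintegral_enorm _).trans (lintegral_mono fun y => ?_)
      rw [enorm_smul, ← mul_assoc, ← ENNReal.rpow_add_of_nonneg _ _ (by norm_num) (by norm_num)]
      norm_num
    have h2 := ENNReal.lintegral_mul_le_Lp_mul_Lq volume Real.HolderConjugate.two_two
      (hk'.pow_const (1 / 2 : ℝ)) ((hk'.pow_const (1 / 2 : ℝ)).mul hgx)
    have h3 := h1.trans h2
    calc ‖∫ y, k y • g x y‖ₑ ^ 2 ≤ _ := pow_le_pow_left' h3 2
      _ = _ := by
        rw [mul_pow, ← ENNReal.rpow_natCast, ← ENNReal.rpow_natCast, ← ENNReal.rpow_mul,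
          ← ENNReal.rpow_mul]
        norm_num
        congr 1
        · refine lintegral_congr fun y => ?_
          rw [← ENNReal.rpow_natCast, ← ENNReal.rpow_mul]
          norm_num
        · refine lintegral_congr fun y => ?_
          rw [mul_pow, ← ENNReal.rpow_natCast (‖k y‖ₑ ^ _), ← ENNReal.rpow_mul]
          norm_num
  calc ∫⁻ x, ‖∫ y, k y • g x y‖ₑ ^ 2
      ≤ ∫⁻ x, (∫⁻ y, ‖k y‖ₑ) * ∫⁻ y, ‖k y‖ₑ * ‖g x y‖ₑ ^ 2 := lintegral_mono_ae hpt
    _ = (∫⁻ y, ‖k y‖ₑ) * ∫⁻ x, ∫⁻ y, ‖k y‖ₑ * ‖g x y‖ₑ ^ 2 := by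
        rw [lintegral_const_mul'']
        have : AEMeasurable (Function.uncurry fun x y => ‖k y‖ₑ * ‖g x y‖ₑ ^ 2)
            ((volume : Measure α).prod volume) :=
          (hk'.comp_snd).mul (hg.enorm.pow_const 2)
        exact this.lintegral_prod_right'
    _ = _ := by
        congr 1
        rw [lintegral_lintegral_swap]
        · refine lintegral_congr_ae ?_
          filter_upwards [hg.prod_swap.prodMk_left] with y hy
          rw [lintegral_const_mul'']
          exact hy.enorm.pow_const 2
        · exact (hk'.comp_snd).mul (hg.enorm.pow_const 2)

end L2

/-! ### Mollification -/

section Mollify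

open Filter

variable {E : Type*} [NormedAddCommGroup E] [InnerProductSpace ℝ E] [FiniteDimensional ℝ E]
  [MeasurableSpace E] [BorelSpace E]
  {F : Type*} [NormedAddCommGroup F] [InnerProductSpace ℂ F] [CompleteSpace F]

/-- Convolution with a scalar kernel, in the form `∫ k(y) u(x - y) dy`. -/
noncomputable def conv (k : E → ℝ) (u : E → F) (x : E) : F := ∫ y, k y • u (x - y)

theorem conv_eq_convolution (k : E → ℝ) (u : E → F) :
    conv k u = (k ⋆[ContinuousLinearMap.lsmul ℝ ℝ, volume] u) := rfl

theorem conv_swap (k : E → ℝ) (u : E → F) (x : E) : conv k u x = ∫ y, k (x - y) • u y :=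
  convolution_lsmul_swap

theorem locInt_of_memLp {u : E → F} (hu : MemLp u 2) : LocallyIntegrable u :=
  hu.locallyIntegrable (by norm_num)

theorem contDiff_conv {k : E → ℝ} (hk : IsTest k) {u : E → F} (hu : MemLp u 2) :
    ContDiff ℝ ∞ (conv k u) :=
  hk.2.contDiff_convolution_left (ContinuousLinearMap.lsmul ℝ ℝ (E := F)) hk.1 (locInt_of_memLp hu)

theorem IsTest.dirDeriv {G : Type*} [NormedAddCommGroup G] [NormedSpace ℝ G] {k : E → G}
    (hk : IsTest k) (v : E) : IsTest (dirDeriv v k) :=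
  ⟨contDiff_dirDeriv v hk.1, hasCompactSupport_dirDeriv v hk.2⟩

theorem IsTest.laplacian {k : E → F} (hk : IsTest k) : IsTest (Laplacian.laplacian k) :=
  ⟨contDiff_laplacian hk.1, hk.2.laplacian⟩

theorem dirDeriv_conv {k : E → ℝ} (hk : IsTest k) {u : E → F} (hu : MemLp u 2) (v : E) :
    dirDeriv v (conv k u) = conv (dirDeriv v k) u := by
  funext x
  have h := hk.2.hasFDerivAt_convolution_left (ContinuousLinearMap.lsmul ℝ ℝ (E := F))
    (hk.1.of_le (by simp)) (locInt_of_memLp hu) x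
  rw [dirDeriv, conv_eq_convolution, h.fderiv]
  have hex : ConvolutionExistsAt (fderiv ℝ k) u x
      ((ContinuousLinearMap.lsmul ℝ ℝ (E := F)).precompL E) volume :=
    (hk.2.fderiv ℝ).convolutionExists_left _ (hk.1.continuous_fderiv (by simp))
      (locInt_of_memLp hu) x
  rw [convolution_def, ContinuousLinearMap.integral_apply hex]
  rfl

theorem integrable_conv {k : E → ℝ} (hk : IsTest k) {u : E → F} (hu : MemLp u 2) (x : E) :
    Integrable fun y => k y • u (x - y) :=
  hk.2.convolutionExists_left (ContinuousLinearMap.lsmul ℝ ℝ (E := F)) hk.1.continuous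
    (locInt_of_memLp hu) x

theorem laplacian_conv {k : E → ℝ} (hk : IsTest k) {u : E → F} (hu : MemLp u 2) :
    Laplacian.laplacian (conv k u) = conv (Laplacian.laplacian k) u := by
  funext x
  rw [laplacian_eq_sum_dirDeriv (stdOrthonormalBasis ℝ E) (contDiff_conv hk hu)]
  have h : ∀ v : E, dirDeriv v (dirDeriv v (conv k u)) x = conv (dirDeriv v (dirDeriv v k)) u x :=
    fun v => by rw [dirDeriv_conv hk hu, dirDeriv_conv (hk.dirDeriv v) hu]
  simp only [h, conv, laplacian_eq_sum_dirDeriv (stdOrthonormalBasis ℝ E) hk.1, Finset.sum_smul]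
  rw [integral_finsetSum]
  exact fun i _ => integrable_conv ((hk.dirDeriv _).dirDeriv _) hu x

theorem aestronglyMeasurable_sub {u : E → F} (hu : AEStronglyMeasurable u volume) :
    AEStronglyMeasurable (Function.uncurry fun x y => u (x - y))
      ((volume : Measure E).prod volume) :=
  hu.comp_quasiMeasurePreserving (quasiMeasurePreserving_sub volume volume)

/-- Young's inequality `‖k * u‖₂ ≤ ‖k‖₁ ‖u‖₂`. -/
theorem memLp_conv {k : E → ℝ} (hk : IsTest k) {u : E → F} (hu : MemLp u 2) :
    MemLp (conv k u) 2 ∧ l2norm (conv k u) ≤ (∫ y, ‖k y‖) * l2norm u := by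
  have hki : Integrable k := hk.1.continuous.integrable_of_hasCompactSupport hk.2
  refine memLp_of_lintegral_le (contDiff_conv hk hu).continuous.aestronglyMeasurable
    (mul_nonneg (integral_nonneg fun _ => norm_nonneg _) (l2norm_nonneg u)) ?_
  refine (lintegral_enorm_integral_sq_le hki.aemeasurable
    (aestronglyMeasurable_sub hu.aestronglyMeasurable)).trans_eq ?_
  have h1 : ∀ y, ∫⁻ x, ‖u (x - y)‖ₑ ^ 2 = ENNReal.ofReal (l2norm u ^ 2) := fun y => by
    rw [lintegral_sub_right_eq_self (fun x => ‖u x‖ₑ ^ 2) y, ofReal_l2norm_sq hu]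
  simp only [h1]
  rw [lintegral_mul_const'' _ hki.aemeasurable.enorm, ← ofReal_integral_norm_eq_lintegral_enorm hki,
    ← ENNReal.ofReal_mul (integral_nonneg fun _ => norm_nonneg _),
    ← ENNReal.ofReal_mul (integral_nonneg fun _ => norm_nonneg _)]
  congr 1
  ring

theorem aestronglyMeasurable_clm_apply {β : Type*} [MeasurableSpace β] {μ : Measure β}
    {c : β → F →L[ℂ] F} {u : β → F} (hc : AEStronglyMeasurable c μ)
    (hu : AEStronglyMeasurable u μ) : AEStronglyMeasurable (fun y => c y (u y)) μ :=
  (isBoundedBilinearMap_apply (𝕜 := ℂ) (E := F) (F := F)).continuous.comp_aestronglyMeasurable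
    (hc.prodMk hu)

theorem integrable_clm_apply {c : E → F →L[ℂ] F} (hc : Continuous c) (hs : HasCompactSupport c)
    {u : E → F} (hu : LocallyIntegrable u) : Integrable fun y => c y (u y) := by
  refine (hu.integrable_smul_left_of_hasCompactSupport hc.norm hs.norm).mono
    (aestronglyMeasurable_clm_apply hc.aestronglyMeasurable hu.aestronglyMeasurable)
    (.of_forall fun y => ?_)
  rw [norm_smul, norm_norm]
  exact (c y).le_opNorm _

/-- Mollification commutes with `-Δ + V` up to a convolution with the kernel `k V`, because
`V x - V (x - y) = V y`. -/
theorem airy_conv (V : E →L[ℝ] F →L[ℂ] F) {k : E → ℝ} (hk : IsTest k) {u f : E → F}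
    (hu : MemLp u 2) (h : WeakSol V u f) (x : E) :
    airy V (conv k u) x = conv k f x + ∫ y, k y • V y (u (x - y)) := by
  have hk' : IsTest fun y => k (x - y) :=
    ⟨hk.1.comp (contDiff_const.sub contDiff_id), hk.2.comp_homeomorph (Homeomorph.subLeft x)⟩
  have hlap : ∀ y, Laplacian.laplacian (fun y => k (x - y)) y = Laplacian.laplacian k (x - y) := by
    intro y
    have hd : ∀ {q : E → ℝ} (hq : ContDiff ℝ ∞ q) (v : E),
        dirDeriv v (fun y => q (x - y)) = fun y => -dirDeriv v q (x - y) := by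
      intro q hq v
      funext y
      have h1 : HasFDerivAt (fun y => q (x - y)) ((fderiv ℝ q (x - y)).comp
          (-ContinuousLinearMap.id ℝ E)) y :=
        ((hq.differentiable (by simp)) (x - y)).hasFDerivAt.comp y
          ((hasFDerivAt_id y).const_sub x)
      rw [dirDeriv, h1.fderiv, dirDeriv]
      simp
    rw [laplacian_eq_sum_dirDeriv (stdOrthonormalBasis ℝ E) hk'.1,
      laplacian_eq_sum_dirDeriv (stdOrthonormalBasis ℝ E) hk.1]
    refine Finset.sum_congr rfl fun i _ => ?_
    have h2 := hd (contDiff_dirDeriv (stdOrthonormalBasis ℝ E i) hk.1) (stdOrthonormalBasis ℝ E i)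
    rw [hd hk.1]
    have h3 : dirDeriv (stdOrthonormalBasis ℝ E i)
        (fun y => -dirDeriv (stdOrthonormalBasis ℝ E i) k (x - y)) y =
        -dirDeriv (stdOrthonormalBasis ℝ E i)
        (fun y => dirDeriv (stdOrthonormalBasis ℝ E i) k (x - y)) y := by
      simp only [dirDeriv]
      rw [fderiv_fun_neg]
      rfl
    rw [h3, h2, neg_neg]
  have hw := h _ hk'.1 hk'.2
  simp only [hlap] at hw
  have hVint : Integrable fun y => k (x - y) • V y (u y) :=
    integrable_clm_apply (c := fun y => k (x - y) • V y)
      (hk'.1.continuous.smul V.continuous) hk'.2.smul_right (locInt_of_memLp hu)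
  have hVint2 : Integrable fun y => k (x - y) • V x (u y) :=
    integrable_clm_apply (c := fun y => k (x - y) • V x)
      (hk'.1.continuous.smul continuous_const) hk'.2.smul_right (locInt_of_memLp hu)
  have hi1 : Integrable fun y => (-(Laplacian.laplacian k (x - y))) • u y := by
    have h2 : IsTest fun y => Laplacian.laplacian k (x - y) :=
      ⟨(contDiff_laplacian hk.1).comp (contDiff_const.sub contDiff_id),
        hk.2.laplacian.comp_homeomorph (Homeomorph.subLeft x)⟩
    exact (locInt_of_memLp hu).integrable_smul_left_of_hasCompactSupport h2.1.neg.continuous h2.2.neg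
  -- the weak equation is tested with `y ↦ k (x - y)`; it contains `V y`, whereas `airy` has `V x`
  have h4 : V x (∫ y, k (x - y) • u y) = ∫ y, k (x - y) • V x (u y) := by
    rw [← ContinuousLinearMap.integral_comp_comm]
    · simp only [ContinuousLinearMap.map_smul_of_tower]
    · exact (locInt_of_memLp hu).integrable_smul_left_of_hasCompactSupport hk'.1.continuous hk'.2
  have h5 : ∫ y, k y • V y (u (x - y)) = ∫ y, k (x - y) • V (x - y) (u y) := by
    rw [← integral_sub_left_eq_self (fun y => k y • V y (u (x - y))) volume x]
    simp only [sub_sub_cancel]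
  have h6 : ∫ y, k (x - y) • V (x - y) (u y)
      = (∫ y, k (x - y) • V x (u y)) - ∫ y, k (x - y) • V y (u y) := by
    rw [← integral_sub hVint2 hVint]
    simp only [map_sub, sub_apply, smul_sub]
  rw [airy, laplacian_conv hk hu, conv_swap, conv_swap, conv_swap k f, ← hw, h4, h5, h6,
    integral_add hi1 hVint]
  simp only [neg_smul, integral_neg]
  abel

end Mollify

/-! ### Mollifiers and translations -/

section Mollifiers

open Filter

variable {E : Type*} [NormedAddCommGroup E] [InnerProductSpace ℝ E] [FiniteDimensional ℝ E]
  [MeasurableSpace E] [BorelSpace E]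
  {F : Type*} [NormedAddCommGroup F] [InnerProductSpace ℂ F] [CompleteSpace F]

/-- A smooth probability density supported in the ball of radius `ε`. -/
structure IsMollifier (ρ : E → ℝ) (ε : ℝ) : Prop where
  isTest : IsTest ρ
  nonneg : ∀ x, 0 ≤ ρ x
  integral_eq : ∫ x, ρ x = 1
  eq_zero : ∀ x, ε ≤ ‖x‖ → ρ x = 0

theorem exists_isMollifier {ε : ℝ} (hε : 0 < ε) : ∃ ρ : E → ℝ, IsMollifier ρ ε := by
  let b : ContDiffBump (0 : E) := ⟨ε / 2, ε, by positivity, by linarith⟩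
  refine ⟨b.normed volume, ⟨b.contDiff_normed, b.hasCompactSupport_normed⟩,
    fun x => b.nonneg_normed x, b.integral_normed, fun x hx => ?_⟩
  have h : x ∉ Function.support (b.normed volume) := by
    rw [b.support_normed_eq, mem_ball_zero_iff, not_lt]
    exact hx
  exact Function.notMem_support.1 h

theorem IsMollifier.lintegral_enorm {ρ : E → ℝ} {ε : ℝ} (hρ : IsMollifier ρ ε) :
    ∫⁻ y, ‖ρ y‖ₑ = 1 := by
  have hi : Integrable ρ := hρ.isTest.1.continuous.integrable_of_hasCompactSupport hρ.isTest.2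
  rw [← ofReal_integral_norm_eq_lintegral_enorm hi]
  simp only [Real.norm_of_nonneg (hρ.nonneg _), hρ.integral_eq, ENNReal.ofReal_one]

/-- Averages with respect to a mollifier do not increase uniform `L²` bounds. -/
theorem IsMollifier.memLp_average {ρ : E → ℝ} {ε : ℝ} (hρ : IsMollifier ρ ε) {g : E → E → F}
    (hg : AEStronglyMeasurable (Function.uncurry g) (volume.prod volume))
    (hm : AEStronglyMeasurable (fun x => ∫ y, ρ y • g x y)) {η : ℝ} (hη : 0 ≤ η)
    (hb : ∀ y, ‖y‖ < ε → ∫⁻ x, ‖g x y‖ₑ ^ 2 ≤ ENNReal.ofReal (η ^ 2)) :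
    MemLp (fun x => ∫ y, ρ y • g x y) 2 ∧ l2norm (fun x => ∫ y, ρ y • g x y) ≤ η := by
  refine memLp_of_lintegral_le hm hη ?_
  refine (lintegral_enorm_integral_sq_le
    hρ.isTest.1.continuous.measurable.aemeasurable hg).trans ?_
  rw [hρ.lintegral_enorm, one_mul]
  calc ∫⁻ y, ‖ρ y‖ₑ * ∫⁻ x, ‖g x y‖ₑ ^ 2 ≤ ∫⁻ y, ‖ρ y‖ₑ * ENNReal.ofReal (η ^ 2) := by
        refine lintegral_mono fun y => ?_
        rcases lt_or_ge ‖y‖ ε with h | h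
        · exact mul_le_mul_right (hb y h) _
        · simp [hρ.eq_zero y h]
    _ = _ := by
        rw [lintegral_mul_const'' _ hρ.isTest.1.continuous.measurable.aemeasurable.enorm,
          hρ.lintegral_enorm, one_mul]

/-- Translations act continuously on `L²`. -/
theorem exists_translation_lintegral_le {u : E → F} (hu : MemLp u 2) {η : ℝ} (hη : 0 < η) :
    ∃ δ : ℝ, 0 < δ ∧ ∀ y : E, ‖y‖ < δ →
      ∫⁻ x, ‖u (x - y) - u x‖ₑ ^ 2 ≤ ENNReal.ofReal (η ^ 2) := by
  let G : C(E, C(E, E)) := ContinuousMap.curry ⟨fun p : E × E => p.2 - p.1, by fun_prop⟩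
  have hG : ∀ y x, G y x = x - y := fun y x => rfl
  have hmp : ∀ y, MeasurePreserving (G y) volume volume := fun y =>
    measurePreserving_sub_right volume y
  have hcont : Continuous fun y => Lp.compMeasurePreserving (G y) (hmp y) (hu.toLp u) :=
    continuous_const.compMeasurePreservingLp G.continuous hmp (by norm_num)
  have h0 : Lp.compMeasurePreserving (G 0) (hmp 0) (hu.toLp u) = hu.toLp u := by
    have h := Lp.toLp_compMeasurePreserving hu (hmp 0)
    rw [h]
    congr 1
    funext x
    simp [hG]
  obtain ⟨δ, hδ, hδu⟩ := Metric.continuous_iff.1 hcont 0 η hη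
  refine ⟨δ, hδ, fun y hy => ?_⟩
  have h1 := (hδu y (by rwa [dist_zero_right])).le
  have h2 : MemLp (fun x => u (x - y)) 2 := hu.comp_measurePreserving (hmp y)
  rw [h0, Lp.toLp_compMeasurePreserving hu (hmp y), dist_eq_norm, ← MemLp.toLp_sub,
    norm_toLp_eq_l2norm] at h1
  have h3 := ofReal_l2norm_sq (h2.sub hu)
  simp only [Pi.sub_apply] at h3
  rw [← h3]
  exact ENNReal.ofReal_le_ofReal (pow_le_pow_left₀ (l2norm_nonneg _) h1 2)

/-- If translates of `u` by less than `ε` are close to `u`, then so is the mollified function. -/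
theorem IsMollifier.l2norm_conv_sub_le {ρ : E → ℝ} {ε : ℝ} (hρ : IsMollifier ρ ε) {u : E → F}
    (hu : MemLp u 2) {η : ℝ} (hη : 0 ≤ η)
    (hb : ∀ y : E, ‖y‖ < ε → ∫⁻ x, ‖u (x - y) - u x‖ₑ ^ 2 ≤ ENNReal.ofReal (η ^ 2)) :
    l2norm (conv ρ u - u) ≤ η := by
  have hi : Integrable ρ :=
    hρ.isTest.1.continuous.integrable_of_hasCompactSupport hρ.isTest.2
  have h1 : conv ρ u - u = fun x => ∫ y, ρ y • (u (x - y) - u x) := by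
    funext x
    have h2 : ∫ y, ρ y • u x = u x := by
      rw [integral_smul_const, hρ.integral_eq, one_smul]
    simp only [smul_sub]
    rw [integral_sub (integrable_conv hρ.isTest hu x) (hi.smul_const _), h2]
    rfl
  have hm := (contDiff_conv hρ.isTest hu).continuous.aestronglyMeasurable (μ := volume) |>.sub hu.1
  rw [h1] at hm ⊢
  exact (hρ.memLp_average (g := fun x y => u (x - y) - u x)
    ((aestronglyMeasurable_sub hu.1).sub hu.1.comp_fst) hm hη hb).2

/-- The commutator of `V` with a mollifier of radius `ε` is of order `ε`, since `‖V y‖ ≤ ‖V‖ ε` on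
the support of the kernel. -/
theorem IsMollifier.memLp_commutator {ρ : E → ℝ} {ε : ℝ} (hρ : IsMollifier ρ ε) (hε : 0 ≤ ε)
    (V : E →L[ℝ] F →L[ℂ] F) {u : E → F} (hu : MemLp u 2)
    (hm : AEStronglyMeasurable (fun x => ∫ y, ρ y • V y (u (x - y)))) :
    MemLp (fun x => ∫ y, ρ y • V y (u (x - y))) 2 ∧
      l2norm (fun x => ∫ y, ρ y • V y (u (x - y))) ≤ ‖V‖ * ε * l2norm u := by
  refine hρ.memLp_average (g := fun x y => V y (u (x - y))) ?_ hm
    (mul_nonneg (mul_nonneg (norm_nonneg _) hε) (l2norm_nonneg _)) fun y hy => ?_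
  · exact aestronglyMeasurable_clm_apply
      (V.continuous.comp continuous_snd).aestronglyMeasurable (aestronglyMeasurable_sub hu.1)
  · calc ∫⁻ x, ‖V y (u (x - y))‖ₑ ^ 2
        ≤ ∫⁻ x, ENNReal.ofReal ((‖V‖ * ε) ^ 2) * ‖u (x - y)‖ₑ ^ 2 := by
          refine lintegral_mono fun x => ?_
          rw [← ofReal_norm, ← ofReal_norm, ← ENNReal.ofReal_pow (norm_nonneg _),
            ← ENNReal.ofReal_pow (norm_nonneg _), ← ENNReal.ofReal_mul (by positivity),
            ← mul_pow]
          refine ENNReal.ofReal_le_ofReal (pow_le_pow_left₀ (norm_nonneg _) ?_ 2)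
          calc ‖V y (u (x - y))‖ ≤ ‖V‖ * ‖y‖ * ‖u (x - y)‖ :=
                ((V y).le_opNorm _).trans (by gcongr; exact V.le_opNorm y)
            _ ≤ _ := by gcongr
      _ = _ := by
          rw [lintegral_const_mul' _ _ ENNReal.ofReal_ne_top,
            lintegral_sub_right_eq_self (fun x => ‖u x‖ₑ ^ 2) y, ← ofReal_l2norm_sq hu,
            ← ENNReal.ofReal_mul (by positivity), ← mul_pow]

end Mollifiers

/-! ### Test functions are a core of the maximal operator -/

section Core

open Filter

variable {E : Type*} [NormedAddCommGroup E] [InnerProductSpace ℝ E] [FiniteDimensional ℝ E]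
  [MeasurableSpace E] [BorelSpace E]
  {F : Type*} [NormedAddCommGroup F] [InnerProductSpace ℂ F] [CompleteSpace F]

theorem dirDeriv_smul {χ : E → ℝ} {w : E → F} (hχ : ContDiff ℝ ∞ χ) (hw : ContDiff ℝ ∞ w) (v : E) :
    dirDeriv v (fun x => χ x • w x) = fun x => χ x • dirDeriv v w x + dirDeriv v χ x • w x := by
  funext x
  rw [dirDeriv, fderiv_fun_smul (hχ.differentiable (by simp) x) (hw.differentiable (by simp) x)]
  rfl

theorem laplacian_smul_fun {χ : E → ℝ} {w : E → F} (hχ : ContDiff ℝ ∞ χ) (hw : ContDiff ℝ ∞ w)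
    {ι : Type*} [Fintype ι] (b : OrthonormalBasis ι ℝ E) (x : E) :
    Laplacian.laplacian (fun x => χ x • w x) x = χ x • Laplacian.laplacian w x +
      (∑ i, (2 * dirDeriv (b i) χ x) • dirDeriv (b i) w x) + Laplacian.laplacian χ x • w x := by
  rw [laplacian_eq_sum_dirDeriv b (f := fun x => χ x • w x) (hχ.smul hw),
    laplacian_eq_sum_dirDeriv b hw,
    laplacian_eq_sum_dirDeriv b hχ, Finset.smul_sum, Finset.sum_smul, ← Finset.sum_add_distrib,
    ← Finset.sum_add_distrib]
  refine Finset.sum_congr rfl fun i _ => ?_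
  rw [dirDeriv_smul hχ hw]
  have h1 : dirDeriv (b i) (fun x => χ x • dirDeriv (b i) w x + dirDeriv (b i) χ x • w x) x =
      dirDeriv (b i) (fun x => χ x • dirDeriv (b i) w x) x +
        dirDeriv (b i) (fun x => dirDeriv (b i) χ x • w x) x := by
    have d1 := ((hχ.smul (contDiff_dirDeriv (b i) hw)).differentiable (by simp)) x
    have d2 := (((contDiff_dirDeriv (b i) hχ).smul hw).differentiable (by simp)) x
    have := fderiv_fun_add d1 d2
    rw [dirDeriv]
    exact congrArg (fun L : E →L[ℝ] F => L (b i)) this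
  rw [h1, dirDeriv_smul hχ (contDiff_dirDeriv _ hw), dirDeriv_smul (contDiff_dirDeriv _ hχ) hw]
  module

/-- Multiplication with the dilated cutoffs `χ(x / (n + 1))` converges strongly to the identity. -/
theorem tendsto_l2norm_cutoff {χ : E → ℝ} (hχ : Continuous χ) (h0 : χ 0 = 1)
    (h01 : ∀ x, ‖χ x‖ ≤ 1) {g : E → F} (hg : MemLp g 2) :
    Tendsto (fun n : ℕ => l2norm fun x => χ ((n + 1 : ℝ)⁻¹ • x) • g x - g x) atTop (𝓝 0) := by
  have hc : ∀ n : ℕ, Continuous fun x : E => χ ((n + 1 : ℝ)⁻¹ • x) := fun n => by fun_prop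
  have hmem : ∀ n : ℕ, MemLp (fun x => χ ((n + 1 : ℝ)⁻¹ • x) • g x) 2 := fun n =>
    hg.mono ((hc n).aestronglyMeasurable.smul hg.1) (.of_forall fun x => by
      rw [norm_smul]
      exact mul_le_of_le_one_left (norm_nonneg _) (h01 _))
  have hsq : Tendsto (fun n : ℕ => ∫ x, ‖χ ((n + 1 : ℝ)⁻¹ • x) • g x - g x‖ ^ 2) atTop
      (𝓝 (∫ _ : E, (0 : ℝ))) := by
    refine tendsto_integral_of_dominated_convergence (fun x => (2 * ‖g x‖) ^ 2)
      (fun n => (((hmem n).sub hg).1.norm.pow 2)) ?_ ?_ ?_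
    · have h1 := (memLp_two_iff_integrable_sq_norm hg.1).1 hg
      simp only [mul_pow]
      exact h1.const_mul _
    · refine fun n => .of_forall fun x => ?_
      rw [Real.norm_of_nonneg (by positivity)]
      refine pow_le_pow_left₀ (norm_nonneg _) ((norm_sub_le _ _).trans ?_) 2
      rw [norm_smul]
      nlinarith [h01 ((n + 1 : ℝ)⁻¹ • x), norm_nonneg (g x)]
    · refine .of_forall fun x => ?_
      have h2 : Tendsto (fun n : ℕ => (n + 1 : ℝ)⁻¹) atTop (𝓝 0) :=
        tendsto_inv_atTop_zero.comp (tendsto_atTop_add_const_right _ _ tendsto_natCast_atTop_atTop)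
      have h3 : Tendsto (fun n : ℕ => χ ((n + 1 : ℝ)⁻¹ • x)) atTop (𝓝 (χ 0)) := by
        refine (hχ.tendsto 0).comp ?_
        simpa using h2.smul_const x
      rw [h0] at h3
      have h4 := ((h3.smul_const (g x)).sub_const (g x)).norm.pow 2
      simpa using h4
  rw [integral_zero] at hsq
  have h5 := hsq.sqrt
  rw [Real.sqrt_zero] at h5
  refine h5.congr fun n => ?_
  have h6 := l2norm_sq ((hmem n).sub hg)
  simp only [Pi.sub_apply] at h6
  rw [← h6, Real.sqrt_sq (l2norm_nonneg _)]
  rfl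

/-- Smooth functions with finite energy can be cut off: the commutator of `Δ` with a cutoff at scale
`s⁻¹` is of order `s` in terms of the function and its gradient. -/
theorem exists_test_approx_of_smooth (V : E →L[ℝ] F →L[ℂ] F) {w : E → F} (hw : ContDiff ℝ ∞ w)
    (hw2 : MemLp w 2) (hdw : ∀ v, MemLp (dirDeriv v w) 2) (hH : MemLp (airy V w) 2) {ε : ℝ}
    (hε : 0 < ε) :
    ∃ φ : E → F, IsTest φ ∧ l2norm (φ - w) ≤ ε ∧ l2norm (airy V φ - airy V w) ≤ ε := by
  obtain ⟨χ, hχs, hχc, hχ0, hχ1⟩ : ∃ χ : E → ℝ, ContDiff ℝ ∞ χ ∧ HasCompactSupport χ ∧ χ 0 = 1 ∧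
      ∀ x, ‖χ x‖ ≤ 1 := by
    let χ : ContDiffBump (0 : E) := ⟨1, 2, one_pos, one_lt_two⟩
    refine ⟨χ, χ.contDiff, χ.hasCompactSupport,
      χ.one_of_mem_closedBall (mem_closedBall_self zero_le_one), fun x => ?_⟩
    rw [Real.norm_of_nonneg χ.nonneg]
    exact χ.le_one
  let b := stdOrthonormalBasis ℝ E
  obtain ⟨C, hC⟩ : ∃ C : ℝ, ∀ x, ‖fderiv ℝ χ x‖ ≤ C :=
    (hχc.fderiv ℝ).exists_bound_of_continuous (hχs.continuous_fderiv (by simp))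
  obtain ⟨C', hC'⟩ : ∃ C : ℝ, ∀ x, ‖Laplacian.laplacian χ x‖ ≤ C :=
    hχc.laplacian.exists_bound_of_continuous (contDiff_laplacian hχs).continuous
  have hC0 : 0 ≤ C := (norm_nonneg _).trans (hC 0)
  have hC'0 : 0 ≤ C' := (norm_nonneg _).trans (hC' 0)
  let s : ℕ → ℝ := fun n => (n + 1 : ℝ)⁻¹
  have hs : ∀ n, 0 < s n ∧ s n ≤ 1 := fun n => by
    constructor
    · positivity
    · exact inv_le_one_of_one_le₀ (by simp)
  have hs0 : Tendsto s atTop (𝓝 0) :=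
    tendsto_inv_atTop_zero.comp (tendsto_atTop_add_const_right _ _ tendsto_natCast_atTop_atTop)
  let χn : ℕ → E → ℝ := fun n x => χ (s n • x)
  have hχns : ∀ n, ContDiff ℝ ∞ (χn n) := fun n => hχs.comp (contDiff_const_smul (s n))
  have hχnc : ∀ n, HasCompactSupport (χn n) := fun n =>
    hχc.comp_homeomorph (Homeomorph.smulOfNeZero (s n) (hs n).1.ne')
  let φ : ℕ → E → F := fun n x => χn n x • w x
  have hφ : ∀ n, IsTest (φ n) := fun n => ⟨(hχns n).smul hw, (hχnc n).smul_right⟩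
  -- the commutator `2 ∇χₙ·∇w + Δχₙ w` is dominated by `s n * h`
  let h : E → ℝ := fun x => (∑ i, 2 * C * ‖dirDeriv (b i) w x‖) + C' * ‖w x‖
  have hh : MemLp h 2 :=
    (memLp_finsetSum _ fun i _ => (hdw (b i)).norm.const_mul (2 * C)).add (hw2.norm.const_mul C')
  have hairy : ∀ n x, airy V (φ n) x = χn n x • airy V w x -
      ((∑ i, (2 * dirDeriv (b i) (χn n) x) • dirDeriv (b i) w x) +
        Laplacian.laplacian (χn n) x • w x) := by
    intro n x
    simp only [airy]
    rw [laplacian_smul_fun (hχns n) hw b, ContinuousLinearMap.map_smul_of_tower]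
    module
  have herr : ∀ n x, ‖(∑ i, (2 * dirDeriv (b i) (χn n) x) • dirDeriv (b i) w x) +
        Laplacian.laplacian (χn n) x • w x‖ ≤ ‖(s n • h) x‖ := by
    intro n x
    have hpos : 0 ≤ h x := by positivity
    rw [Pi.smul_apply, smul_eq_mul, Real.norm_of_nonneg (mul_nonneg (hs n).1.le hpos)]
    simp only [h]
    rw [mul_add, Finset.mul_sum]
    refine (norm_add_le _ _).trans (add_le_add ((norm_sum_le _ _).trans
      (Finset.sum_le_sum fun i _ => ?_)) ?_)
    · have h1 : ‖dirDeriv (b i) (χn n) x‖ ≤ s n * C := by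
        change ‖dirDeriv (b i) (fun x => χ (s n • x)) x‖ ≤ _
        rw [dirDeriv_comp_smul hχs, norm_mul, Real.norm_of_nonneg (hs n).1.le]
        refine mul_le_mul_of_nonneg_left ?_ (hs n).1.le
        refine ((fderiv ℝ χ (s n • x)).le_opNorm _).trans ?_
        rw [b.norm_eq_one, mul_one]
        exact hC _
      rw [norm_smul, norm_mul, Real.norm_two]
      calc 2 * ‖dirDeriv (b i) (χn n) x‖ * ‖dirDeriv (b i) w x‖
          ≤ 2 * (s n * C) * ‖dirDeriv (b i) w x‖ := by gcongr
        _ = _ := by ring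
    · rw [norm_smul, laplacian_comp_smul hχs, norm_mul, norm_mul, Real.norm_of_nonneg (hs n).1.le]
      calc s n * (s n * ‖Laplacian.laplacian χ (s n • x)‖) * ‖w x‖
          ≤ s n * (1 * C') * ‖w x‖ := by
            gcongr
            · exact (hs n).2
            · exact hC' _
        _ = _ := by ring
  have hA : Tendsto (fun n => l2norm (φ n - w)) atTop (𝓝 0) :=
    tendsto_l2norm_cutoff hχs.continuous hχ0 hχ1 hw2
  have hB : Tendsto (fun n => (l2norm fun x => χn n x • airy V w x - airy V w x) + s n * l2norm h)
      atTop (𝓝 0) := by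
    have := (tendsto_l2norm_cutoff hχs.continuous hχ0 hχ1 hH).add (hs0.mul_const (l2norm h))
    simpa using this
  obtain ⟨n, hn1, hn2⟩ :=
    ((hA.eventually (ge_mem_nhds hε)).and (hB.eventually (ge_mem_nhds hε))).exists
  refine ⟨φ n, hφ n, hn1, le_trans ?_ hn2⟩
  let e : E → F := fun x => (∑ i, (2 * dirDeriv (b i) (χn n) x) • dirDeriv (b i) w x) +
        Laplacian.laplacian (χn n) x • w x
  have heq : airy V (φ n) - airy V w = (fun x => χn n x • airy V w x - airy V w x) - e := by
    funext x
    simp only [Pi.sub_apply, hairy]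
    simp only [e]
    abel
  have hm1 : MemLp (fun x => χn n x • airy V w x - airy V w x) 2 :=
    MemLp.sub (hH.mono ((hχns n).continuous.aestronglyMeasurable.smul hH.1) (.of_forall fun x => by
      rw [norm_smul]
      exact mul_le_of_le_one_left (norm_nonneg _) (hχ1 _))) hH
  have hec : AEStronglyMeasurable e volume := by
    refine Continuous.aestronglyMeasurable ?_
    have c1 := (contDiff_laplacian (hχns n)).continuous
    have c2 := hw.continuous
    have c3 := fun i => (contDiff_dirDeriv (b i) (hχns n)).continuous
    have c4 := fun i => (contDiff_dirDeriv (b i) hw).continuous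
    fun_prop
  have hm2 : MemLp e 2 := (hh.const_smul (s n)).mono hec (.of_forall (herr n))
  rw [heq]
  refine (l2norm_sub_le hm1 hm2).trans (add_le_add le_rfl ?_)
  calc l2norm e ≤ l2norm (s n • h) := l2norm_mono (hh.const_smul (s n)) (herr n)
    _ = s n * l2norm h := by rw [l2norm_const_smul, Real.norm_of_nonneg (hs n).1.le]

/-- Test functions form a core: every weak solution with `u, f ∈ L²` is a limit, in the graph norm,
of smooth functions with compact support. -/
theorem WeakSol.exists_test_approx {V : E →L[ℝ] F →L[ℂ] F} {u f : E → F} (h : WeakSol V u f)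
    (hu : MemLp u 2) (hf : MemLp f 2) {ε : ℝ} (hε : 0 < ε) :
    ∃ φ : E → F, IsTest φ ∧ l2norm (φ - u) ≤ ε ∧ l2norm (airy V φ - f) ≤ ε := by
  obtain ⟨δ, hδ, hδu⟩ := exists_translation_lintegral_le hu (half_pos hε)
  obtain ⟨δ', hδ', hδf⟩ := exists_translation_lintegral_le hf (half_pos (half_pos hε))
  -- the radius of the mollifier: translations by less than `r` hardly change `u` and `f`, and the
  -- commutator with `V` is at most `‖V‖ r ‖u‖ ≤ ε / 4`
  let c : ℝ := ‖V‖ * l2norm u + 1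
  have hc : 0 < c := by have := l2norm_nonneg u; positivity
  let r : ℝ := min (min δ δ') (ε / 2 / 2 / c)
  have hr : 0 < r := by positivity
  obtain ⟨ρ, hρ⟩ := exists_isMollifier (E := E) hr
  have h1 := hρ.l2norm_conv_sub_le hu (half_pos hε).le fun y hy =>
    hδu y (hy.trans_le ((min_le_left _ _).trans (min_le_left _ _)))
  have h2 := hρ.l2norm_conv_sub_le hf (half_pos (half_pos hε)).le fun y hy =>
    hδf y (hy.trans_le ((min_le_left _ _).trans (min_le_right _ _)))
  have hws := contDiff_conv hρ.isTest hu
  have hairy := airy_conv V hρ.isTest hu h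
  let e : E → F := fun x => ∫ y, ρ y • V y (u (x - y))
  have heq : e = airy V (conv ρ u) - conv ρ f := by
    funext x
    simp only [Pi.sub_apply, hairy, e]
    abel
  have hem : AEStronglyMeasurable e volume := by
    rw [heq]
    exact ((contDiff_airy V hws).continuous.sub
      (contDiff_conv hρ.isTest hf).continuous).aestronglyMeasurable
  have he := hρ.memLp_commutator hr.le V hu hem
  have hel : l2norm e ≤ ε / 2 / 2 := by
    refine he.2.trans ?_
    calc ‖V‖ * r * l2norm u = r * (‖V‖ * l2norm u) := by ring
      _ ≤ ε / 2 / 2 / c * c := by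
        have hle : ‖V‖ * l2norm u ≤ c := by simp [c]
        exact mul_le_mul (min_le_right _ _) hle
          (mul_nonneg (norm_nonneg _) (l2norm_nonneg u)) (by positivity)
      _ = ε / 2 / 2 := by field_simp
  have hfm := (memLp_conv hρ.isTest hf).1
  have hHeq : airy V (conv ρ u) = conv ρ f + e := by rw [heq]; abel
  have hH : MemLp (airy V (conv ρ u)) 2 := by
    rw [hHeq]
    exact hfm.add he.1
  have hwm := (memLp_conv hρ.isTest hu).1
  obtain ⟨φ, hφ, hφ1, hφ2⟩ := exists_test_approx_of_smooth V hws hwm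
    (fun v => by
      rw [dirDeriv_conv hρ.isTest hu]
      exact (memLp_conv (hρ.isTest.dirDeriv v) hu).1) hH (half_pos hε)
  refine ⟨φ, hφ, ?_, ?_⟩
  · have : φ - u = (φ - conv ρ u) + (conv ρ u - u) := by abel
    rw [this]
    linarith [l2norm_add_le (hφ.memLp.sub hwm) (hwm.sub hu)]
  · have h3 : airy V φ - f = (airy V φ - airy V (conv ρ u)) + ((conv ρ f - f) + e) := by
      rw [hHeq]
      abel
    rw [h3]
    have h4 := l2norm_add_le ((isTest_airy V hφ).memLp.sub hH) ((hfm.sub hf).add he.1)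
    have h5 := l2norm_add_le (hfm.sub hf) he.1
    linarith

end Core

/-! ### Energy estimates -/

section Energy

open Filter

variable {E : Type*} [NormedAddCommGroup E] [InnerProductSpace ℝ E] [FiniteDimensional ℝ E]
  [MeasurableSpace E] [BorelSpace E]
  {F : Type*} [NormedAddCommGroup F] [InnerProductSpace ℂ F] [CompleteSpace F]

/-- The inner product as a real bilinear map. -/
noncomputable def innerB (F : Type*) [NormedAddCommGroup F] [InnerProductSpace ℂ F] :
    F →L[ℝ] F →L[ℝ] ℂ :=
  (isBoundedBilinearMap_inner (𝕜 := ℂ) (E := F)).toContinuousLinearMap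

theorem innerB_apply (x y : F) : innerB F x y = inner ℂ x y := rfl

/-- The values of the potential are anti-Hermitian. -/
def IsSkew (V : E →L[ℝ] F →L[ℂ] F) : Prop :=
  ∀ (a : E) (x y : F), inner ℂ (V a x) y = -inner ℂ x (V a y)

theorem IsSkew.re_inner {V : E →L[ℝ] F →L[ℂ] F} (hV : IsSkew V) (a : E) (x : F) :
    (inner ℂ x (V a x)).re = 0 := by
  have h1 := congrArg Complex.re (hV a x x)
  rw [← inner_conj_symm, Complex.conj_re, Complex.neg_re] at h1
  linarith

theorem IsTest.integrable_inner {φ χ : E → F} (hφ : IsTest φ) (hχ : IsTest χ) :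
    Integrable fun x => inner ℂ (φ x) (χ x) :=
  integrable_bilin (innerB F) hφ.1.continuous hχ.1.continuous (Or.inl hφ.2)

theorem IsTest.potential (V : E →L[ℝ] F →L[ℂ] F) {φ : E → F} (hφ : IsTest φ) :
    IsTest fun x => V x (φ x) :=
  ⟨contDiff_potential V hφ.1, hφ.2.mono fun x hx hx' => hx (by simp [hx'])⟩

theorem integral_inner_eq_l2norm_sq {φ : E → F} (hφ : MemLp φ 2) :
    (∫ x, inner ℂ (φ x) (φ x)) = ((l2norm φ ^ 2 : ℝ) : ℂ) := by
  rw [l2norm_sq hφ, ← integral_complex_ofReal]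
  refine integral_congr_ae (.of_forall fun x => ?_)
  simp only [inner_self_eq_norm_sq_to_K]
  norm_cast

theorem norm_integral_inner_le {u v : E → F} (hu : MemLp u 2) (hv : MemLp v 2) :
    ‖∫ x, inner ℂ (u x) (v x)‖ ≤ l2norm u * l2norm v := by
  have h := norm_inner_le_norm (𝕜 := ℂ) (hu.toLp u) (hv.toLp v)
  rw [norm_toLp_eq_l2norm, norm_toLp_eq_l2norm, L2.inner_def] at h
  refine le_of_eq_of_le ?_ h
  congr 1
  refine integral_congr_ae ?_
  filter_upwards [hu.coeFn_toLp, hv.coeFn_toLp] with x hx hy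
  rw [hx, hy]

/-- The Dirichlet energy, `‖∇ φ‖²`. -/
noncomputable def dirichlet (φ : E → F) : ℝ :=
  ∑ i, l2norm (dirDeriv (stdOrthonormalBasis ℝ E i) φ) ^ 2

theorem dirichlet_nonneg (φ : E → F) : 0 ≤ dirichlet φ := Finset.sum_nonneg fun _ _ => sq_nonneg _

/-- The skew potential does not contribute to the real part of the quadratic form. -/
theorem re_integral_inner_airy {V : E →L[ℝ] F →L[ℂ] F} (hV : IsSkew V) {φ : E → F}
    (hφ : IsTest φ) : (∫ x, inner ℂ (φ x) (airy V φ x)).re = dirichlet φ := by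
  have h1 : ∫ x, inner ℂ (φ x) (airy V φ x) =
      -(∫ x, innerB F (φ x) (Laplacian.laplacian φ x)) + ∫ x, inner ℂ (φ x) (V x (φ x)) := by
    rw [← integral_neg, ← integral_add]
    · refine integral_congr_ae (.of_forall fun x => ?_)
      simp only [airy, inner_add_right, inner_neg_right, innerB_apply]
    · exact (hφ.integrable_inner hφ.laplacian).neg
    · exact hφ.integrable_inner (hφ.potential V)
  have h2 : (∫ x, inner ℂ (φ x) (V x (φ x))).re = 0 := by
    have h := integral_re (hφ.integrable_inner (hφ.potential V))
    change ∫ x, (inner ℂ (φ x) (V x (φ x))).re = _ at h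
    simp only [hV.re_inner, integral_zero] at h
    exact h.symm
  rw [h1, integral_bilin_laplacian (innerB F) hφ.1 hφ.1 (Or.inl hφ.2) (stdOrthonormalBasis ℝ E),
    Complex.add_re, h2, neg_neg, add_zero, Complex.re_sum, dirichlet]
  refine Finset.sum_congr rfl fun i _ => ?_
  simp only [innerB_apply]
  rw [integral_inner_eq_l2norm_sq (hφ.dirDeriv _).memLp, Complex.ofReal_re]

/-- The operator controls the gradient. -/
theorem dirichlet_le {V : E →L[ℝ] F →L[ℂ] F} (hV : IsSkew V) {φ : E → F} (hφ : IsTest φ) :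
    dirichlet φ ≤ l2norm φ * l2norm (airy V φ) := by
  rw [← re_integral_inner_airy hV hφ]
  exact (Complex.re_le_norm _).trans (norm_integral_inner_le hφ.memLp (isTest_airy V hφ).memLp)

/-- Accretivity on test functions. -/
theorem neg_re_mul_l2norm_le {V : E →L[ℝ] F →L[ℂ] F} (hV : IsSkew V) {φ : E → F} (hφ : IsTest φ)
    (z : ℂ) : -z.re * l2norm φ ≤ l2norm (airy V φ - z • φ) := by
  have hm := (isTest_airy V hφ).memLp.sub (hφ.memLp.const_smul z)
  have h1 := (Complex.re_le_norm _).trans (norm_integral_inner_le hφ.memLp hm)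
  have h2 : ∫ x, inner ℂ (φ x) ((airy V φ - z • φ) x) =
      (∫ x, inner ℂ (φ x) (airy V φ x)) - z * ∫ x, inner ℂ (φ x) (φ x) := by
    rw [← integral_const_mul, ← integral_sub (hφ.integrable_inner (isTest_airy V hφ))
      ((hφ.integrable_inner hφ).const_mul z)]
    refine integral_congr_ae (.of_forall fun x => ?_)
    simp only [Pi.sub_apply, Pi.smul_apply, inner_sub_right, inner_smul_right]
  rw [h2, integral_inner_eq_l2norm_sq hφ.memLp, Complex.sub_re, Complex.re_mul_ofReal,
    re_integral_inner_airy hV hφ] at h1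
  rcases (l2norm_nonneg φ).eq_or_lt with h0 | h0
  · rw [← h0, mul_zero]
    exact l2norm_nonneg _
  · have h3 := dirichlet_nonneg φ
    nlinarith

theorem dirDeriv_potential (V : E →L[ℝ] F →L[ℂ] F) {φ : E → F} (hφ : ContDiff ℝ ∞ φ) (v x : E) :
    dirDeriv v (fun x => V x (φ x)) x = V v (φ x) + V x (dirDeriv v φ x) := by
  let L : E →L[ℝ] F →L[ℝ] F := (ContinuousLinearMap.restrictScalarsL ℂ F F ℝ ℝ).comp V
  have h1 : HasFDerivAt (fun x => L x (φ x)) _ x :=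
    L.hasFDerivAt.clm_apply ((hφ.differentiable (by simp)) x).hasFDerivAt
  change fderiv ℝ (fun x => L x (φ x)) x v = _
  rw [h1.fderiv, add_comm]
  rfl

/-- The potential is controlled by the operator in `L²`. In the square of `‖-Δ φ + V φ‖` the mixed
term reduces to the commutator `[∂, V]`, which is constant since `V` is linear. -/
theorem l2norm_potential_sq_le {V : E →L[ℝ] F →L[ℂ] F} (hV : IsSkew V) {φ : E → F}
    (hφ : IsTest φ) :
    l2norm (fun x => V x (φ x)) ^ 2 ≤ l2norm (airy V φ) ^ 2 +
      ‖V‖ * (dirichlet φ + Module.finrank ℝ E * l2norm φ ^ 2) := by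
  let b := stdOrthonormalBasis ℝ E
  have hVφ := hφ.potential V
  have hsq : l2norm (airy V φ) ^ 2 = l2norm (Laplacian.laplacian φ) ^ 2 +
      l2norm (fun x => V x (φ x)) ^ 2 -
        2 * (∫ x, inner ℂ (Laplacian.laplacian φ x) (V x (φ x))).re := by
    have hi : ∀ {a : E → F}, IsTest a → Integrable fun x => ‖a x‖ ^ 2 := fun ha =>
      (memLp_two_iff_integrable_sq_norm ha.memLp.1).1 ha.memLp
    have hre : (∫ x, inner ℂ (Laplacian.laplacian φ x) (V x (φ x))).re =
        ∫ x, (inner ℂ (Laplacian.laplacian φ x) (V x (φ x))).re :=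
      (integral_re (hφ.laplacian.integrable_inner hVφ)).symm
    rw [hre, l2norm_sq (isTest_airy V hφ).memLp, l2norm_sq hφ.laplacian.memLp, l2norm_sq hVφ.memLp,
      ← integral_const_mul, ← integral_add (hi hφ.laplacian) (hi hVφ), ← integral_sub]
    · refine integral_congr_ae (.of_forall fun x => ?_)
      simp only [airy]
      rw [neg_add_eq_sub, norm_sub_sq (𝕜 := ℂ), ← inner_conj_symm]
      simp only [RCLike.re_eq_complex_re, Complex.conj_re]
      ring
    · exact (hi hφ.laplacian).add (hi hVφ)
    · exact ((hφ.laplacian.integrable_inner hVφ).re).const_mul 2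
  have hmix : (∫ x, inner ℂ (Laplacian.laplacian φ x) (V x (φ x))).re =
      -∑ i, (∫ x, inner ℂ (dirDeriv (b i) φ x) (V (b i) (φ x))).re := by
    have h1 := integral_laplacian_bilin (innerB F) hφ.1 hVφ.1 (Or.inl hφ.2) b
    simp only [innerB_apply] at h1
    rw [h1, Complex.neg_re, Complex.re_sum]
    congr 1
    refine Finset.sum_congr rfl fun i _ => ?_
    have hd : ∀ x, dirDeriv (b i) (fun x => V x (φ x)) x =
        V (b i) (φ x) + V x (dirDeriv (b i) φ x) := by
      exact dirDeriv_potential V hφ.1 (b i)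
    simp only [hd, inner_add_right]
    have i1 : Integrable fun x => inner ℂ (dirDeriv (b i) φ x) (V (b i) (φ x)) := by
      have ht : IsTest fun x => V (b i) (φ x) := by
        refine ⟨?_, hφ.2.mono fun x hx hx' => hx (by simp [hx'])⟩
        exact (((V (b i)).restrictScalars ℝ).contDiff).comp hφ.1
      exact (hφ.dirDeriv _).integrable_inner ht
    have i2 := (hφ.dirDeriv (b i)).integrable_inner ((hφ.dirDeriv (b i)).potential V)
    have h2 : (∫ x, inner ℂ (dirDeriv (b i) φ x) (V x (dirDeriv (b i) φ x))).re = 0 := by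
      have h := integral_re i2
      change ∫ x, (inner ℂ (dirDeriv (b i) φ x) (V x (dirDeriv (b i) φ x))).re = _ at h
      simp only [hV.re_inner, integral_zero] at h
      exact h.symm
    rw [integral_add i1 i2, Complex.add_re, h2, add_zero]
  have hterm : ∀ i, -(2 * (∫ x, inner ℂ (dirDeriv (b i) φ x) (V (b i) (φ x))).re) ≤
      ‖V‖ * (l2norm (dirDeriv (b i) φ) ^ 2 + l2norm φ ^ 2) := by
    intro i
    have ht : MemLp (fun x => V (b i) (φ x)) 2 := (V (b i)).comp_memLp' hφ.memLp
    have h1 := norm_integral_inner_le (hφ.dirDeriv (b i)).memLp ht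
    have h2 : l2norm (fun x => V (b i) (φ x)) ≤ ‖V‖ * l2norm φ := by
      have := l2norm_mono (u := fun x => V (b i) (φ x)) (hφ.memLp.const_smul ‖V‖) fun x => by
        rw [Pi.smul_apply, norm_smul, norm_norm]
        refine ((V (b i)).le_opNorm _).trans (mul_le_mul_of_nonneg_right ?_ (norm_nonneg _))
        simpa using V.le_opNorm (b i)
      rwa [l2norm_const_smul, norm_norm] at this
    have h3 := (Complex.abs_re_le_norm _).trans h1
    have h4 := (abs_le.1 h3).1
    have h5 := mul_le_mul_of_nonneg_left h2 (l2norm_nonneg (dirDeriv (b i) φ))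
    have h6 := mul_nonneg (norm_nonneg V) (sq_nonneg (l2norm (dirDeriv (b i) φ) - l2norm φ))
    nlinarith
  have hsum : -(2 * ∑ i, (∫ x, inner ℂ (dirDeriv (b i) φ x) (V (b i) (φ x))).re) ≤
      ‖V‖ * (dirichlet φ + Module.finrank ℝ E * l2norm φ ^ 2) := by
    rw [Finset.mul_sum, ← Finset.sum_neg_distrib]
    refine (Finset.sum_le_sum fun i _ => hterm i).trans_eq ?_
    rw [← Finset.mul_sum, Finset.sum_add_distrib, dirichlet]
    simp [b]
  rw [hmix] at hsq
  have h0 := sq_nonneg (l2norm (Laplacian.laplacian φ))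
  linarith

end Energy

/-! ### The adjoint of the maximal operator -/

section Adjoint

open Filter

variable {E : Type*} [NormedAddCommGroup E] [InnerProductSpace ℝ E] [FiniteDimensional ℝ E]
  [MeasurableSpace E] [BorelSpace E]
  {F : Type*} [NormedAddCommGroup F] [InnerProductSpace ℂ F] [FiniteDimensional ℂ F]

theorem integrable_inner_of_test {φ : E → F} (hφ : IsTest φ) {v : E → F} (hv : MemLp v 2) :
    Integrable fun x => inner ℂ (φ x) (v x) := by
  have h := L2.integrable_inner (𝕜 := ℂ) (hφ.memLp.toLp φ) (hv.toLp v)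
  refine h.congr ?_
  filter_upwards [hφ.memLp.coeFn_toLp, hv.coeFn_toLp] with x hx hy
  rw [hx, hy]

theorem isTest_smul_const {ψ : E → ℝ} (hψ : IsTest ψ) (e : F) : IsTest fun x => ψ x • e :=
  ⟨hψ.1.smul contDiff_const, hψ.2.smul_right⟩

theorem laplacian_smul_const {ψ : E → ℝ} (hψ : ContDiff ℝ ∞ ψ) (e : F) (x : E) :
    Laplacian.laplacian (fun x => ψ x • e) x = Laplacian.laplacian ψ x • e := by
  have h := laplacian_smul_fun hψ (contDiff_const (c := e)) (stdOrthonormalBasis ℝ E) x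
  have h2 : ∀ v : E, dirDeriv v (fun _ : E => e) x = 0 := fun v => by simp [dirDeriv]
  have h3 : Laplacian.laplacian (fun _ : E => e) x = 0 := by
    rw [InnerProductSpace.laplacian_const]
    rfl
  simpa [h2, h3] using h

/-- Both sides of the weak equation, tested with `ψ` and paired with the vector `e`. -/
theorem integral_inner_airy_smul_const {V : E →L[ℝ] F →L[ℂ] F} (hV : IsSkew V) {ψ : E → ℝ}
    (hψ : IsTest ψ) (e : F) {v : E → F} (hv : MemLp v 2) :
    ∫ x, inner ℂ (airy V (fun x => ψ x • e) x) (v x) =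
      inner ℂ e (∫ x, ((-(Laplacian.laplacian ψ x)) • v x + ψ x • (-V) x (v x))) := by
  have hi : Integrable fun x => (-(Laplacian.laplacian ψ x)) • v x + ψ x • (-V) x (v x) := by
    refine Integrable.add ?_ ?_
    · exact (locInt_of_memLp hv).integrable_smul_left_of_hasCompactSupport
        (contDiff_laplacian hψ.1).neg.continuous hψ.2.laplacian.neg
    · exact integrable_clm_apply (c := fun y => ψ y • (-V) y)
        (hψ.1.continuous.smul (-V).continuous) hψ.2.smul_right (locInt_of_memLp hv)
  rw [← integral_inner hi]
  refine integral_congr_ae (.of_forall fun x => ?_)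
  simp only [airy]
  rw [laplacian_smul_const hψ.1, inner_add_left, inner_neg_left, hV, inner_add_right,
    ← Complex.coe_smul, ← Complex.coe_smul, ← Complex.coe_smul, ← Complex.coe_smul,
    inner_smul_left, inner_smul_left, inner_smul_right,
    inner_smul_right, Complex.conj_ofReal, Complex.conj_ofReal]
  simp

theorem integral_inner_smul_const {ψ : E → ℝ} (hψ : IsTest ψ) (e : F) {k : E → F}
    (hk : MemLp k 2) :
    ∫ x, inner ℂ (ψ x • e) (k x) = inner ℂ e (∫ x, ψ x • k x) := by
  rw [← integral_inner ((locInt_of_memLp hk).integrable_smul_left_of_hasCompactSupport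
    hψ.1.continuous hψ.2)]
  refine integral_congr_ae (.of_forall fun x => ?_)
  simp only
  rw [← Complex.coe_smul, ← Complex.coe_smul, inner_smul_left, inner_smul_right,
    Complex.conj_ofReal]

/-- The weak equation for `-V` says that `v` is in the domain of the adjoint of `-Δ + V` on test
functions. -/
theorem weakSol_neg_of_adjoint {V : E →L[ℝ] F →L[ℂ] F} (hV : IsSkew V) {v k : E → F}
    (hv : MemLp v 2) (hk : MemLp k 2)
    (h : ∀ φ : E → F, IsTest φ →
      ∫ x, inner ℂ (airy V φ x) (v x) = ∫ x, inner ℂ (φ x) (k x)) : WeakSol (-V) v k := by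
  intro ψ hψ hs
  refine ext_inner_left ℂ fun e => ?_
  rw [← integral_inner_airy_smul_const hV ⟨hψ, hs⟩ e hv, ← integral_inner_smul_const ⟨hψ, hs⟩ e hk]
  exact h _ (isTest_smul_const ⟨hψ, hs⟩ e)

theorem airy_sum (V : E →L[ℝ] F →L[ℂ] F) {ι : Type*} (s : Finset ι) {φ : ι → E → F}
    (hφ : ∀ i, ContDiff ℝ ∞ (φ i)) (x : E) :
    airy V (fun x => ∑ i ∈ s, φ i x) x = ∑ i ∈ s, airy V (φ i) x := by
  have hd : ∀ {φ : ι → E → F}, (∀ i, ContDiff ℝ ∞ (φ i)) → ∀ v : E,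
      dirDeriv v (fun x => ∑ i ∈ s, φ i x) = fun x => ∑ i ∈ s, dirDeriv v (φ i) x := by
    intro φ hφ v
    funext x
    simp only [dirDeriv]
    rw [fderiv_fun_sum fun i _ => (hφ i).differentiable (by simp) x]
    simp
  simp only [airy, Finset.sum_add_distrib, map_sum, Finset.sum_neg_distrib]
  rw [laplacian_eq_sum_dirDeriv (stdOrthonormalBasis ℝ E) (ContDiff.sum fun i _ => hφ i)]
  simp only [laplacian_eq_sum_dirDeriv (stdOrthonormalBasis ℝ E) (hφ _)]
  rw [Finset.sum_comm]
  congr 2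
  refine Finset.sum_congr rfl fun j _ => ?_
  rw [hd hφ, hd fun i => contDiff_dirDeriv _ (hφ i)]

/-- The weak equation may be tested with vector-valued test functions. -/
theorem WeakSol.integral_inner_airy {V : E →L[ℝ] F →L[ℂ] F} (hV : IsSkew V) {v k : E → F}
    (h : WeakSol (-V) v k) (hv : MemLp v 2) (hk : MemLp k 2) {φ : E → F} (hφ : IsTest φ) :
    ∫ x, inner ℂ (airy V φ x) (v x) = ∫ x, inner ℂ (φ x) (k x) := by
  have : FiniteDimensional ℝ F := FiniteDimensional.complexToReal F
  let b := Module.finBasis ℝ F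
  let L : ∀ i, F →L[ℝ] ℝ := fun i => LinearMap.toContinuousLinearMap (b.coord i)
  let ψ : Fin (Module.finrank ℝ F) → E → ℝ := fun i x => L i (φ x)
  have hψ : ∀ i, IsTest (ψ i) := fun i =>
    ⟨(L i).contDiff.comp hφ.1, hφ.2.comp_left (map_zero (L i))⟩
  have hsum : φ = fun x => ∑ i, ψ i x • b i := by
    funext x
    exact (b.sum_repr (φ x)).symm
  have h1 : ∀ i, ∫ x, inner ℂ (airy V (fun x => ψ i x • b i) x) (v x) =
      ∫ x, inner ℂ (ψ i x • b i) (k x) := fun i => by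
    rw [integral_inner_airy_smul_const hV (hψ i) _ hv, integral_inner_smul_const (hψ i) _ hk,
      h _ (hψ i).1 (hψ i).2]
  rw [hsum]
  simp only [airy_sum V Finset.univ fun i => (isTest_smul_const (hψ i) (b i)).1, sum_inner]
  rw [integral_finsetSum _ fun i _ => integrable_inner_of_test
    (isTest_airy V (isTest_smul_const (hψ i) (b i))) hv,
    integral_finsetSum _ fun i _ => integrable_inner_of_test (isTest_smul_const (hψ i) (b i)) hk]
  exact Finset.sum_congr rfl fun i _ => h1 i

/-- The maximal operators for `V` and `-V` are formally adjoint to each other, since test functions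
are a core of the former. -/
theorem WeakSol.integral_inner_eq {V : E →L[ℝ] F →L[ℂ] F} (hV : IsSkew V) {u f v k : E → F}
    (h : WeakSol V u f) (hu : MemLp u 2) (hf : MemLp f 2) (h' : WeakSol (-V) v k) (hv : MemLp v 2)
    (hk : MemLp k 2) : ∫ x, inner ℂ (f x) (v x) = ∫ x, inner ℂ (u x) (k x) := by
  have hLp : ∀ {a b : E → F} (ha : MemLp a 2) (hb : MemLp b 2),
      ∫ x, inner ℂ (a x) (b x) = inner ℂ (ha.toLp a) (hb.toLp b) := by
    intro a b ha hb
    rw [L2.inner_def]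
    refine integral_congr_ae ?_
    filter_upwards [ha.coeFn_toLp, hb.coeFn_toLp] with x hx hy
    rw [hx, hy]
  refine eq_of_forall_dist_le fun ε hε => ?_
  have hN : 0 < l2norm v + l2norm k + 1 := by
    have := l2norm_nonneg v
    have := l2norm_nonneg k
    positivity
  obtain ⟨φ, hφ, h1, h2⟩ := h.exists_test_approx hu hf (div_pos hε hN)
  have ha := isTest_airy V hφ
  have h3 := h'.integral_inner_airy hV hv hk hφ
  rw [hLp ha.memLp hv, hLp hφ.memLp hk] at h3
  rw [hLp hf hv, hLp hu hk, dist_eq_norm]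
  have h4 : inner ℂ (hf.toLp f) (hv.toLp v) - inner ℂ (hu.toLp u) (hk.toLp k) =
      inner ℂ ((hφ.memLp.sub hu).toLp (φ - u)) (hk.toLp k) -
        inner ℂ ((ha.memLp.sub hf).toLp (airy V φ - f)) (hv.toLp v) := by
    rw [MemLp.toLp_sub hφ.memLp hu, MemLp.toLp_sub ha.memLp hf, inner_sub_left, inner_sub_left, h3]
    ring
  rw [h4]
  have h5 := norm_inner_le_norm (𝕜 := ℂ) ((hφ.memLp.sub hu).toLp (φ - u)) (hk.toLp k)
  have h6 := norm_inner_le_norm (𝕜 := ℂ) ((ha.memLp.sub hf).toLp (airy V φ - f)) (hv.toLp v)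
  rw [norm_toLp_eq_l2norm, norm_toLp_eq_l2norm] at h5 h6
  refine (norm_sub_le _ _).trans ((add_le_add h5 h6).trans ?_)
  calc l2norm (φ - u) * l2norm k + l2norm (airy V φ - f) * l2norm v
      ≤ ε / (l2norm v + l2norm k + 1) * l2norm k + ε / (l2norm v + l2norm k + 1) * l2norm v :=
        add_le_add (mul_le_mul_of_nonneg_right h1 (l2norm_nonneg k))
          (mul_le_mul_of_nonneg_right h2 (l2norm_nonneg v))
    _ ≤ ε / (l2norm v + l2norm k + 1) * (l2norm v + l2norm k + 1) := by
        rw [← mul_add]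
        refine mul_le_mul_of_nonneg_left (by linarith) (by positivity)
    _ = ε := by field_simp

/-- An estimate on test functions extends to the domain of the maximal operator. -/
theorem WeakSol.l2norm_le_of_test {V : E →L[ℝ] F →L[ℂ] F} {C : ℝ} (hC : 0 ≤ C) {z : ℂ}
    (hb : ∀ φ : E → F, IsTest φ → l2norm φ ≤ C * l2norm (airy V φ - z • φ)) {u f : E → F}
    (h : WeakSol V u f) (hu : MemLp u 2) (hf : MemLp f 2) :
    l2norm u ≤ C * l2norm (f - z • u) := by
  refine le_of_forall_pos_le_add fun ε hε => ?_
  have hN : 0 < 1 + C * (1 + ‖z‖) := by positivity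
  obtain ⟨φ, hφ, h1, h2⟩ := h.exists_test_approx hu hf (div_pos hε hN)
  have ha := (isTest_airy V hφ).memLp
  have hd := hφ.memLp.sub hu
  have e1 : u = φ - (φ - u) := by abel
  have e2 : airy V φ - z • φ = (f - z • u) + ((airy V φ - f) - z • (φ - u)) := by
    rw [smul_sub]
    abel
  have h3 : l2norm u ≤ l2norm φ + l2norm (φ - u) := by
    nth_rewrite 1 [e1]
    exact l2norm_sub_le hφ.memLp hd
  have h4 : l2norm (airy V φ - z • φ) ≤
      l2norm (f - z • u) + (l2norm (airy V φ - f) + ‖z‖ * l2norm (φ - u)) := by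
    rw [e2]
    refine (l2norm_add_le (hf.sub (hu.const_smul z)) ((ha.sub hf).sub (hd.const_smul z))).trans ?_
    refine add_le_add le_rfl ((l2norm_sub_le (ha.sub hf) (hd.const_smul z)).trans ?_)
    rw [l2norm_const_smul]
  calc l2norm u ≤ C * l2norm (airy V φ - z • φ) + l2norm (φ - u) :=
        h3.trans (add_le_add (hb φ hφ) le_rfl)
    _ ≤ C * (l2norm (f - z • u) + (ε / (1 + C * (1 + ‖z‖)) +
          ‖z‖ * (ε / (1 + C * (1 + ‖z‖))))) + ε / (1 + C * (1 + ‖z‖)) := by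
        refine add_le_add (mul_le_mul_of_nonneg_left (h4.trans ?_) hC) h1
        gcongr
    _ = C * l2norm (f - z • u) + ε / (1 + C * (1 + ‖z‖)) * (1 + C * (1 + ‖z‖)) := by ring
    _ = C * l2norm (f - z • u) + ε := by rw [div_mul_cancel₀ _ hN.ne']

/-- The operator is accretive. -/
theorem WeakSol.neg_re_mul_l2norm_le {V : E →L[ℝ] F →L[ℂ] F} (hV : IsSkew V) {u f : E → F}
    (h : WeakSol V u f) (hu : MemLp u 2) (hf : MemLp f 2) {z : ℂ} (hz : z.re < 0) :
    l2norm u ≤ (-z.re)⁻¹ * l2norm (f - z • u) := by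
  have hz' : 0 < -z.re := by linarith
  refine h.l2norm_le_of_test (inv_nonneg.2 hz'.le) (fun φ hφ => ?_) hu hf
  rw [inv_mul_eq_div, le_div_iff₀ hz', mul_comm]
  exact _root_.neg_re_mul_l2norm_le hV hφ z

end Adjoint

/-! ### The operator `airyOp` -/

section AiryOp

theorem WeakSol.congr {E F : Type*} [NormedAddCommGroup E] [InnerProductSpace ℝ E]
    [FiniteDimensional ℝ E] [MeasurableSpace E] [BorelSpace E] [NormedAddCommGroup F]
    [InnerProductSpace ℂ F] {V : E →L[ℝ] F →L[ℂ] F} {u f u' f' : E → F} (h : WeakSol V u f)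
    (hu : u =ᵐ[volume] u') (hf : f =ᵐ[volume] f') : WeakSol V u' f' := by
  intro ψ hψ hs
  refine Eq.trans (integral_congr_ae ?_) ((h ψ hψ hs).trans (integral_congr_ae ?_))
  · filter_upwards [hu] with x hx
    rw [hx]
  · filter_upwards [hf] with x hx
    rw [hx]

variable {d D : ℕ}

/-- The Clifford potential as a continuous linear map. -/
noncomputable def potL (g : ℝ) (W : Matrix (Fin D) (Fin d) ℝ) :
    EuclideanSpace ℝ (Fin d) →L[ℝ] ClVal D →L[ℂ] ClVal D :=
  LinearMap.toContinuousLinearMap (cliffordPot g W)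

theorem potL_apply (g : ℝ) (W : Matrix (Fin D) (Fin d) ℝ) (A : EuclideanSpace ℝ (Fin d)) :
    potL g W A = leftMul (cliffordPotential g W A) := rfl

theorem potL_neg (g : ℝ) (W : Matrix (Fin D) (Fin d) ℝ) : potL g (-W) = -potL g W := by
  ext A : 1
  exact congrArg (fun L => L A) (cliffordPot_neg g W)

theorem isSkew_potL (g : ℝ) (W : Matrix (Fin D) (Fin d) ℝ) : IsSkew (potL g W) :=
  inner_cliffordPot g W

theorem mem_graph_iff_weakSol (g : ℝ) (W : Matrix (Fin D) (Fin d) ℝ) (u f : WaveSpace d D) :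
    (u, f) ∈ (airyOp g W).graph ↔ WeakSol (potL g W) u f :=
  mem_graph_airyOp g W u f

/-- The adjoint of the maximal operator for `W` is the maximal operator for `-W`, because left
multiplication by the potential is anti-Hermitian. -/
theorem isAdjointGraph_airyOp (g : ℝ) (W : Matrix (Fin D) (Fin d) ℝ) :
    IsAdjointGraph (airyOp g W) (airyOp g (-W)) := by
  intro v k
  rw [mem_graph_iff_weakSol, potL_neg]
  constructor
  · intro h u f huf
    rw [mem_graph_iff_weakSol] at huf
    rw [L2.inner_def, L2.inner_def]
    exact huf.integral_inner_eq (isSkew_potL g W) (Lp.memLp u) (Lp.memLp f) h (Lp.memLp v)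
      (Lp.memLp k)
  · intro h
    refine weakSol_neg_of_adjoint (isSkew_potL g W) (Lp.memLp v) (Lp.memLp k) fun φ hφ => ?_
    have ha := (isTest_airy (potL g W) hφ).memLp
    have h1 := h (hφ.memLp.toLp φ) (ha.toLp _) (by
      rw [mem_graph_iff_weakSol]
      exact (weakSol_airy (potL g W) hφ.1).congr hφ.memLp.coeFn_toLp.symm ha.coeFn_toLp.symm)
    rw [L2.inner_def, L2.inner_def] at h1
    refine Eq.trans (integral_congr_ae ?_) (h1.trans (integral_congr_ae ?_))
    · filter_upwards [ha.coeFn_toLp] with x hx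
      rw [hx]
    · filter_upwards [hφ.memLp.coeFn_toLp] with x hx
      rw [hx]

theorem boundedBelowAt_airyOp {z : ℂ} (g : ℝ) (W : Matrix (Fin D) (Fin d) ℝ) {C : ℝ}
    (hC : ∀ u f : EuclideanSpace ℝ (Fin d) → ClVal D, MemLp u 2 → MemLp f 2 →
      WeakSol (potL g W) u f → l2norm u ≤ C * l2norm (f - z • u)) :
    BoundedBelowAt (airyOp g W) z := by
  refine ⟨C, fun u f huf => ?_⟩
  rw [mem_graph_iff_weakSol] at huf
  refine (hC u f (Lp.memLp u) (Lp.memLp f) huf).trans_eq ?_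
  rw [norm_eq_l2norm]
  congr 1
  refine l2norm_congr ?_
  filter_upwards [Lp.coeFn_sub f (z • u), Lp.coeFn_smul z u] with x h1 h2
  rw [h1, Pi.sub_apply, Pi.sub_apply, h2]

theorem boundedBelowAt_airyOp_of_re_neg (g : ℝ) (W : Matrix (Fin D) (Fin d) ℝ) {z : ℂ}
    (hz : z.re < 0) : BoundedBelowAt (airyOp g W) z :=
  boundedBelowAt_airyOp g W fun _ _ hu hf h => h.neg_re_mul_l2norm_le (isSkew_potL g W) hu hf hz

theorem notMem_opSpectrum_airyOp_iff (g : ℝ) (W : Matrix (Fin D) (Fin d) ℝ) (z : ℂ) :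
    z ∉ opSpectrum (airyOp g W) ↔
      BoundedBelowAt (airyOp g W) z ∧ BoundedBelowAt (airyOp g (-W)) (starRingEnd ℂ z) :=
  notMem_opSpectrum_iff (isAdjointGraph_airyOp g W)
    (by simpa using isAdjointGraph_airyOp g (-W)) z

/-- The skew potential makes the operator accretive, so its spectrum lies in the closed right
half-plane. -/
theorem spectrumBoundedBelow_airyOp (g : ℝ) (W : Matrix (Fin D) (Fin d) ℝ) :
    SpectrumBoundedBelow (airyOp g W) := by
  refine ⟨0, fun z hz => ?_⟩
  by_contra! hneg
  exact (notMem_opSpectrum_airyOp_iff g W z).2 ⟨boundedBelowAt_airyOp_of_re_neg g W hneg,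
    boundedBelowAt_airyOp_of_re_neg g (-W) (by simpa using hneg)⟩ hz

end AiryOp

/-! ### Compactness of the resolvent -/

section Compactness

open Filter

variable {E : Type*} [NormedAddCommGroup E] [InnerProductSpace ℝ E] [FiniteDimensional ℝ E]
  [MeasurableSpace E] [BorelSpace E]
  {F : Type*} [NormedAddCommGroup F] [InnerProductSpace ℂ F] [FiniteDimensional ℂ F]

theorem l2norm_dirDeriv_sq_le {φ : E → F} (hφ : IsTest φ) (v : E) :
    l2norm (dirDeriv v φ) ^ 2 ≤ ‖v‖ ^ 2 * dirichlet φ := by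
  let b := stdOrthonormalBasis ℝ E
  have hi : ∀ w : E, Integrable fun x => ‖dirDeriv w φ x‖ ^ 2 := fun w =>
    (memLp_two_iff_integrable_sq_norm (hφ.dirDeriv w).memLp.1).1 (hφ.dirDeriv w).memLp
  rw [dirichlet, l2norm_sq (hφ.dirDeriv v).memLp]
  simp only [l2norm_sq (hφ.dirDeriv _).memLp]
  rw [← integral_finsetSum _ fun i _ => hi _, ← integral_const_mul]
  refine integral_mono (hi v) ((integrable_finsetSum _ fun i _ => hi _).const_mul _) fun x => ?_
  have h1 : dirDeriv v φ x = ∑ i, b.repr v i • dirDeriv (b i) φ x := by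
    simp only [dirDeriv]
    nth_rewrite 1 [← b.sum_repr v]
    simp
  have h2 : ‖dirDeriv v φ x‖ ≤ ∑ i, |b.repr v i| * ‖dirDeriv (b i) φ x‖ := by
    rw [h1]
    refine (norm_sum_le _ _).trans_eq (Finset.sum_congr rfl fun i _ => ?_)
    rw [norm_smul, Real.norm_eq_abs]
  have h3 : ‖v‖ ^ 2 = ∑ i, |b.repr v i| ^ 2 := by
    rw [← b.repr.norm_map v, EuclideanSpace.real_norm_sq_eq]
    simp
  simp only
  calc ‖dirDeriv v φ x‖ ^ 2 ≤ (∑ i, |b.repr v i| * ‖dirDeriv (b i) φ x‖) ^ 2 :=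
        pow_le_pow_left₀ (norm_nonneg _) h2 2
    _ ≤ _ := by
        rw [h3]
        exact Finset.sum_mul_sq_le_sq_mul_sq _ _ _

/-- Translations move a function of finite energy by at most `‖y‖ ‖∇ φ‖`: Minkowski's inequality,
applied to `φ (x - y) - φ x = -∫₀¹ (∂_y φ) (x - t y) dt`. -/
theorem lintegral_translation_le {φ : E → F} (hφ : IsTest φ) (y : E) :
    ∫⁻ x, ‖φ (x - y) - φ x‖ₑ ^ 2 ≤ ENNReal.ofReal (‖y‖ ^ 2 * dirichlet φ) := by
  let k : ℝ → ℝ := Set.indicator (Set.Ioc 0 1) 1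
  have hk : Measurable k := measurable_one.indicator measurableSet_Ioc
  have hk1 : ∫⁻ t, ‖k t‖ₑ = 1 := by
    have : ∀ t, ‖k t‖ₑ = Set.indicator (Set.Ioc (0 : ℝ) 1) 1 t := fun t => by
      by_cases ht : t ∈ Set.Ioc (0 : ℝ) 1 <;> simp [k, ht]
    simp only [this]
    rw [lintegral_indicator_one measurableSet_Ioc]
    simp
  have hdy := hφ.dirDeriv y
  have hftc : ∀ x, φ (x - y) - φ x = ∫ t, k t • (-dirDeriv y φ (x - t • y)) := by
    intro x
    have h1 : ∀ t ∈ Set.uIcc (0 : ℝ) 1,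
        HasDerivAt (fun t : ℝ => φ (x - t • y)) (-dirDeriv y φ (x - t • y)) t := by
      intro t _
      have h2 : HasDerivAt (fun t : ℝ => x - t • y) (-y) t := by
        simpa using ((hasDerivAt_id t).smul_const y).const_sub x
      have h3 := ((hφ.1.differentiable (by simp)) (x - t • y)).hasFDerivAt.comp_hasDerivAt t h2
      simpa [dirDeriv, Function.comp_def] using h3
    have hc : Continuous fun t : ℝ => -dirDeriv y φ (x - t • y) := by
      have := hdy.1.continuous
      fun_prop
    have h4 := intervalIntegral.integral_eq_sub_of_hasDerivAt h1 (hc.intervalIntegrable _ _)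
    simp only [one_smul, zero_smul, sub_zero] at h4
    rw [← h4, intervalIntegral.integral_of_le zero_le_one,
      ← integral_indicator measurableSet_Ioc]
    refine integral_congr_ae (.of_forall fun t => ?_)
    by_cases ht : t ∈ Set.Ioc (0 : ℝ) 1 <;> simp [k, ht]
  simp only [hftc]
  have hcont : Continuous (Function.uncurry fun (x : E) (t : ℝ) => -dirDeriv y φ (x - t • y)) := by
    have := hdy.1.continuous
    simp only [Function.uncurry_def]
    fun_prop
  refine (lintegral_enorm_integral_sq_le hk.aemeasurable hcont.aestronglyMeasurable).trans ?_
  have h5 : ∀ t : ℝ, ∫⁻ x, ‖-dirDeriv y φ (x - t • y)‖ₑ ^ 2 =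
      ENNReal.ofReal (l2norm (dirDeriv y φ) ^ 2) := fun t => by
    simp only [enorm_neg]
    rw [lintegral_sub_right_eq_self (fun x => ‖dirDeriv y φ x‖ₑ ^ 2) (t • y),
      ofReal_l2norm_sq hdy.memLp]
  simp only [h5]
  rw [lintegral_mul_const _ hk.enorm, hk1, one_mul, one_mul]
  exact ENNReal.ofReal_le_ofReal (l2norm_dirDeriv_sq_le hφ y)

/-- Mollified `L²` functions are equicontinuous. -/
theorem IsTest.exists_equicontinuous {ρ : E → ℝ} (hρ : IsTest ρ) {η : ℝ} (hη : 0 < η) :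
    ∃ δ : ℝ, 0 < δ ∧ ∀ u : E → F, MemLp u 2 → ∀ x x' : E, ‖x - x'‖ < δ →
      ‖conv ρ u x - conv ρ u x'‖ ≤ η * l2norm u := by
  have hρc : IsTest fun x => (ρ x : ℂ) :=
    ⟨Complex.ofRealCLM.contDiff.comp hρ.1, hρ.2.comp_left Complex.ofReal_zero⟩
  obtain ⟨δ, hδ, hδρ⟩ := exists_translation_lintegral_le hρc.memLp hη
  refine ⟨δ, hδ, fun u hu x x' hxx => ?_⟩
  have hsub : ∀ x : E, IsTest fun y => ρ (x - y) := fun x =>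
    ⟨hρ.1.comp (contDiff_const.sub contDiff_id), hρ.2.comp_homeomorph (Homeomorph.subLeft x)⟩
  have hi : ∀ x, Integrable fun y => ρ (x - y) • u y := fun x =>
    (locInt_of_memLp hu).integrable_smul_left_of_hasCompactSupport (hsub x).1.continuous (hsub x).2
  let a : E → ℂ := fun y => ((‖ρ (x - y) - ρ (x' - y)‖ : ℝ) : ℂ)
  let b : E → ℂ := fun y => ((‖u y‖ : ℝ) : ℂ)
  have hac : Continuous a := by
    have := hρ.1.continuous
    fun_prop
  have hale : MemLp a 2 ∧ l2norm a ≤ η := by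
    refine memLp_of_lintegral_le hac.aestronglyMeasurable hη.le ?_
    have h1 : ∀ y, ‖a y‖ₑ = (fun z => ‖((ρ (z - (x' - x)) : ℝ) : ℂ) - (ρ z : ℂ)‖ₑ) (x' - y) := by
      intro y
      simp only [a]
      rw [← Complex.ofReal_sub, ← ofReal_norm, ← ofReal_norm, Complex.norm_real, Complex.norm_real,
        norm_norm]
      congr 3
      abel_nf
    simp only [h1]
    rw [lintegral_sub_left_eq_self (fun z => ‖((ρ (z - (x' - x)) : ℝ) : ℂ) - (ρ z : ℂ)‖ₑ ^ 2) x']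
    exact hδρ (x' - x) (by rwa [norm_sub_rev])
  have hb : MemLp b 2 ∧ l2norm b ≤ l2norm u := by
    have hbm : AEStronglyMeasurable b volume :=
      Complex.continuous_ofReal.comp_aestronglyMeasurable hu.1.norm
    have hbn : ∀ y, ‖b y‖ = ‖u y‖ := fun y => by simp [b]
    exact ⟨hu.mono hbm (.of_forall fun y => (hbn y).le), l2norm_mono hu fun y => (hbn y).le⟩
  have h2 := norm_integral_inner_le hale.1 hb.1
  have h3 : ∫ y, inner ℂ (a y) (b y) = ((∫ y, ‖ρ (x - y) - ρ (x' - y)‖ * ‖u y‖ : ℝ) : ℂ) := by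
    rw [← integral_complex_ofReal]
    refine integral_congr_ae (.of_forall fun y => ?_)
    simp [a, b, mul_comm]
  rw [conv_swap, conv_swap, ← integral_sub (hi x) (hi x')]
  calc ‖∫ y, (ρ (x - y) • u y - ρ (x' - y) • u y)‖
      ≤ ∫ y, ‖ρ (x - y) - ρ (x' - y)‖ * ‖u y‖ := by
        refine (norm_integral_le_integral_norm _).trans_eq (integral_congr_ae (.of_forall fun y => ?_))
        simp only
        rw [← sub_smul, norm_smul]
    _ ≤ ‖∫ y, inner ℂ (a y) (b y)‖ := by
        rw [h3, Complex.norm_real]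
        exact le_abs_self _
    _ ≤ l2norm a * l2norm b := h2
    _ ≤ η * l2norm u := mul_le_mul hale.2 hb.2 (l2norm_nonneg _) hη.le

/-- Equicontinuous functions on a compact set are close in `L²` to piecewise constant functions on
a fixed finite partition. -/
theorem exists_finiteDimensional_piecewise {K : Set E} (hK : IsCompact K) {δ : ℝ} (hδ : 0 < δ) :
    ∃ S : Submodule ℂ (Lp F 2 (volume : Measure E)), FiniteDimensional ℂ S ∧
      ∀ (w : E → F) (c : ℝ), 0 ≤ c → (∀ x x', ‖x - x'‖ < δ → ‖w x - w x'‖ ≤ c) →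
        ∃ v : E → F, ∃ hv : MemLp v 2 (volume : Measure E), hv.toLp v ∈ S ∧ (∀ x ∉ K, v x = 0) ∧
          ∀ x ∈ K, ‖w x - v x‖ ≤ c := by
  -- the pieces are the Voronoi cells in `K` of points `e 0, …, e N`, which include the centres of a
  -- finite cover by balls of radius `δ`; the further point `0` that may occur is harmless
  obtain ⟨t, -, htf, htK⟩ := hK.finite_cover_balls hδ
  obtain ⟨e, N, heN⟩ : ∃ (e : ℕ → E) (N : ℕ), ∀ a ∈ t, ∃ k ≤ N, e k = a := by
    refine ⟨fun n => htf.toFinset.toList.getD n 0, htf.toFinset.toList.length, fun a ha => ?_⟩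
    obtain ⟨k, hk, hka⟩ := List.getElem_of_mem (Finset.mem_toList.2 (htf.mem_toFinset.2 ha))
    exact ⟨k, hk.le, (List.getD_eq_getElem _ _ hk).trans hka⟩
  let p : E → ℕ := SimpleFunc.nearestPtInd e N
  have hp : Measurable p := SimpleFunc.measurable (SimpleFunc.nearestPtInd e N)
  have hpN : ∀ x, p x ≤ N := fun x => SimpleFunc.nearestPtInd_le e N x
  let q : (Fin (N + 1) → F) → E → F := fun a =>
    K.indicator fun x => a ⟨p x, Nat.lt_succ_of_le (hpN x)⟩
  have hq : ∀ a, MemLp (q a) 2 := by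
    intro a
    have hm : StronglyMeasurable fun x => a ⟨p x, Nat.lt_succ_of_le (hpN x)⟩ := by
      let b : ℕ → F := fun n => if h : n < N + 1 then a ⟨n, h⟩ else 0
      have hb : (fun x => a ⟨p x, Nat.lt_succ_of_le (hpN x)⟩) = fun x => b (p x) := by
        funext x
        have h : p x < N + 1 := Nat.lt_succ_of_le (hpN x)
        simp only [b]
        rw [dif_pos h]
      rw [hb]
      exact (continuous_of_discreteTopology (f := b)).stronglyMeasurable.comp_measurable hp
    rw [memLp_indicator_iff_restrict hK.measurableSet]
    have : IsFiniteMeasure ((volume : Measure E).restrict K) :=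
      isFiniteMeasure_restrict.2 hK.measure_lt_top.ne
    exact MemLp.of_bound hm.aestronglyMeasurable (∑ k, ‖a k‖) (.of_forall fun x =>
      Finset.single_le_sum (f := fun k => ‖a k‖) (fun k _ => norm_nonneg _) (Finset.mem_univ _))
  let Λ : (Fin (N + 1) → F) →ₗ[ℂ] Lp F 2 (volume : Measure E) :=
    { toFun := fun a => (hq a).toLp (q a)
      map_add' := fun a b => by
        rw [← MemLp.toLp_add]
        congr 1
        exact Set.indicator_add _ _ _
      map_smul' := fun c a => by
        rw [RingHom.id_apply, ← MemLp.toLp_const_smul]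
        congr 1
        funext x
        exact congrFun (Set.indicator_const_smul K c
          (fun x => a ⟨p x, Nat.lt_succ_of_le (hpN x)⟩)) x }
  refine ⟨Λ.range, inferInstance, fun w c hc hw => ?_⟩
  refine ⟨q fun k => w (e k), hq fun k => w (e k), ⟨fun k => w (e k), rfl⟩,
    fun x hx => Set.indicator_of_notMem hx _, fun x hx => ?_⟩
  simp only [q]
  rw [Set.indicator_of_mem hx]
  refine hw _ _ ?_
  obtain ⟨a, ha, hxa⟩ := Set.mem_iUnion₂.1 (htK hx)
  obtain ⟨k, hk, rfl⟩ := heN a ha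
  have h1 := SimpleFunc.edist_nearestPt_le e x hk
  rw [edist_dist, edist_dist, ENNReal.ofReal_le_ofReal_iff dist_nonneg] at h1
  rw [← dist_eq_norm, dist_comm]
  refine h1.trans_lt ?_
  rwa [dist_comm]

/-- The unit ball of the graph norm is almost finite-dimensional if the potential grows linearly
in all directions: mass escapes neither to infinity nor to high frequencies. -/
theorem exists_finiteDimensional_approx_test {V : E →L[ℝ] F →L[ℂ] F} (hV : IsSkew V) {c : ℝ}
    (hc : 0 < c) (hcV : ∀ (x : E) (ψ : F), c * (‖x‖ * ‖ψ‖) ≤ ‖V x ψ‖) {ε : ℝ} (hε : 0 < ε) :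
    ∃ S : Submodule ℂ (Lp F 2 (volume : Measure E)), FiniteDimensional ℂ S ∧
      ∀ φ : E → F, IsTest φ → ∃ v : E → F, ∃ hv : MemLp v 2 (volume : Measure E), hv.toLp v ∈ S ∧
        l2norm (φ - v) ≤ ε * (l2norm φ + l2norm (airy V φ)) := by
  obtain ⟨P, hPdef⟩ : ∃ P : ℝ, P = 1 + ‖V‖ * (1 + Module.finrank ℝ E) := ⟨_, rfl⟩
  have hP : 1 ≤ P := by
    rw [hPdef]
    have : 0 ≤ ‖V‖ * (1 + (Module.finrank ℝ E : ℝ)) := by positivity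
    linarith
  have hε3 : 0 < ε / 3 := by positivity
  -- outside of the ball of radius `M` the potential is at least `c M = P / (ε / 3)`, whereas
  -- `‖V φ‖ ≤ P N`, so that the mass there is at most `N ε / 3`
  obtain ⟨M, hMdef⟩ : ∃ M : ℝ, M = P / (c * (ε / 3)) := ⟨_, rfl⟩
  have hM : 0 < M := by rw [hMdef]; positivity
  obtain ⟨K, hKdef⟩ : ∃ K : Set E, K = closedBall 0 M := ⟨_, rfl⟩
  have hK : IsCompact K := hKdef ▸ isCompact_closedBall 0 M
  obtain ⟨ρ, hρ⟩ := exists_isMollifier (E := E) hε3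
  obtain ⟨vol, hvoldef⟩ : ∃ r : ℝ, r = (volume K).toReal := ⟨_, rfl⟩
  have hvol : 0 ≤ vol := hvoldef ▸ ENNReal.toReal_nonneg
  -- an error of `η N`, uniform on `K`, is at most `N ε / 3` in `L²`; `1 + vol` dominates `√vol`
  obtain ⟨η, hηdef⟩ : ∃ η : ℝ, η = ε / 3 / (1 + vol) := ⟨_, rfl⟩
  have hη : 0 < η := by rw [hηdef]; positivity
  obtain ⟨δ, hδ, hδρ⟩ := hρ.isTest.exists_equicontinuous (F := F) hη
  obtain ⟨S, hS, hSK⟩ := exists_finiteDimensional_piecewise (F := F) hK hδ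
  refine ⟨S, hS, fun φ hφ => ?_⟩
  obtain ⟨N, hN⟩ : ∃ N : ℝ, N = l2norm φ + l2norm (airy V φ) := ⟨_, rfl⟩
  have hφ0 := l2norm_nonneg φ
  have ha0 := l2norm_nonneg (airy V φ)
  have hN0 : 0 ≤ N := by rw [hN]; positivity
  obtain ⟨v, hv, hvS, hv0, hvK⟩ := hSK (conv ρ φ) (η * N) (by positivity) fun x x' hxx =>
    (hδρ φ hφ.memLp x x' hxx).trans (by gcongr; linarith)
  refine ⟨v, hv, hvS, ?_⟩
  rw [← hN]
  have hdir : dirichlet φ ≤ N ^ 2 := (dirichlet_le hV hφ).trans (by nlinarith)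
  have hcm : MemLp (conv ρ φ) 2 := (memLp_conv hρ.isTest hφ.memLp).1
  have hVφ : l2norm (fun x => V x (φ x)) ≤ P * N := by
    refine le_of_sq_le_sq ?_ (by positivity)
    refine (l2norm_potential_sq_le hV hφ).trans ?_
    have h1 : l2norm φ ^ 2 ≤ N ^ 2 := pow_le_pow_left₀ hφ0 (by linarith) 2
    have h2 : l2norm (airy V φ) ^ 2 ≤ N ^ 2 := pow_le_pow_left₀ ha0 (by linarith) 2
    calc l2norm (airy V φ) ^ 2 + ‖V‖ * (dirichlet φ + Module.finrank ℝ E * l2norm φ ^ 2)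
        ≤ N ^ 2 + ‖V‖ * (N ^ 2 + Module.finrank ℝ E * N ^ 2) := by gcongr
      _ = P * N ^ 2 := by rw [hPdef]; ring
      _ ≤ P ^ 2 * N ^ 2 := by gcongr; nlinarith
      _ = (P * N) ^ 2 := by ring
  have hcc : MemLp (φ - conv ρ φ) 2 := hφ.memLp.sub hcm
  have hcv : MemLp (conv ρ φ - v) 2 := hcm.sub hv
  -- the mass outside of `K`, the high frequencies in `K`, and the variation within the pieces
  have e1 : l2norm (Kᶜ.indicator φ) ≤ ε / 3 * N := by
    have hs : MemLp ((c * M)⁻¹ • fun x => V x (φ x)) 2 := (hφ.potential V).memLp.const_smul _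
    calc l2norm (Kᶜ.indicator φ) ≤ l2norm ((c * M)⁻¹ • fun x => V x (φ x)) := by
          refine l2norm_mono hs fun x => ?_
          by_cases hx : x ∈ K
          · rw [Set.indicator_of_notMem (by simpa using hx), norm_zero]
            exact norm_nonneg _
          · rw [Set.indicator_of_mem hx, Pi.smul_apply, norm_smul, norm_inv, Real.norm_eq_abs,
              abs_of_pos (by positivity), inv_mul_eq_div, le_div_iff₀ (by positivity)]
            have hxM : M ≤ ‖x‖ := by
              simp only [hKdef, mem_closedBall_zero_iff, not_le] at hx
              exact hx.le
            calc ‖φ x‖ * (c * M) = c * (M * ‖φ x‖) := by ring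
              _ ≤ c * (‖x‖ * ‖φ x‖) := by gcongr
              _ ≤ _ := hcV x (φ x)
      _ = (c * M)⁻¹ * l2norm (fun x => V x (φ x)) := by
          rw [l2norm_const_smul, norm_inv, Real.norm_eq_abs, abs_of_pos (by positivity)]
      _ ≤ (c * M)⁻¹ * (P * N) := by gcongr
      _ = ε / 3 * N := by
          have : P ≠ 0 := by positivity
          rw [hMdef]
          field_simp
  have e2 : l2norm (K.indicator (φ - conv ρ φ)) ≤ ε / 3 * N := by
    refine (l2norm_mono hcc fun x => norm_indicator_le_norm_self _ _).trans ?_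
    rw [← l2norm_neg, neg_sub]
    refine hρ.l2norm_conv_sub_le hφ.memLp (by positivity) fun y hy =>
      (lintegral_translation_le hφ y).trans (ENNReal.ofReal_le_ofReal ?_)
    rw [mul_pow]
    have := dirichlet_nonneg φ
    gcongr
  have e3 : l2norm (K.indicator (conv ρ φ - v)) ≤ ε / 3 * N := by
    refine (memLp_of_lintegral_le (hcv.indicator hK.measurableSet).1 (by positivity) ?_).2
    calc ∫⁻ x, ‖K.indicator (conv ρ φ - v) x‖ₑ ^ 2
        ≤ ∫⁻ x, K.indicator (fun _ => ENNReal.ofReal ((η * N) ^ 2)) x := by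
          refine lintegral_mono fun x => ?_
          by_cases hx : x ∈ K
          · rw [Set.indicator_of_mem hx, Set.indicator_of_mem hx, ← ofReal_norm,
              ← ENNReal.ofReal_pow (norm_nonneg _)]
            exact ENNReal.ofReal_le_ofReal (pow_le_pow_left₀ (norm_nonneg _) (hvK x hx) 2)
          · simp [Set.indicator_of_notMem hx]
      _ = ENNReal.ofReal ((η * N) ^ 2) * ENNReal.ofReal vol := by
          rw [lintegral_indicator_const hK.measurableSet, hvoldef,
            ENNReal.ofReal_toReal hK.measure_lt_top.ne]
      _ ≤ ENNReal.ofReal ((ε / 3 * N) ^ 2) := by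
          rw [← ENNReal.ofReal_mul (by positivity)]
          refine ENNReal.ofReal_le_ofReal ?_
          have h1 : ε / 3 = η * (1 + vol) := by rw [hηdef]; field_simp
          rw [h1]
          have h2 : (η * (1 + vol) * N) ^ 2 - (η * N) ^ 2 * vol =
            (η * N) ^ 2 * (1 + vol + vol ^ 2) := by ring
          have h3 : 0 ≤ (η * N) ^ 2 * (1 + vol + vol ^ 2) := by positivity
          linarith
  have hsplit : φ - v =
      Kᶜ.indicator φ + (K.indicator (φ - conv ρ φ) + K.indicator (conv ρ φ - v)) := by
    funext x
    by_cases hx : x ∈ K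
    · simp [hx]
    · simp [hx, hv0 x hx]
  have hKm := hK.measurableSet
  have m1 : MemLp (Kᶜ.indicator φ) 2 volume := hφ.memLp.indicator hKm.compl
  have m2 : MemLp (K.indicator (φ - conv ρ φ)) 2 volume := hcc.indicator hKm
  have m3 : MemLp (K.indicator (conv ρ φ - v)) 2 volume := hcv.indicator hKm
  calc l2norm (φ - v) = l2norm
        (Kᶜ.indicator φ + (K.indicator (φ - conv ρ φ) + K.indicator (conv ρ φ - v))) := by
        rw [← hsplit]
    _ ≤ ε / 3 * N + (ε / 3 * N + ε / 3 * N) :=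
        (l2norm_add_le m1 (m2.add m3)).trans
          (add_le_add e1 ((l2norm_add_le m2 m3).trans (add_le_add e2 e3)))
    _ = ε * N := by ring

/-- The same for the domain of the maximal operator, in which test functions are dense. -/
theorem exists_finiteDimensional_approx {V : E →L[ℝ] F →L[ℂ] F} (hV : IsSkew V) {c : ℝ}
    (hc : 0 < c) (hcV : ∀ (x : E) (ψ : F), c * (‖x‖ * ‖ψ‖) ≤ ‖V x ψ‖) {ε : ℝ} (hε : 0 < ε) :
    ∃ S : Submodule ℂ (Lp F 2 (volume : Measure E)), FiniteDimensional ℂ S ∧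
      ∀ u f : E → F, MemLp u 2 → MemLp f 2 → WeakSol V u f →
        ∃ v : E → F, ∃ hv : MemLp v 2 (volume : Measure E), hv.toLp v ∈ S ∧
          l2norm (u - v) ≤ ε * (l2norm u + l2norm f) := by
  obtain ⟨S, hS, hSφ⟩ := exists_finiteDimensional_approx_test hV hc hcV (half_pos hε)
  refine ⟨S, hS, fun u f hu hf huf => ?_⟩
  have hf0 := l2norm_nonneg f
  rcases (l2norm_nonneg u).eq_or_lt with hu0 | hu0
  · refine ⟨0, MemLp.zero, ?_, ?_⟩
    · rw [MemLp.toLp_zero]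
      exact S.zero_mem
    · rw [sub_zero, ← hu0]
      positivity
  set N := l2norm u + l2norm f with hN
  have hNpos : 0 < N := by positivity
  let θ : ℝ := ε / 2 / (1 + ε) * N
  have hθ : 0 < θ := by positivity
  obtain ⟨φ, hφ, h1, h2⟩ := huf.exists_test_approx hu hf hθ
  obtain ⟨v, hv, hvS, hvφ⟩ := hSφ φ hφ
  refine ⟨v, hv, hvS, ?_⟩
  have ha := (isTest_airy V hφ).memLp
  have h3 : l2norm φ ≤ θ + l2norm u :=
    calc l2norm φ = l2norm ((φ - u) + u) := by rw [sub_add_cancel]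
      _ ≤ _ := (l2norm_add_le (hφ.memLp.sub hu) hu).trans (add_le_add_left h1 _)
  have h4 : l2norm (airy V φ) ≤ θ + l2norm f :=
    calc l2norm (airy V φ) = l2norm ((airy V φ - f) + f) := by rw [sub_add_cancel]
      _ ≤ _ := (l2norm_add_le (ha.sub hf) hf).trans (add_le_add_left h2 _)
  have h5 : l2norm (u - v) ≤ θ + l2norm (φ - v) :=
    calc l2norm (u - v) = l2norm ((u - φ) + (φ - v)) := by rw [sub_add_sub_cancel]
      _ ≤ l2norm (u - φ) + l2norm (φ - v) := l2norm_add_le (hu.sub hφ.memLp) (hφ.memLp.sub hv)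
      _ ≤ _ := by
        rw [← l2norm_neg, neg_sub]
        exact add_le_add_left h1 _
  calc l2norm (u - v) ≤ θ + ε / 2 * ((θ + l2norm u) + (θ + l2norm f)) := by
        have : ε / 2 * (l2norm φ + l2norm (airy V φ)) ≤
            ε / 2 * ((θ + l2norm u) + (θ + l2norm f)) := by gcongr
        linarith
    _ = θ * (1 + ε) + ε / 2 * N := by rw [hN]; ring
    _ = ε * N := by
      simp only [θ]
      field_simp
      ring

variable {d D : ℕ} {g : ℝ} {W : Matrix (Fin D) (Fin d) ℝ}

/-- The operator with injective `W` has compact resolvent, hence discrete spectrum. The point `-1`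
is in the resolvent set by accretivity. -/
theorem hasDiscreteSpectrum_airyOp (hg : g ≠ 0) (hW : Function.Injective W.mulVec) :
    HasDiscreteSpectrum (airyOp g W) := by
  obtain ⟨R, hR⟩ := exists_isResolventAt (isAdjointGraph_airyOp g W)
    (by simpa using isAdjointGraph_airyOp g (-W)) (z := -1)
    (boundedBelowAt_airyOp_of_re_neg g W (by simp))
    (boundedBelowAt_airyOp_of_re_neg g (-W) (by simp))
  refine hasDiscreteSpectrum_of_compact_resolvent hR (hR.isCompactOperator fun ε hε => ?_)
  obtain ⟨c, hc, hcV⟩ := exists_le_norm_cliffordPot hg hW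
  obtain ⟨S, hS, hSu⟩ := exists_finiteDimensional_approx (isSkew_potL g W) hc hcV hε
  refine ⟨S, hS, fun u f huf => ?_⟩
  rw [mem_graph_iff_weakSol] at huf
  obtain ⟨v, hv, hvS, h⟩ := hSu u f (Lp.memLp u) (Lp.memLp f) huf
  refine ⟨hv.toLp v, hvS, ?_⟩
  have h6 : u - hv.toLp v = ((Lp.memLp u).sub hv).toLp (⇑u - v) := by
    rw [MemLp.toLp_sub (Lp.memLp u) hv, Lp.toLp_coeFn]
  rw [h6, norm_toLp_eq_l2norm, norm_eq_l2norm, norm_eq_l2norm]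
  exact h

end Compactness

/-! ### Orthogonal splittings of the configuration space -/

section Split

variable {E E₁ E₂ : Type*} [NormedAddCommGroup E] [InnerProductSpace ℝ E] [FiniteDimensional ℝ E]
  [MeasurableSpace E] [BorelSpace E]
  [NormedAddCommGroup E₁] [InnerProductSpace ℝ E₁] [FiniteDimensional ℝ E₁]
  [MeasurableSpace E₁] [BorelSpace E₁]
  [NormedAddCommGroup E₂] [InnerProductSpace ℝ E₂] [FiniteDimensional ℝ E₂]
  [MeasurableSpace E₂] [BorelSpace E₂]
  {F : Type*} [NormedAddCommGroup F] [InnerProductSpace ℂ F]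

/-- The linear coordinates on `E` given by an isometry from the orthogonal sum of `E₁` and `E₂`,
on the plain product. -/
noncomputable def splitCoord (L : WithLp 2 (E₁ × E₂) ≃ₗᵢ[ℝ] E) : (E₁ × E₂) ≃L[ℝ] E :=
  (WithLp.prodContinuousLinearEquiv 2 ℝ E₁ E₂).symm.trans L.toContinuousLinearEquiv

theorem splitCoord_apply (L : WithLp 2 (E₁ × E₂) ≃ₗᵢ[ℝ] E) (z : E₁ × E₂) :
    splitCoord L z = L (WithLp.toLp 2 z) := rfl

theorem measurePreserving_splitCoord (L : WithLp 2 (E₁ × E₂) ≃ₗᵢ[ℝ] E) :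
    MeasurePreserving (splitCoord L) (volume.prod volume) volume := by
  have h1 : MeasurePreserving (WithLp.toLp 2 : E₁ × E₂ → WithLp 2 (E₁ × E₂))
      (volume.prod volume) volume := WithLp.volume_preserving_toLp E₁ E₂
  exact L.measurePreserving.comp h1

theorem lintegral_splitCoord (L : WithLp 2 (E₁ × E₂) ≃ₗᵢ[ℝ] E) {f : E → ENNReal}
    (hf : Measurable f) : ∫⁻ z, f z = ∫⁻ x, ∫⁻ y, f (splitCoord L (x, y)) := by
  rw [← (measurePreserving_splitCoord L).lintegral_comp hf]
  exact lintegral_prod _ (hf.comp (measurePreserving_splitCoord L).measurable).aemeasurable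

theorem IsTest.comp_splitCoord_left {L : WithLp 2 (E₁ × E₂) ≃ₗᵢ[ℝ] E} {φ : E → F} (hφ : IsTest φ)
    (y : E₂) : IsTest fun x => φ (splitCoord L (x, y)) := by
  refine ⟨hφ.1.comp ((splitCoord L).contDiff.comp (contDiff_id.prodMk contDiff_const)),
    HasCompactSupport.intro (K := (fun z => ((splitCoord L).symm z).1) '' tsupport φ)
      (hφ.2.image (by fun_prop)) fun x hx => ?_⟩
  by_contra hne
  exact hx ⟨splitCoord L (x, y), subset_tsupport _ hne, by simp⟩

theorem IsTest.comp_splitCoord_right {L : WithLp 2 (E₁ × E₂) ≃ₗᵢ[ℝ] E} {φ : E → F} (hφ : IsTest φ)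
    (x : E₁) : IsTest fun y => φ (splitCoord L (x, y)) := by
  refine ⟨hφ.1.comp ((splitCoord L).contDiff.comp (contDiff_const.prodMk contDiff_id)),
    HasCompactSupport.intro (K := (fun z => ((splitCoord L).symm z).2) '' tsupport φ)
      (hφ.2.image (by fun_prop)) fun y hy => ?_⟩
  by_contra hne
  exact hy ⟨splitCoord L (x, y), subset_tsupport _ hne, by simp⟩

theorem dirDeriv_comp_splitCoord_left (L : WithLp 2 (E₁ × E₂) ≃ₗᵢ[ℝ] E) {φ : E → F}
    (hφ : ContDiff ℝ ∞ φ) (v : E₁) (y : E₂) :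
    dirDeriv v (fun x => φ (splitCoord L (x, y))) =
      fun x => dirDeriv (splitCoord L (v, 0)) φ (splitCoord L (x, y)) := by
  funext x
  have h1 : HasFDerivAt (fun x : E₁ => splitCoord L (x, y))
      ((splitCoord L : E₁ × E₂ →L[ℝ] E).comp (ContinuousLinearMap.inl ℝ E₁ E₂)) x :=
    (splitCoord L).hasFDerivAt.comp x (hasFDerivAt_prodMk_left x y)
  have h2 := (hφ.differentiable (by simp) (splitCoord L (x, y))).hasFDerivAt.comp x h1
  rw [dirDeriv]
  exact congrArg (fun M : E₁ →L[ℝ] F => M v) h2.fderiv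

theorem dirDeriv_comp_splitCoord_right (L : WithLp 2 (E₁ × E₂) ≃ₗᵢ[ℝ] E) {φ : E → F}
    (hφ : ContDiff ℝ ∞ φ) (v : E₂) (x : E₁) :
    dirDeriv v (fun y => φ (splitCoord L (x, y))) =
      fun y => dirDeriv (splitCoord L (0, v)) φ (splitCoord L (x, y)) := by
  funext y
  have h1 : HasFDerivAt (fun y : E₂ => splitCoord L (x, y))
      ((splitCoord L : E₁ × E₂ →L[ℝ] E).comp (ContinuousLinearMap.inr ℝ E₁ E₂)) y :=
    (splitCoord L).hasFDerivAt.comp y (hasFDerivAt_prodMk_right x y)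
  have h2 := (hφ.differentiable (by simp) (splitCoord L (x, y))).hasFDerivAt.comp y h1
  rw [dirDeriv]
  exact congrArg (fun M : E₂ →L[ℝ] F => M v) h2.fderiv

theorem laplacian_splitCoord (L : WithLp 2 (E₁ × E₂) ≃ₗᵢ[ℝ] E) {φ : E → F}
    (hφ : ContDiff ℝ ∞ φ) (x : E₁) (y : E₂) :
    Laplacian.laplacian φ (splitCoord L (x, y)) =
      Laplacian.laplacian (fun x' => φ (splitCoord L (x', y))) x +
        Laplacian.laplacian (fun y' => φ (splitCoord L (x, y'))) y := by
  have hl : ContDiff ℝ ∞ fun x' => φ (splitCoord L (x', y)) :=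
    hφ.comp ((splitCoord L).contDiff.comp (contDiff_id.prodMk contDiff_const))
  have hr : ContDiff ℝ ∞ fun y' => φ (splitCoord L (x, y')) :=
    hφ.comp ((splitCoord L).contDiff.comp (contDiff_const.prodMk contDiff_id))
  rw [laplacian_eq_sum_dirDeriv
    (((stdOrthonormalBasis ℝ E₁).prod (stdOrthonormalBasis ℝ E₂)).map L) hφ,
    laplacian_eq_sum_dirDeriv (stdOrthonormalBasis ℝ E₁) hl,
    laplacian_eq_sum_dirDeriv (stdOrthonormalBasis ℝ E₂) hr, Fintype.sum_sum_type]
  congr 1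
  · refine Finset.sum_congr rfl fun i _ => ?_
    rw [dirDeriv_comp_splitCoord_left L hφ,
      dirDeriv_comp_splitCoord_left L (contDiff_dirDeriv _ hφ)]
    simp [splitCoord_apply, OrthonormalBasis.prod_apply]
  · refine Finset.sum_congr rfl fun i _ => ?_
    rw [dirDeriv_comp_splitCoord_right L hφ,
      dirDeriv_comp_splitCoord_right L (contDiff_dirDeriv _ hφ)]
    simp [splitCoord_apply, OrthonormalBasis.prod_apply]

theorem airy_splitCoord {L : WithLp 2 (E₁ × E₂) ≃ₗᵢ[ℝ] E} {V : E →L[ℝ] F →L[ℂ] F}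
    {V₁ : E₁ →L[ℝ] F →L[ℂ] F} (hV : ∀ x y, V (splitCoord L (x, y)) = V₁ x) {φ : E → F}
    (hφ : ContDiff ℝ ∞ φ) (x : E₁) (y : E₂) :
    airy V φ (splitCoord L (x, y)) = airy V₁ (fun x' => φ (splitCoord L (x', y))) x -
      Laplacian.laplacian (fun y' => φ (splitCoord L (x, y'))) y := by
  rw [airy, airy, laplacian_splitCoord L hφ, hV]
  abel

/-- The functions `η ⊗ φ` in split coordinates. -/
theorem isTest_tensor {L : WithLp 2 (E₁ × E₂) ≃ₗᵢ[ℝ] E} {η : E₂ → ℂ} {φ : E₁ → F} (hη : IsTest η)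
    (hφ : IsTest φ) :
    IsTest fun z => η ((splitCoord L).symm z).2 • φ ((splitCoord L).symm z).1 := by
  have h1 : ContDiff ℝ ∞ fun z => ((splitCoord L).symm z).1 :=
    contDiff_fst.comp (splitCoord L).symm.contDiff
  have h2 : ContDiff ℝ ∞ fun z => ((splitCoord L).symm z).2 :=
    contDiff_snd.comp (splitCoord L).symm.contDiff
  refine ⟨(hη.1.comp h2).smul (hφ.1.comp h1),
    HasCompactSupport.intro (K := splitCoord L '' (tsupport φ ×ˢ tsupport η))
      ((hφ.2.prod hη.2).image (splitCoord L).continuous) fun z hz => ?_⟩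
  by_contra hne
  rw [smul_eq_zero, not_or] at hne
  exact hz ⟨(splitCoord L).symm z, ⟨subset_tsupport _ hne.2, subset_tsupport _ hne.1⟩, by simp⟩

theorem l2norm_tensor {L : WithLp 2 (E₁ × E₂) ≃ₗᵢ[ℝ] E} {η : E₂ → ℂ} {φ : E₁ → F} (hη : IsTest η)
    (hφ : IsTest φ) :
    l2norm (fun z => η ((splitCoord L).symm z).2 • φ ((splitCoord L).symm z).1) =
      l2norm η * l2norm φ := by
  have hT := isTest_tensor (L := L) hη hφ
  have h0 := l2norm_nonneg η
  have h0' := l2norm_nonneg φ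
  rw [← sq_eq_sq₀ (l2norm_nonneg _) (by positivity), mul_pow,
    ← ENNReal.ofReal_eq_ofReal_iff (by positivity) (by positivity),
    ENNReal.ofReal_mul (by positivity), ofReal_l2norm_sq hT.memLp, ofReal_l2norm_sq hη.memLp,
    ofReal_l2norm_sq hφ.memLp,
    lintegral_splitCoord L (hT.1.continuous.enorm.measurable.pow_const 2)]
  simp only [ContinuousLinearEquiv.symm_apply_apply, enorm_smul, mul_pow]
  have h3 : ∀ x, ∫⁻ y, ‖η y‖ₑ ^ 2 * ‖φ x‖ₑ ^ 2 = (∫⁻ y, ‖η y‖ₑ ^ 2) * ‖φ x‖ₑ ^ 2 := fun x =>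
    lintegral_mul_const _ (hη.1.continuous.enorm.measurable.pow_const 2)
  simp only [h3]
  rw [lintegral_const_mul _ (hφ.1.continuous.enorm.measurable.pow_const 2)]

end Split

/-! ### Approximate eigenfunctions of the Laplacian -/

section PlaneWave

variable {E : Type*} [NormedAddCommGroup E] [InnerProductSpace ℝ E]

/-- The plane wave `y ↦ exp (i ⟨p, y⟩)`. -/
noncomputable def planeWave (p y : E) : ℂ := Complex.exp (((inner ℝ p y : ℝ) : ℂ) * Complex.I)

theorem norm_planeWave (p y : E) : ‖planeWave p y‖ = 1 := Complex.norm_exp_ofReal_mul_I _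

theorem contDiff_planeWave (p : E) : ContDiff ℝ ∞ (planeWave p) := by
  unfold planeWave
  have h1 : ContDiff ℝ ∞ fun y : E => (inner ℝ p y : ℝ) := contDiff_const.inner ℝ contDiff_id
  exact ((Complex.ofRealCLM.contDiff.comp h1).mul contDiff_const).cexp

theorem dirDeriv_planeWave [FiniteDimensional ℝ E] (p v : E) :
    dirDeriv v (planeWave p) = (((inner ℝ p v : ℝ) : ℂ) * Complex.I) • planeWave p := by
  funext y
  have h1 : HasFDerivAt (fun y : E => ((inner ℝ p y : ℝ) : ℂ))
      (Complex.ofRealCLM.comp (innerSL ℝ p)) y :=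
    (Complex.ofRealCLM.comp (innerSL ℝ p)).hasFDerivAt
  have h2 := (h1.mul_const Complex.I).cexp
  rw [dirDeriv, show planeWave p = fun y => Complex.exp (((inner ℝ p y : ℝ) : ℂ) * Complex.I)
    from rfl, h2.fderiv]
  simp
  ring

variable [FiniteDimensional ℝ E]

theorem dirDeriv_const_smul {f : E → ℂ} (hf : ContDiff ℝ ∞ f) (c : ℂ) (v : E) :
    dirDeriv v (c • f) = c • dirDeriv v f := by
  funext y
  rw [dirDeriv, fderiv_const_smul (hf.differentiable (by simp) y)]
  rfl

theorem laplacian_planeWave (p y : E) :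
    Laplacian.laplacian (planeWave p) y = -((‖p‖ ^ 2 : ℝ) : ℂ) * planeWave p y := by
  have b := stdOrthonormalBasis ℝ E
  rw [laplacian_eq_sum_dirDeriv b (contDiff_planeWave p), ← b.sum_sq_norm_inner_right p,
    Complex.ofReal_sum, ← Finset.sum_neg_distrib, Finset.sum_mul]
  refine Finset.sum_congr rfl fun i _ => ?_
  rw [dirDeriv_planeWave, dirDeriv_const_smul (contDiff_planeWave p), dirDeriv_planeWave,
    real_inner_comm]
  simp only [Pi.smul_apply, smul_eq_mul, Real.norm_eq_abs, sq_abs, Complex.ofReal_pow]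
  linear_combination ((inner ℝ (b i) p : ℝ) : ℂ) ^ 2 * planeWave p y * Complex.I_sq

variable [MeasurableSpace E] [BorelSpace E]

theorem l2norm_comp_smul {G : Type*} [NormedAddCommGroup G] {f : E → G} (hf : Continuous f)
    (hs : HasCompactSupport f) {a : ℝ} (ha : a ≠ 0) :
    l2norm (fun y => f (a • y)) = √|(a ^ Module.finrank ℝ E)⁻¹| * l2norm f := by
  have h1 : MemLp (fun y => f (a • y)) 2 := by
    refine Continuous.memLp_of_hasCompactSupport (by fun_prop) ?_
    exact hs.comp_homeomorph (Homeomorph.smulOfNeZero a ha)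
  have h2 := l2norm_sq h1
  have h3 := Measure.integral_comp_smul volume (fun y => ‖f y‖ ^ 2) a
  rw [h3, ← l2norm_sq (hf.memLp_of_hasCompactSupport hs), smul_eq_mul] at h2
  rw [← Real.sqrt_sq (l2norm_nonneg _), h2, Real.sqrt_mul (abs_nonneg _),
    Real.sqrt_sq (l2norm_nonneg _)]

/-- Plane waves with a wide cutoff show that `‖p‖²` is in the approximate point spectrum of
`-Δ`. -/
theorem exists_approx_eigenfunction (p : E) {ε : ℝ} (hε : 0 < ε) :
    ∃ η : E → ℂ, IsTest η ∧ 0 < l2norm η ∧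
      l2norm (fun y => Laplacian.laplacian η y + ((‖p‖ ^ 2 : ℝ) : ℂ) • η y) ≤ ε * l2norm η := by
  let b := stdOrthonormalBasis ℝ E
  obtain ⟨χ, hχs, hχc, hχ0⟩ : ∃ χ : E → ℝ, ContDiff ℝ ∞ χ ∧ HasCompactSupport χ ∧ χ 0 = 1 := by
    let χ : ContDiffBump (0 : E) := ⟨1, 2, one_pos, one_lt_two⟩
    exact ⟨χ, χ.contDiff, χ.hasCompactSupport, χ.one_of_mem_closedBall (by simp [χ])⟩
  have hχm : MemLp χ 2 := hχs.continuous.memLp_of_hasCompactSupport hχc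
  have hχpos : 0 < l2norm χ := by
    have h1 : 0 < ∫ y, ‖χ y‖ ^ 2 := by
      refine Continuous.integral_pos_of_hasCompactSupport_nonneg_nonzero (x := 0) ?_ ?_ ?_ ?_
      · have := hχs.continuous
        fun_prop
      · exact hχc.mono fun x hx hx' => hx (by simp [hx'])
      · exact fun x => by positivity
      · simp [hχ0]
    rw [← l2norm_sq hχm] at h1
    exact (l2norm_nonneg χ).lt_of_ne fun h => by simp [← h] at h1
  -- the error for the cutoff `y ↦ χ (a y)` is dominated by `y ↦ a K (a y)`, whose norm scales like
  -- `a ‖K‖`, relative to the norm of the cutoff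
  let K : E → ℝ := fun y => (∑ i, 2 * ‖p‖ * |dirDeriv (b i) χ y|) + |Laplacian.laplacian χ y|
  have hKc : Continuous K := by
    have h1 : ∀ i, Continuous (dirDeriv (b i) χ) := fun i => (contDiff_dirDeriv _ hχs).continuous
    have h2 := (contDiff_laplacian hχs).continuous
    fun_prop
  have hKs : HasCompactSupport K := by
    refine HasCompactSupport.intro hχc fun y hy => ?_
    have h1 : ∀ i, dirDeriv (b i) χ y = 0 := fun i => by
      rw [dirDeriv, fderiv_of_notMem_tsupport ℝ hy]
      rfl
    have h2 : Laplacian.laplacian χ y = 0 := by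
      have : χ =ᶠ[𝓝 y] fun _ => 0 := notMem_tsupport_iff_eventuallyEq.1 hy
      refine (InnerProductSpace.laplacian_congr_nhds this).eq_of_nhds.trans ?_
      rw [InnerProductSpace.laplacian_const]
      rfl
    simp [K, h1, h2]
  have hK0 := l2norm_nonneg K
  let a : ℝ := min 1 (ε * l2norm χ / (l2norm K + 1))
  have ha : 0 < a := lt_min one_pos (by positivity)
  have ha1 : a ≤ 1 := min_le_left _ _
  have haK : a * l2norm K ≤ ε * l2norm χ := by
    have h1 : a * (l2norm K + 1) ≤ ε * l2norm χ :=
      (le_div_iff₀ (by positivity)).1 (min_le_right _ _)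
    nlinarith
  let c : ℝ := √|(a ^ Module.finrank ℝ E)⁻¹|
  have hc : 0 < c := Real.sqrt_pos.2 (by positivity)
  let χa : E → ℝ := fun y => χ (a • y)
  have hχa : ContDiff ℝ ∞ χa := hχs.comp (contDiff_const_smul a)
  have hχac : HasCompactSupport χa := hχc.comp_homeomorph (Homeomorph.smulOfNeZero a ha.ne')
  let η : E → ℂ := fun y => χa y • planeWave p y
  have hη : IsTest η := ⟨hχa.smul (contDiff_planeWave p), hχac.smul_right⟩
  have hηn : l2norm η = c * l2norm χ := by
    rw [← l2norm_comp_smul hχs.continuous hχc ha.ne']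
    refine le_antisymm (l2norm_mono (hχa.continuous.memLp_of_hasCompactSupport hχac) fun y => ?_)
      (l2norm_mono hη.memLp fun y => ?_) <;>
    simp [η, χa, norm_planeWave]
  refine ⟨η, hη, by rw [hηn]; positivity, ?_⟩
  have hKa : MemLp (a • fun y => K (a • y)) 2 := by
    refine MemLp.const_smul (Continuous.memLp_of_hasCompactSupport (by fun_prop) ?_) a
    exact hKs.comp_homeomorph (Homeomorph.smulOfNeZero a ha.ne')
  have hpt : ∀ y, ‖Laplacian.laplacian η y + ((‖p‖ ^ 2 : ℝ) : ℂ) • η y‖ ≤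
      ‖(a • fun y => K (a • y)) y‖ := by
    intro y
    have h1 : Laplacian.laplacian η y + ((‖p‖ ^ 2 : ℝ) : ℂ) • η y =
        (∑ i, (2 * dirDeriv (b i) χa y) • dirDeriv (b i) (planeWave p) y) +
          Laplacian.laplacian χa y • planeWave p y := by
      rw [laplacian_smul_fun hχa (contDiff_planeWave p) b, laplacian_planeWave]
      simp only [η, smul_eq_mul, Complex.real_smul]
      ring
    have hin : ∀ i, |inner ℝ p (b i)| ≤ ‖p‖ := fun i => by
      simpa using abs_real_inner_le_norm p (b i)
    have hK' : 0 ≤ K (a • y) := by positivity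
    rw [h1, Pi.smul_apply, norm_smul, Real.norm_of_nonneg ha.le, Real.norm_of_nonneg hK', mul_add,
      Finset.mul_sum]
    refine (norm_add_le _ _).trans (add_le_add ((norm_sum_le _ _).trans
      (Finset.sum_le_sum fun i _ => ?_)) ?_)
    · rw [dirDeriv_planeWave, norm_smul, Pi.smul_apply, norm_smul, norm_planeWave,
        show dirDeriv (b i) χa y = a * dirDeriv (b i) χ (a • y) from
          congrFun (dirDeriv_comp_smul hχs a _) y]
      simp only [norm_mul, Real.norm_eq_abs, Complex.norm_I, Complex.norm_real, mul_one,
        abs_of_pos ha, abs_two]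
      have := mul_le_mul_of_nonneg_left (hin i)
        (show 0 ≤ 2 * (a * |dirDeriv (b i) χ (a • y)|) by positivity)
      linarith
    · rw [norm_smul, norm_planeWave, laplacian_comp_smul hχs]
      simp only [norm_mul, Real.norm_eq_abs, mul_one, abs_of_pos ha]
      refine mul_le_mul_of_nonneg_left ?_ ha.le
      exact mul_le_of_le_one_left (abs_nonneg _) ha1
  calc l2norm (fun y => Laplacian.laplacian η y + ((‖p‖ ^ 2 : ℝ) : ℂ) • η y)
      ≤ l2norm (a • fun y => K (a • y)) := l2norm_mono hKa hpt
    _ = c * (a * l2norm K) := by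
        rw [l2norm_const_smul, l2norm_comp_smul hKc hKs ha.ne', Real.norm_of_nonneg ha.le]
        ring
    _ ≤ c * (ε * l2norm χ) := by gcongr
    _ = ε * l2norm η := by rw [hηn]; ring

end PlaneWave

/-! ### Lower bounds on test functions -/

section SplitBound

variable {E E₁ E₂ : Type*} [NormedAddCommGroup E] [InnerProductSpace ℝ E] [FiniteDimensional ℝ E]
  [MeasurableSpace E] [BorelSpace E]
  [NormedAddCommGroup E₁] [InnerProductSpace ℝ E₁] [FiniteDimensional ℝ E₁]
  [MeasurableSpace E₁] [BorelSpace E₁]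
  [NormedAddCommGroup E₂] [InnerProductSpace ℝ E₂] [FiniteDimensional ℝ E₂]
  [MeasurableSpace E₂] [BorelSpace E₂]
  {F : Type*} [NormedAddCommGroup F] [InnerProductSpace ℂ F]

/-- The lower bound `‖φ‖ ≤ C ‖(-Δ + V - z) φ‖` for test functions. -/
def TestBound (V : E →L[ℝ] F →L[ℂ] F) (z : ℂ) (C : ℝ) : Prop :=
  ∀ φ : E → F, IsTest φ → l2norm φ ≤ C * l2norm (airy V φ - z • φ)

/-- A lower bound for `-Δ + V - z`, with `V` depending on the variables in `E₁` only, gives one for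
`-Δ + V₁ - (z - ‖p‖²)`: tensor with approximate eigenfunctions of `-Δ` for the value `‖p‖²`. -/
theorem TestBound.of_split {L : WithLp 2 (E₁ × E₂) ≃ₗᵢ[ℝ] E} {V : E →L[ℝ] F →L[ℂ] F}
    {V₁ : E₁ →L[ℝ] F →L[ℂ] F} (hV : ∀ x y, V (splitCoord L (x, y)) = V₁ x) {z : ℂ} {C : ℝ}
    (hC : 0 ≤ C) (h : TestBound V z C) (p : E₂) : TestBound V₁ (z - ((‖p‖ ^ 2 : ℝ) : ℂ)) C := by
  intro φ hφ
  refine le_of_forall_pos_le_add fun δ hδ => ?_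
  have hφ0 := l2norm_nonneg φ
  obtain ⟨η, hη, hηpos, hηε⟩ := exists_approx_eigenfunction p
    (show 0 < δ / (C * l2norm φ + 1) by positivity)
  let w : E₁ → F := airy V₁ φ - (z - ((‖p‖ ^ 2 : ℝ) : ℂ)) • φ
  have hw : IsTest w := ⟨(contDiff_airy V₁ hφ.1).sub (hφ.1.const_smul _),
    (isTest_airy V₁ hφ).2.sub (hφ.2.mono fun x hx hx' => hx (by simp [hx']))⟩
  let θ : E₂ → ℂ := fun y => Laplacian.laplacian η y + ((‖p‖ ^ 2 : ℝ) : ℂ) • η y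
  have hθ : IsTest θ := ⟨(contDiff_laplacian hη.1).add (hη.1.const_smul _),
    hη.2.laplacian.add (hη.2.mono fun x hx hx' => hx (by simp [hx']))⟩
  let Φ : E → F := fun z => η ((splitCoord L).symm z).2 • φ ((splitCoord L).symm z).1
  have hΦ : IsTest Φ := isTest_tensor hη hφ
  have hdec : airy V Φ - z • Φ =
      (fun z => η ((splitCoord L).symm z).2 • w ((splitCoord L).symm z).1) -
        fun z => θ ((splitCoord L).symm z).2 • φ ((splitCoord L).symm z).1 := by
    funext q
    obtain ⟨⟨x, y⟩, rfl⟩ := (splitCoord L).surjective q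
    have h1 : Laplacian.laplacian (fun x' => η y • φ x') x = η y • Laplacian.laplacian φ x :=
      (hφ.1.contDiffAt.of_le (by norm_cast)).laplacian_CLM_comp_left
        (l := η y • ContinuousLinearMap.id ℝ F)
    have h2 : Laplacian.laplacian (fun y' => η y' • φ x) y = Laplacian.laplacian η y • φ x :=
      (hη.1.contDiffAt.of_le (by norm_cast)).laplacian_CLM_comp_left
        (l := (ContinuousLinearMap.toSpanSingleton ℂ (φ x)).restrictScalars ℝ)
    rw [Pi.sub_apply, airy_splitCoord hV hΦ.1]
    simp only [Φ, Pi.smul_apply, Pi.sub_apply, ContinuousLinearEquiv.symm_apply_apply, airy, w, θ,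
      h1, h2, map_smul]
    module
  have h3 := h Φ hΦ
  rw [hdec, show l2norm Φ = l2norm η * l2norm φ from l2norm_tensor hη hφ] at h3
  have h4 := l2norm_sub_le (isTest_tensor (L := L) hη hw).memLp (isTest_tensor (L := L) hθ hφ).memLp
  rw [l2norm_tensor hη hw, l2norm_tensor hθ hφ] at h4
  have h5 : l2norm η * l2norm φ ≤
      l2norm η * (C * l2norm w + C * (δ / (C * l2norm φ + 1) * l2norm φ)) :=
    calc l2norm η * l2norm φ ≤ C * (l2norm η * l2norm w + l2norm θ * l2norm φ) :=
          h3.trans (by gcongr)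
      _ ≤ C * (l2norm η * l2norm w + δ / (C * l2norm φ + 1) * l2norm η * l2norm φ) := by gcongr
      _ = _ := by ring
  refine (le_of_mul_le_mul_left h5 hηpos).trans ?_
  gcongr
  rw [div_mul_eq_mul_div, mul_div_assoc', div_le_iff₀ (by positivity)]
  nlinarith

end SplitBound

/-! ### Partial Fourier transform -/

section PartialFourier

variable {E E₁ E₂ : Type*} [NormedAddCommGroup E] [InnerProductSpace ℝ E] [FiniteDimensional ℝ E]
  [MeasurableSpace E] [BorelSpace E]
  [NormedAddCommGroup E₁] [InnerProductSpace ℝ E₁] [FiniteDimensional ℝ E₁]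
  [MeasurableSpace E₁] [BorelSpace E₁]
  [NormedAddCommGroup E₂] [InnerProductSpace ℝ E₂] [FiniteDimensional ℝ E₂]
  [MeasurableSpace E₂] [BorelSpace E₂]
  {F : Type*} [NormedAddCommGroup F] [InnerProductSpace ℂ F] [FiniteDimensional ℂ F]
  {L : WithLp 2 (E₁ × E₂) ≃ₗᵢ[ℝ] E}

/-- Plancherel's theorem for test functions, with the plane waves `exp (-2πi ⟨ξ, y⟩)`. -/
theorem lintegral_planeWave_transform {f : E₂ → F} (hf : IsTest f) :
    ∫⁻ ξ : E₂, ‖∫ y, planeWave ((-(2 * Real.pi)) • ξ) y • f y‖ₑ ^ 2 = ∫⁻ y, ‖f y‖ₑ ^ 2 := by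
  have : CompleteSpace F := FiniteDimensional.complete ℂ F
  let S : SchwartzMap E₂ F := hf.2.toSchwartzMap hf.1
  have h1 : ∀ ξ : E₂, ∫ y, planeWave ((-(2 * Real.pi)) • ξ) y • f y =
      FourierTransform.fourier S ξ := by
    intro ξ
    rw [SchwartzMap.fourier_coe, Real.fourier_eq']
    refine integral_congr_ae (.of_forall fun y => ?_)
    simp only [planeWave, inner_smul_left, real_inner_comm]
    simp [S]
  simp only [h1]
  have h2 : MemLp (FourierTransform.fourier S) 2 (volume : Measure E₂) :=
    SchwartzMap.memLp _ 2 volume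
  rw [← ofReal_l2norm_sq h2, ← ofReal_l2norm_sq hf.memLp, l2norm_sq h2, l2norm_sq hf.memLp,
    SchwartzMap.integral_norm_sq_fourier]
  rfl

/-- The Fourier transform of `φ` in the variables in `E₂`, with kernel `exp (i ⟨p, y⟩)`. -/
noncomputable def partialFourier (L : WithLp 2 (E₁ × E₂) ≃ₗᵢ[ℝ] E) (φ : E → F) (p : E₂) (x : E₁) :
    F :=
  ∫ y, planeWave p y • φ (splitCoord L (x, y))

theorem integrable_planeWave_smul {φ : E → F} (hφ : IsTest φ) (p : E₂) (x : E₁) :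
    Integrable fun y => planeWave p y • φ (splitCoord L (x, y)) :=
  ((contDiff_planeWave p).continuous.smul
    (hφ.comp_splitCoord_right x).1.continuous).integrable_of_hasCompactSupport
      (hφ.comp_splitCoord_right x).2.smul_left

theorem continuous_partialFourier {φ : E → F} (hφ : IsTest φ) :
    Continuous fun q : E₂ × E₁ => partialFourier L φ q.1 q.2 := by
  let K : Set E₂ := (fun z => ((splitCoord L).symm z).2) '' tsupport φ
  have hK : IsCompact K := hφ.2.image (by fun_prop)
  have h1 : ∀ q : E₂ × E₁, partialFourier L φ q.1 q.2 =
      ∫ y in K, planeWave q.1 y • φ (splitCoord L (q.2, y)) := by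
    intro q
    refine (setIntegral_eq_integral_of_forall_compl_eq_zero fun y hy => ?_).symm
    by_contra hne
    rw [smul_eq_zero, not_or] at hne
    exact hy ⟨splitCoord L (q.2, y), subset_tsupport _ hne.2, by simp⟩
  simp only [h1]
  refine continuous_parametric_integral_of_continuous ?_ hK
  have := hφ.1.continuous
  simp only [planeWave, Function.uncurry_def]
  fun_prop

theorem memLp_partialFourier {φ : E → F} (hφ : IsTest φ) (p : E₂) :
    MemLp (partialFourier L φ p) 2 := by
  refine Continuous.memLp_of_hasCompactSupport
    ((continuous_partialFourier hφ).comp (Continuous.prodMk_right p))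
    (HasCompactSupport.intro (K := (fun z => ((splitCoord L).symm z).1) '' tsupport φ)
      (hφ.2.image (by fun_prop)) fun x hx => ?_)
  refine integral_eq_zero_of_ae (.of_forall fun y => ?_)
  by_contra hne
  exact hx ⟨splitCoord L (x, y), subset_tsupport _ (smul_ne_zero_iff.1 hne).2, by simp⟩

/-- Plancherel's theorem in the variables in `E₂`. -/
theorem lintegral_partialFourier {φ : E → F} (hφ : IsTest φ) :
    ∫⁻ ξ : E₂, ∫⁻ x, ‖partialFourier L φ ((-(2 * Real.pi)) • ξ) x‖ₑ ^ 2 = ∫⁻ z, ‖φ z‖ₑ ^ 2 := by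
  have hc : Continuous fun q : E₂ × E₁ => partialFourier L φ ((-(2 * Real.pi)) • q.1) q.2 :=
    (continuous_partialFourier (L := L) hφ).comp
      ((continuous_fst.const_smul _).prodMk continuous_snd)
  rw [lintegral_lintegral_swap (hc.enorm.measurable.pow_const 2).aemeasurable,
    lintegral_splitCoord L (hφ.1.continuous.enorm.measurable.pow_const 2)]
  exact lintegral_congr fun x => lintegral_planeWave_transform (hφ.comp_splitCoord_right x)

theorem integral_planeWave_smul_laplacian {f : E₂ → F} (hf : IsTest f) (p : E₂) :
    ∫ y, planeWave p y • Laplacian.laplacian f y =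
      -((‖p‖ ^ 2 : ℝ) : ℂ) • ∫ y, planeWave p y • f y := by
  let B : ℂ →L[ℝ] F →L[ℝ] F := ContinuousLinearMap.lsmul ℝ ℂ
  have hB : ∀ (a : ℂ) (x : F), B a x = a • x := fun a x => rfl
  have b := stdOrthonormalBasis ℝ E₂
  have h1 := integral_bilin_laplacian B (contDiff_planeWave p) hf.1 (.inr hf.2) b
  rw [← integral_laplacian_bilin B (contDiff_planeWave p) hf.1 (.inr hf.2) b] at h1
  simp only [hB, laplacian_planeWave] at h1
  rw [h1, ← integral_smul]
  exact integral_congr_ae (.of_forall fun y => mul_smul _ _ _)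

/-- Applying `-Δ + V₁` in the variables in `E₁` only gives a test function on the whole space. -/
theorem exists_isTest_airy_slice {V : E →L[ℝ] F →L[ℂ] F} {V₁ : E₁ →L[ℝ] F →L[ℂ] F}
    (hV : ∀ x y, V (splitCoord L (x, y)) = V₁ x) {φ : E → F} (hφ : IsTest φ) :
    ∃ h : E → F, IsTest h ∧
      ∀ x y, airy V₁ (fun x' => φ (splitCoord L (x', y))) x = h (splitCoord L (x, y)) := by
  let b := stdOrthonormalBasis ℝ E₁
  let e : Fin (Module.finrank ℝ E₁) → E := fun i => splitCoord L (b i, 0)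
  have hs : IsTest fun z => ∑ i, dirDeriv (e i) (dirDeriv (e i) φ) z :=
    ⟨ContDiff.sum fun i _ => ((hφ.dirDeriv (e i)).dirDeriv (e i)).1,
      HasCompactSupport.intro hφ.2 fun z hz => Finset.sum_eq_zero fun i _ =>
        image_eq_zero_of_notMem_tsupport fun hz' => hz
          ((tsupport_fderiv_apply_subset ℝ (e i)).trans
            (tsupport_fderiv_apply_subset ℝ (e i)) hz')⟩
  refine ⟨fun z => -(∑ i, dirDeriv (e i) (dirDeriv (e i) φ) z) + V z (φ z),
    ⟨hs.1.neg.add (hφ.potential V).1, hs.2.neg.add (hφ.potential V).2⟩, fun x y => ?_⟩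
  simp only [airy, hV]
  rw [laplacian_eq_sum_dirDeriv b (hφ.comp_splitCoord_left y).1]
  congr 2
  refine Finset.sum_congr rfl fun i _ => ?_
  rw [dirDeriv_comp_splitCoord_left L hφ.1,
    dirDeriv_comp_splitCoord_left L (contDiff_dirDeriv _ hφ.1)]

theorem integral_planeWave_swap {G : E₁ → E₂ → F} (hG : Continuous (Function.uncurry G))
    (hs : HasCompactSupport (Function.uncurry G)) (p : E₂) :
    ∫ x, ∫ y, planeWave p y • G x y = ∫ y, planeWave p y • ∫ x, G x y := by
  have hi : Integrable (Function.uncurry fun x y => planeWave p y • G x y)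
      ((volume : Measure E₁).prod (volume : Measure E₂)) := by
    refine Continuous.integrable_of_hasCompactSupport ?_ ?_
    · exact ((contDiff_planeWave p).continuous.comp continuous_snd).smul hG
    · exact hs.smul_left (f := fun q : E₁ × E₂ => planeWave p q.2)
  rw [integral_integral_swap hi]
  exact integral_congr_ae (.of_forall fun y => integral_smul _ _)

/-- The partial Fourier transform turns `-Δ + V` into `-Δ + V₁ + ‖p‖²`. It is enough to have this in
the weak sense, so that the integral over `y` need not be differentiated in `x`. -/
theorem weakSol_partialFourier {V : E →L[ℝ] F →L[ℂ] F} {V₁ : E₁ →L[ℝ] F →L[ℂ] F}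
    (hV : ∀ x y, V (splitCoord L (x, y)) = V₁ x) {φ : E → F} (hφ : IsTest φ) (p : E₂) :
    WeakSol V₁ (partialFourier L φ p) fun x =>
      partialFourier L (airy V φ) p x - ((‖p‖ ^ 2 : ℝ) : ℂ) • partialFourier L φ p x := by
  have : CompleteSpace F := FiniteDimensional.complete ℂ F
  intro ψ hψ hψs
  obtain ⟨h, hh, hhV⟩ := exists_isTest_airy_slice hV hφ
  have hpf : ∀ x, partialFourier L (airy V φ) p x - ((‖p‖ ^ 2 : ℝ) : ℂ) • partialFourier L φ p x =
      partialFourier L h p x := by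
    intro x
    rw [sub_eq_add_neg, ← neg_smul, partialFourier, partialFourier, partialFourier,
      ← integral_planeWave_smul_laplacian (hφ.comp_splitCoord_right x) p, ← integral_add
        (integrable_planeWave_smul (isTest_airy V hφ) p x)]
    · refine integral_congr_ae (.of_forall fun y => ?_)
      simp only
      rw [airy_splitCoord hV hφ.1, hhV, ← smul_add, sub_add_cancel]
    · exact ((contDiff_planeWave p).continuous.smul
        (contDiff_laplacian (hφ.comp_splitCoord_right x).1).continuous).integrable_of_hasCompactSupport
          (hφ.comp_splitCoord_right x).2.laplacian.smul_left
  have hφJ : HasCompactSupport fun q : E₁ × E₂ => φ (splitCoord L q) :=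
    hφ.2.comp_homeomorph (splitCoord L).toHomeomorph
  have hhJ : HasCompactSupport fun q : E₁ × E₂ => h (splitCoord L q) :=
    hh.2.comp_homeomorph (splitCoord L).toHomeomorph
  have hl : ∀ x, (-(Laplacian.laplacian ψ x)) • partialFourier L φ p x +
      ψ x • V₁ x (partialFourier L φ p x) =
      ∫ y, planeWave p y • ((-(Laplacian.laplacian ψ x)) • φ (splitCoord L (x, y)) +
        ψ x • V₁ x (φ (splitCoord L (x, y)))) := by
    intro x
    have hi := integrable_planeWave_smul (L := L) hφ p x
    have hi1 : Integrable fun y =>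
        (-(Laplacian.laplacian ψ x)) • planeWave p y • φ (splitCoord L (x, y)) := hi.smul _
    have hi2 : Integrable fun y => ψ x • V₁ x (planeWave p y • φ (splitCoord L (x, y))) :=
      ((V₁ x).integrable_comp hi).smul _
    rw [partialFourier, ← ContinuousLinearMap.integral_comp_comm _ hi, ← integral_smul,
      ← integral_smul, ← integral_add hi1 hi2]
    refine integral_congr_ae (.of_forall fun y => ?_)
    simp only [map_smul]
    rw [smul_add, smul_comm (planeWave p y), smul_comm (planeWave p y)]
  have hr : ∀ x, ψ x • partialFourier L h p x =
      ∫ y, planeWave p y • (ψ x • h (splitCoord L (x, y))) := by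
    intro x
    rw [partialFourier, ← integral_smul]
    exact integral_congr_ae (.of_forall fun y => smul_comm _ _ _)
  simp only [hpf, hl, hr]
  have hψc := hψ.continuous
  have hΔc := (contDiff_laplacian hψ).continuous
  have hφc := hφ.1.continuous.comp (splitCoord L).continuous
  have hhc := hh.1.continuous.comp (splitCoord L).continuous
  rw [integral_planeWave_swap (G := fun x y => (-(Laplacian.laplacian ψ x)) • φ (splitCoord L (x, y)) +
        ψ x • V₁ x (φ (splitCoord L (x, y)))),
    integral_planeWave_swap (G := fun x y => ψ x • h (splitCoord L (x, y)))]
  · refine integral_congr_ae (.of_forall fun y => ?_)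
    simp only
    rw [weakSol_airy V₁ (hφ.comp_splitCoord_left (L := L) y).1 ψ hψ hψs]
    simp only [hhV]
  · exact (hψc.comp continuous_fst).smul hhc
  · exact hhJ.mono fun q hq hq' => hq (by simp_all [Function.uncurry_def])
  · exact ((hΔc.comp continuous_fst).neg.smul hφc).add
      ((hψc.comp continuous_fst).smul ((V₁.continuous.comp continuous_fst).clm_apply hφc))
  · exact hφJ.mono fun q hq hq' => hq (by simp_all [Function.uncurry_def])

/-- After a partial Fourier transform the operator is the direct integral of the operators
`-Δ + V₁ + ‖p‖²`, so a lower bound for these that is uniform in `p` is one for the operator. -/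
theorem TestBound.of_forall_split {V : E →L[ℝ] F →L[ℂ] F}
    {V₁ : E₁ →L[ℝ] F →L[ℂ] F} (hV : ∀ x y, V (splitCoord L (x, y)) = V₁ x) {z : ℂ} {C : ℝ}
    (hC : 0 ≤ C) (h : ∀ p : E₂, TestBound V₁ (z - ((‖p‖ ^ 2 : ℝ) : ℂ)) C) : TestBound V z C := by
  intro φ hφ
  let w : E → F := airy V φ - z • φ
  have ha := isTest_airy V hφ
  have hw : IsTest w := ⟨ha.1.sub (hφ.1.const_smul _),
    ha.2.sub (hφ.2.mono fun x hx hx' => hx (by simp [hx']))⟩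
  have hp : ∀ p : E₂, l2norm (partialFourier L φ p) ≤ C * l2norm (partialFourier L w p) := by
    intro p
    have hf := memLp_partialFourier (L := L) hφ p
    have h1 := (weakSol_partialFourier hV hφ p).l2norm_le_of_test hC (h p) hf
      ((memLp_partialFourier ha p).sub (hf.const_smul _))
    refine h1.trans_eq ?_
    congr 2
    funext x
    have hi : Integrable fun y => z • planeWave p y • φ (splitCoord L (x, y)) :=
      (integrable_planeWave_smul hφ p x).smul z
    have h2 : partialFourier L w p x =
        partialFourier L (airy V φ) p x - z • partialFourier L φ p x := by
      rw [partialFourier, partialFourier, partialFourier, ← integral_smul, ← integral_sub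
        (integrable_planeWave_smul ha p x) hi]
      refine integral_congr_ae (.of_forall fun y => ?_)
      simp only [w, Pi.sub_apply, Pi.smul_apply]
      rw [smul_sub, smul_comm z]
    rw [h2]
    simp only [Pi.sub_apply, Pi.smul_apply]
    module
  have hφ0 := l2norm_nonneg φ
  have hw0 := l2norm_nonneg w
  rw [← sq_le_sq₀ hφ0 (by positivity), mul_pow,
    ← ENNReal.ofReal_le_ofReal_iff (by positivity), ENNReal.ofReal_mul (by positivity),
    ofReal_l2norm_sq hφ.memLp, ofReal_l2norm_sq hw.memLp, ← lintegral_partialFourier (L := L) hφ,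
    ← lintegral_partialFourier (L := L) hw, ← lintegral_const_mul' _ _ ENNReal.ofReal_ne_top]
  refine lintegral_mono fun ξ => ?_
  rw [← ofReal_l2norm_sq (memLp_partialFourier hφ _), ← ofReal_l2norm_sq (memLp_partialFourier hw _),
    ← ENNReal.ofReal_mul (by positivity), ← mul_pow]
  exact ENNReal.ofReal_le_ofReal (pow_le_pow_left₀ (l2norm_nonneg _) (hp _) 2)

end PartialFourier

/-! ### The spectrum of a split operator -/

section UniformBound

variable {d D : ℕ} {g : ℝ} {W : Matrix (Fin D) (Fin d) ℝ}

theorem TestBound.boundedBelowAt {z : ℂ} {C : ℝ} (hC : 0 ≤ C) (h : TestBound (potL g W) z C) :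
    BoundedBelowAt (airyOp g W) z :=
  boundedBelowAt_airyOp g W fun _ _ hu hf huf => huf.l2norm_le_of_test hC h hu hf

theorem testBound_of_forall_graph {z : ℂ} {C : ℝ}
    (h : ∀ u f, (u, f) ∈ (airyOp g W).graph → ‖u‖ ≤ C * ‖f - z • u‖) :
    TestBound (potL g W) z C := by
  intro φ hφ
  have ha := (isTest_airy (potL g W) hφ).memLp
  have h1 := h (hφ.memLp.toLp φ) (ha.toLp _) (by
    rw [mem_graph_iff_weakSol]
    exact (weakSol_airy (potL g W) hφ.1).congr hφ.memLp.coeFn_toLp.symm ha.coeFn_toLp.symm)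
  rwa [← MemLp.toLp_const_smul, ← MemLp.toLp_sub ha (hφ.memLp.const_smul z), norm_toLp_eq_l2norm,
    norm_toLp_eq_l2norm] at h1

/-- The constant in the lower bound can be chosen uniformly along the half-line `z - ‖p‖²`: by
compactness for bounded `p`, and by accretivity for large `p`. -/
theorem exists_uniform_testBound {E₂ : Type*} [NormedAddCommGroup E₂] [InnerProductSpace ℝ E₂]
    [FiniteDimensional ℝ E₂] {z : ℂ}
    (h : ∀ p : E₂, BoundedBelowAt (airyOp g W) (z - ((‖p‖ ^ 2 : ℝ) : ℂ))) :
    ∃ C : ℝ, 0 ≤ C ∧ ∀ p : E₂, TestBound (potL g W) (z - ((‖p‖ ^ 2 : ℝ) : ℂ)) C := by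
  -- for `‖p‖ > R` the real part of `z - ‖p‖²` is at most `-1`
  let R : ℝ := |z.re| + 1
  have hR : 1 ≤ R := by
    have := abs_nonneg z.re
    simp only [R]
    linarith
  have hK : ∃ C : ℝ, 0 ≤ C ∧ ∀ p ∈ closedBall (0 : E₂) R,
      TestBound (potL g W) (z - ((‖p‖ ^ 2 : ℝ) : ℂ)) C := by
    refine (isCompact_closedBall (0 : E₂) R).induction_on
      (p := fun s => ∃ C : ℝ, 0 ≤ C ∧ ∀ p ∈ s, TestBound (potL g W) (z - ((‖p‖ ^ 2 : ℝ) : ℂ)) C)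
      ⟨0, le_rfl, fun p hp => hp.elim⟩ ?_ ?_ ?_
    · rintro s t hst ⟨C, hC, hCt⟩
      exact ⟨C, hC, fun p hp => hCt p (hst hp)⟩
    · rintro s t ⟨C, hC, hCs⟩ ⟨C', hC', hCt⟩
      refine ⟨max C C', le_max_of_le_left hC, fun p hp φ hφ => ?_⟩
      rcases hp with hp | hp
      · exact (hCs p hp φ hφ).trans
          (mul_le_mul_of_nonneg_right (le_max_left _ _) (l2norm_nonneg _))
      · exact (hCt p hp φ hφ).trans
          (mul_le_mul_of_nonneg_right (le_max_right _ _) (l2norm_nonneg _))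
    · intro p _
      obtain ⟨C₀, hC₀⟩ := h p
      obtain ⟨C, hC, hCb⟩ : ∃ C : ℝ, 0 < C ∧
          TestBound (potL g W) (z - ((‖p‖ ^ 2 : ℝ) : ℂ)) C := by
        refine ⟨max C₀ 1, lt_max_of_lt_right one_pos, fun φ hφ =>
          (testBound_of_forall_graph hC₀ φ hφ).trans
            (mul_le_mul_of_nonneg_right (le_max_left _ _) (l2norm_nonneg _))⟩
      -- a shift of the spectral parameter by less than `1 / (2 * C)` costs at most a factor `2`
      refine ⟨{q | |‖q‖ ^ 2 - ‖p‖ ^ 2| < 1 / (2 * C)}, mem_nhdsWithin_of_mem_nhds ?_, 2 * C,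
        by positivity, fun q hq φ hφ => ?_⟩
      · have hc : Continuous fun q : E₂ => |‖q‖ ^ 2 - ‖p‖ ^ 2| := by fun_prop
        exact (isOpen_lt hc continuous_const).mem_nhds
          (by simp only [Set.mem_ofPred_eq, sub_self, abs_zero]; positivity)
      · have hq' : C * |‖q‖ ^ 2 - ‖p‖ ^ 2| ≤ 1 / 2 := by
          have := mul_le_mul_of_nonneg_left (Set.mem_ofPred_eq ▸ hq : _ < _).le hC.le
          refine this.trans_eq ?_
          field_simp
        have ha := (isTest_airy (potL g W) hφ).memLp
        have h1 : airy (potL g W) φ - (z - ((‖p‖ ^ 2 : ℝ) : ℂ)) • φ =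
            (airy (potL g W) φ - (z - ((‖q‖ ^ 2 : ℝ) : ℂ)) • φ) +
              ((‖p‖ ^ 2 - ‖q‖ ^ 2 : ℝ) : ℂ) • φ := by
          rw [Complex.ofReal_sub]
          module
        have h2 := hCb φ hφ
        rw [h1] at h2
        have h3 := h2.trans (mul_le_mul_of_nonneg_left (l2norm_add_le
          (ha.sub (hφ.memLp.const_smul (z - ((‖q‖ ^ 2 : ℝ) : ℂ)))) (hφ.memLp.const_smul _)) hC.le)
        rw [l2norm_const_smul, Complex.norm_real, Real.norm_eq_abs, abs_sub_comm, mul_add,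
          ← mul_assoc] at h3
        have h4 := mul_le_mul_of_nonneg_right hq' (l2norm_nonneg φ)
        linarith
  obtain ⟨C, hC, hCK⟩ := hK
  refine ⟨max C 1, le_max_of_le_left hC, fun p φ hφ => ?_⟩
  have hl := l2norm_nonneg (airy (potL g W) φ - (z - ((‖p‖ ^ 2 : ℝ) : ℂ)) • φ)
  by_cases hp : p ∈ closedBall (0 : E₂) R
  · exact (hCK p hp φ hφ).trans (mul_le_mul_of_nonneg_right (le_max_left _ _) hl)
  · rw [mem_closedBall_zero_iff, not_le] at hp
    have h1 : 1 ≤ -(z - ((‖p‖ ^ 2 : ℝ) : ℂ)).re := by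
      rw [Complex.sub_re, Complex.ofReal_re]
      have h2 : R ≤ ‖p‖ ^ 2 := by nlinarith
      have h3 := le_abs_self z.re
      simp only [R] at h2
      linarith
    have h4 := neg_re_mul_l2norm_le (isSkew_potL g W) hφ (z - ((‖p‖ ^ 2 : ℝ) : ℂ))
    have h5 := mul_le_mul_of_nonneg_right h1 (l2norm_nonneg φ)
    have h6 := mul_le_mul_of_nonneg_right (le_max_right C 1) hl
    linarith

end UniformBound

section SplitMatrix

variable {d D r k : ℕ} {g : ℝ}

/-- The potential depends on the position only through `W A`. -/
theorem potL_congr {d' : ℕ} {W : Matrix (Fin D) (Fin d) ℝ} {W' : Matrix (Fin D) (Fin d') ℝ}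
    {A : EuclideanSpace ℝ (Fin d)} {A' : EuclideanSpace ℝ (Fin d')}
    (h : W *ᵥ A.ofLp = W' *ᵥ A'.ofLp) : potL g W A = potL g W' A' := by
  have h1 : cliffordPotential g W A = cliffordPotential g W' A' := by
    simp only [cliffordPotential, ← Finset.sum_smul, ← Complex.ofReal_sum]
    congr 1
    refine Finset.sum_congr rfl fun i _ => ?_
    congr 2
    exact congrFun h i
  ext1 ψ
  rw [potL_apply, potL_apply, h1]

/-- If `W` vanishes on the second summand of an orthogonal splitting, lower bounds at `z` are lower
bounds of the reduced operator on the whole half-line `z - ‖p‖²`. -/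
theorem boundedBelowAt_split_iff {W : Matrix (Fin D) (Fin d) ℝ} {W₁ : Matrix (Fin D) (Fin r) ℝ}
    (L : WithLp 2 (EuclideanSpace ℝ (Fin r) × EuclideanSpace ℝ (Fin k)) ≃ₗᵢ[ℝ]
      EuclideanSpace ℝ (Fin d))
    (hL : ∀ x y, W *ᵥ (splitCoord L (x, y)).ofLp = W₁ *ᵥ x.ofLp) (z : ℂ) :
    BoundedBelowAt (airyOp g W) z ↔ ∀ p : EuclideanSpace ℝ (Fin k),
      BoundedBelowAt (airyOp g W₁) (z - ((‖p‖ ^ 2 : ℝ) : ℂ)) := by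
  have hV : ∀ x y, potL g W (splitCoord L (x, y)) = potL g W₁ x := fun x y =>
    potL_congr (hL x y)
  constructor
  · rintro ⟨C₀, hC₀⟩ p
    have h1 : TestBound (potL g W) z (max C₀ 0) := fun φ hφ =>
      (testBound_of_forall_graph hC₀ φ hφ).trans
        (mul_le_mul_of_nonneg_right (le_max_left _ _) (l2norm_nonneg _))
    exact (h1.of_split hV (le_max_right _ _) p).boundedBelowAt (le_max_right _ _)
  · intro h
    obtain ⟨C, hC, hCb⟩ := exists_uniform_testBound h
    exact (TestBound.of_forall_split hV hC hCb).boundedBelowAt hC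

/-- The variables on which the potential does not depend add `[0, ∞)` to the spectrum. -/
theorem opSpectrum_split {W : Matrix (Fin D) (Fin d) ℝ} {W₁ : Matrix (Fin D) (Fin r) ℝ}
    (L : WithLp 2 (EuclideanSpace ℝ (Fin r) × EuclideanSpace ℝ (Fin k)) ≃ₗᵢ[ℝ]
      EuclideanSpace ℝ (Fin d))
    (hL : ∀ x y, W *ᵥ (splitCoord L (x, y)).ofLp = W₁ *ᵥ x.ofLp) :
    opSpectrum (airyOp g W) = {w | ∃ w' ∈ opSpectrum (airyOp g W₁),
      ∃ p : EuclideanSpace ℝ (Fin k), w = w' + ((‖p‖ ^ 2 : ℝ) : ℂ)} := by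
  have hL' : ∀ x y, (-W) *ᵥ (splitCoord L (x, y)).ofLp = (-W₁) *ᵥ x.ofLp := fun x y => by
    rw [Matrix.neg_mulVec, Matrix.neg_mulVec, hL]
  have key : ∀ w, w ∉ opSpectrum (airyOp g W) ↔ ∀ p : EuclideanSpace ℝ (Fin k),
      w - ((‖p‖ ^ 2 : ℝ) : ℂ) ∉ opSpectrum (airyOp g W₁) := by
    intro w
    simp only [notMem_opSpectrum_airyOp_iff, boundedBelowAt_split_iff L hL,
      boundedBelowAt_split_iff L hL', map_sub, Complex.conj_ofReal]
    exact forall_and.symm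
  ext w
  rw [← not_iff_not, key]
  simp only [Set.mem_ofPred_eq, not_exists, not_and]
  constructor
  · rintro h w' hw' p rfl
    exact h p (by rwa [add_sub_cancel_right])
  · intro h p hp
    exact h _ hp p (by rw [sub_add_cancel])

theorem mulVec_injective_of_le_rank {W : Matrix (Fin D) (Fin d) ℝ} (h : d ≤ W.rank) :
    Function.Injective W.mulVec := by
  have h1 := W.mulVecLin.finrank_range_add_finrank_ker
  rw [Module.finrank_fin_fun] at h1
  have h2 : Module.finrank ℝ W.mulVecLin.ker = 0 := by
    rw [Matrix.rank] at h
    omega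
  exact LinearMap.ker_eq_bot.1 (Submodule.finrank_eq_zero.1 h2)

/-- Orthonormal coordinates adapted to the orthogonal sum of the column space of `B` and its
complement, on which `W = W B Bᵀ` vanishes. -/
theorem exists_split_isometry {W : Matrix (Fin D) (Fin d) ℝ} {B : Matrix (Fin d) (Fin r) ℝ}
    (hB : Bᵀ * B = 1) (hW : W * B * Bᵀ = W) :
    ∃ L : WithLp 2 (EuclideanSpace ℝ (Fin r) × EuclideanSpace ℝ (Fin (d - r))) ≃ₗᵢ[ℝ]
      EuclideanSpace ℝ (Fin d), ∀ x y, W *ᵥ (splitCoord L (x, y)).ofLp = (W * B) *ᵥ x.ofLp := by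
  let b : EuclideanSpace ℝ (Fin r) →ₗ[ℝ] EuclideanSpace ℝ (Fin d) := B.toEuclideanLin
  have hb : ∀ x, (b x).ofLp = B *ᵥ x.ofLp := fun x => by simp [b]
  have hinner : ∀ (x : EuclideanSpace ℝ (Fin r)) (w : EuclideanSpace ℝ (Fin d)),
      inner ℝ (b x) w = x.ofLp ⬝ᵥ (Bᵀ *ᵥ w.ofLp) := by
    intro x w
    rw [EuclideanSpace.inner_eq_star_dotProduct, hb, star_trivial,
      Matrix.dotProduct_mulVec, Matrix.mulVec_transpose, dotProduct_comm]
  have hnorm : ∀ x, ‖b x‖ ^ 2 = ‖x‖ ^ 2 := by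
    intro x
    rw [← real_inner_self_eq_norm_sq, hinner, hb, Matrix.mulVec_mulVec, hB, Matrix.one_mulVec,
      ← real_inner_self_eq_norm_sq, EuclideanSpace.inner_eq_star_dotProduct, star_trivial]
  have hinj : Function.Injective b := by
    rw [injective_iff_map_eq_zero]
    intro x hx
    have := hnorm x
    rw [hx, norm_zero] at this
    simpa using this.symm
  have hfr : Module.finrank ℝ b.range = r := by
    rw [LinearMap.finrank_range_of_inj hinj, finrank_euclideanSpace_fin]
  have hsum := b.range.finrank_add_finrank_orthogonal
  rw [hfr, finrank_euclideanSpace_fin] at hsum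
  have hfr' : Module.finrank ℝ b.rangeᗮ = d - r := by omega
  let c : EuclideanSpace ℝ (Fin (d - r)) ≃ₗᵢ[ℝ] b.rangeᗮ :=
    ((stdOrthonormalBasis ℝ b.rangeᗮ).reindex (finCongr hfr')).repr.symm
  have hc : ∀ y, Bᵀ *ᵥ ((c y : b.rangeᗮ) : EuclideanSpace ℝ (Fin d)).ofLp = 0 := by
    intro y
    refine dotProduct_eq_zero _ fun x => ?_
    rw [dotProduct_comm]
    have := (Submodule.mem_orthogonal _ _).1 (c y).2 (b (WithLp.toLp 2 x)) ⟨_, rfl⟩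
    rwa [hinner] at this
  let Λ : WithLp 2 (EuclideanSpace ℝ (Fin r) × EuclideanSpace ℝ (Fin (d - r))) →ₗᵢ[ℝ]
      EuclideanSpace ℝ (Fin d) :=
    { toFun := fun q => b q.fst + (c q.snd : EuclideanSpace ℝ (Fin d))
      map_add' := fun q q' => by
        simp only [WithLp.add_fst, WithLp.add_snd, map_add, Submodule.coe_add]
        abel
      map_smul' := fun t q => by
        simp only [WithLp.smul_fst, WithLp.smul_snd, map_smul, Submodule.coe_smul, smul_add,
          RingHom.id_apply]
      norm_map' := fun q => by
        have h0 : inner ℝ (b q.fst) (c q.snd : EuclideanSpace ℝ (Fin d)) = (0 : ℝ) :=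
          (Submodule.mem_orthogonal _ _).1 (c q.snd).2 _ ⟨_, rfl⟩
        rw [← sq_eq_sq₀ (norm_nonneg _) (norm_nonneg _), WithLp.prod_norm_sq_eq_of_L2]
        change ‖b q.fst + (c q.snd : EuclideanSpace ℝ (Fin d))‖ ^ 2 = _
        rw [norm_add_sq_real, h0, hnorm, ← Submodule.coe_norm, c.norm_map]
        ring }
  have hdim : Module.finrank ℝ
      (WithLp 2 (EuclideanSpace ℝ (Fin r) × EuclideanSpace ℝ (Fin (d - r)))) =
      Module.finrank ℝ (EuclideanSpace ℝ (Fin d)) := by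
    rw [(WithLp.linearEquiv 2 ℝ _).finrank_eq, Module.finrank_prod]
    simp only [finrank_euclideanSpace_fin]
    omega
  refine ⟨Λ.toLinearIsometryEquiv hdim, fun x y => ?_⟩
  have h1 : (splitCoord (Λ.toLinearIsometryEquiv hdim) (x, y)).ofLp =
      B *ᵥ x.ofLp + ((c y : b.rangeᗮ) : EuclideanSpace ℝ (Fin d)).ofLp := by
    rw [← hb]
    rfl
  rw [h1, Matrix.mulVec_add, Matrix.mulVec_mulVec]
  nth_rewrite 2 [← hW]
  rw [← Matrix.mulVec_mulVec _ (W * B) Bᵀ, hc, Matrix.mulVec_zero, add_zero]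

end SplitMatrix

/-! ### The spectrum of the matrix-valued Airy operator -/

theorem lemma1 (D : ℕ) (g : ℝ) (hg : g ≠ 0) (m : ℝ) (mij mt : Matrix (Fin D) (Fin D) ℝ)
    (hmt : mt = m • (1 : Matrix (Fin D) (Fin D) ℝ) + mij) :
    -- the spectrum is bounded from below
    SpectrumBoundedBelow (airyOp g mt) ∧
    -- it is discrete for non-vanishing `m` and antisymmetric `m_ij`
    (m ≠ 0 → mijᵀ = -mij → HasDiscreteSpectrum (airyOp g mt)) ∧
    -- it is discrete whenever `mt` has full rank
    (mt.rank = D → HasDiscreteSpectrum (airyOp g mt)) ∧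
    -- for general `mt`, in orthonormal coordinates of the orthogonal complement of the kernel of
    -- `mt` (the columns of `B`), the operator has discrete spectrum bounded from below, and the
    -- remaining `D - rank mt` coordinates add the continuous part `|p|²`
    (∀ B : Matrix (Fin D) (Fin mt.rank) ℝ, Bᵀ * B = 1 → mt * B * Bᵀ = mt →
      HasDiscreteSpectrum (airyOp g (mt * B)) ∧ SpectrumBoundedBelow (airyOp g (mt * B)) ∧
      opSpectrum (airyOp g mt) = {w | ∃ w' ∈ opSpectrum (airyOp g (mt * B)),
        ∃ p : EuclideanSpace ℝ (Fin (D - mt.rank)), w = w' + ((‖p‖ ^ 2 : ℝ) : ℂ)}) := by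
  refine ⟨spectrumBoundedBelow_airyOp g mt, fun hm has => ?_, fun hr => ?_, fun B hB hmB => ?_⟩
  · -- `x ⬝ᵥ mt x = m |x|²`, since the antisymmetric part does not contribute
    refine hasDiscreteSpectrum_airyOp hg ?_
    refine (injective_iff_map_eq_zero mt.mulVecLin).2 fun x hx => ?_
    rw [Matrix.mulVecLin_apply] at hx
    have h1 : x ⬝ᵥ mij *ᵥ x = 0 := by
      have h2 : x ⬝ᵥ mij *ᵥ x = -(x ⬝ᵥ mij *ᵥ x) := by
        conv_lhs => rw [Matrix.dotProduct_mulVec, ← Matrix.mulVec_transpose, has,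
          Matrix.neg_mulVec, neg_dotProduct, dotProduct_comm]
      linarith
    have h3 : x ⬝ᵥ mt *ᵥ x = m * (x ⬝ᵥ x) := by
      rw [hmt, Matrix.add_mulVec, dotProduct_add, h1, Matrix.smul_mulVec, Matrix.one_mulVec,
        dotProduct_smul, smul_eq_mul, add_zero]
    rw [hx, dotProduct_zero] at h3
    exact dotProduct_self_eq_zero.1 ((mul_eq_zero.1 h3.symm).resolve_left hm)
  · exact hasDiscreteSpectrum_airyOp hg (mulVec_injective_of_le_rank hr.ge)
  · have hrank : mt.rank ≤ (mt * B).rank := by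
      conv_lhs => rw [← hmB]
      exact Matrix.rank_mul_le_left _ _
    obtain ⟨L, hL⟩ := exists_split_isometry hB hmB
    exact ⟨hasDiscreteSpectrum_airyOp hg (mulVec_injective_of_le_rank hrank),
      spectrumBoundedBelow_airyOp g _, opSpectrum_split L hL⟩
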